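/- **Proposition 1.** Let $M$ be an oriented smooth $7$-manifold with a $G_2$-structure, i.e. a smooth $3$-form $\varphi$ which is positive at each point: $(i_u\varphi)^2\wedge\varphi>0$ for every non-zero tangent vector $u$. Let $g_\varphi$ be the induced Riemannian metric, i.e. the metric in the conformal class defined by $u\mapsto (i_u\varphi)^2\wedge\varphi$ with $|\varphi|^2_{g_\varphi}=7$; $\varphi$ is called torsion-free if $\nabla\varphi=0$ for the Levi-Civita connection $\nabla$ of $g_\varphi$. Let $N\to M$ be a smoothly immersed (e.g. embedded) hypersurface with smooth unit normal field $\nu$, oriented so that $(\nu,\text{positive frame of }N)$ is a positive frame of $M$. Put $\rho=\varphi|_N$ and $\omega=(i_\nu\varphi)|_N$. Let $I=I_\rho$ be the almost-complex structure on $N$, compatible with the orientation, for which $\rho$ is the real part of a form of type $(3,0)$; let $\tilde\rho$ be the real $3$-form such that $\rho+i\tilde\rho$ has type $(3,0)$, and let $\mathrm{vol}=\frac14\rho\wedge\tilde\rho$, a nowhere vanishing $6$-form. Let $B(X,Y)=g_\varphi(\nabla_XY,\nu)$ be the second fundamental form of $N$ with respect to $\nu$ (with this sign), $\mu=\operatorname{tr}B$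 the mean curvature with respect to $\nu$, $B_{1,1}(X,Y)=\frac12\big(B(X,Y)+B(IX,IY)\big)$, and $\beta_{1,1}(X,Y)=B_{1,1}(IX,Y)$ the corresponding $(1,1)$-form. 1. If $\varphi$ is torsion-free, then at every point of $N$ $$\beta_{1,1}\wedge\omega=\tfrac12\,d\tilde\rho ,\qquad \mu=\tfrac12\,(d\tilde\rho\wedge\omega)\,\mathrm{vol}^{-1}.$$ In particular, if $\rho$ is mean-convex, then $\mu>0$ everywhere on $N$. Here $\rho$ is mean-convex if at each point $d\tilde\rho$ is semi-positive, i.e. equals $-\frac14(\lambda_1 dz_2d\bar z_2dz_3d\bar z_3+\lambda_2 dz_3d\bar z_3dz_1d\bar z_1+\lambda_3 dz_1d\bar z_1dz_2d\bar z_2)$ in suitable $I$-complex linear coordinates $z_1,z_2,z_3$ on the tangent space, with all $\lambda_i\ge 0$ and at least one $\lambda_i>0$. 2. If $\varphi$ is only assumed to be closed ($d\varphi=0$), the formula $\mu=\frac12\,(d\tilde\rho\wedge\omega)\,\mathrm{vol}^{-1}$ still holds. -/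

import Mathlib

open scoped Manifold ContDiff

noncomputable section

namespace G2Geometry

/-! ### Exterior algebra of a real vector space -/

section LinearAlgebra

variable {V : Type*} [AddCommGroup V] [Module ℝ V]

/-- The wedge product of two alternating forms, as a sum over shuffles
(so that `(dx ∧ dy)(∂x, ∂y) = 1`). -/
def wedge {m n : ℕ} (α : V [⋀^Fin m]→ₗ[ℝ] ℝ) (β : V [⋀^Fin n]→ₗ[ℝ] ℝ) :
    V [⋀^Fin (m + n)]→ₗ[ℝ] ℝ :=
  ((LinearMap.mul' ℝ ℝ).compAlternatingMap (α.domCoprod β)).domDomCongr finSumFinEquiv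

/-- A linear functional as an alternating `1`-form. -/
def oneForm (θ : V →ₗ[ℝ] ℝ) : V [⋀^Fin 1]→ₗ[ℝ] ℝ :=
  AlternatingMap.ofSubsingleton ℝ V ℝ (0 : Fin 1) θ

/-- The `7`-form `(i_u φ) ∧ (i_u φ) ∧ φ` attached to a `3`-form `φ` and a vector `u`. -/
def contractionCube (φ : V [⋀^Fin 3]→ₗ[ℝ] ℝ) (u : V) : V [⋀^Fin 7]→ₗ[ℝ] ℝ :=
  wedge (wedge (φ.curryLeft u) (φ.curryLeft u)) φ

/-- A `3`-form on an oriented `7`-dimensional space is positive if `(i_u φ)² ∧ φ > 0` for every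
non-zero vector `u`. -/
def IsPositiveForm (o : Orientation ℝ V (Fin 7)) (φ : V [⋀^Fin 3]→ₗ[ℝ] ℝ) : Prop :=
  ∀ u : V, u ≠ 0 → ∀ b : Module.Basis (Fin 7) ℝ V, b.orientation = o →
    0 < contractionCube φ u b

/-- The family `e` is orthonormal for the bilinear form `g`. -/
def IsOrthonormalFrame {n : ℕ} (g : V →ₗ[ℝ] V →ₗ[ℝ] ℝ) (e : Fin n → V) : Prop :=
  ∀ i j, g (e i) (e j) = if i = j then 1 else 0

/-- `g` is the Euclidean structure induced by the positive `3`-form `φ` on a `7`-dimensional space: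
it lies in the conformal class given by `u ↦ (i_u φ)² ∧ φ`, and it is normalized by `|φ|² = 7`,
where `|φ|² = ∑_{i<j<k} φ(eᵢ, eⱼ, eₖ)²` in an orthonormal frame. -/
structure IsInducedMetric (φ : V [⋀^Fin 3]→ₗ[ℝ] ℝ) (g : V →ₗ[ℝ] V →ₗ[ℝ] ℝ) : Prop where
  symm : ∀ u v, g u v = g v u
  pos : ∀ u, u ≠ 0 → 0 < g u u
  conformal : ∃ τ : V [⋀^Fin 7]→ₗ[ℝ] ℝ, ∀ u, contractionCube φ u = g u u • τ
  norm_sq : ∀ e : Fin 7 → V, IsOrthonormalFrame g e →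
    (1 / 6 : ℝ) * ∑ i, ∑ j, ∑ k, φ ![e i, e j, e k] ^ 2 = 7

/-- The Euclidean structure `g_φ` of a positive `3`-form `φ`. -/
def inducedMetric (φ : V [⋀^Fin 3]→ₗ[ℝ] ℝ) : V →ₗ[ℝ] V →ₗ[ℝ] ℝ :=
  Classical.epsilon (IsInducedMetric φ)

/-- The trace of a bilinear form `B` with respect to the Euclidean structure `g` on an
`n`-dimensional space: `∑ B(eᵢ, eᵢ)` in an orthonormal frame. -/
def metricTrace (n : ℕ) (g : V →ₗ[ℝ] V →ₗ[ℝ] ℝ) (B : V → V → ℝ) : ℝ :=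
  ∑ i, B (Classical.epsilon (IsOrthonormalFrame (n := n) g) i)
    (Classical.epsilon (IsOrthonormalFrame (n := n) g) i)

/-- The orientation of a hyperplane, given as the set of its positively oriented bases: the
hyperplane is the image of `L : W → V`, co-oriented by the transverse vector `ν` of the oriented
space `V`. A basis `b` is positive if `(ν, L b₀, …, L b₅)` is. (In this dimension
`(L b₀, …, L b₅, ν)` gives the same orientation.) -/
def positiveBases {W : Type*} [AddCommGroup W] [Module ℝ W] (o : Orientation ℝ V (Fin 7))
    (L : W →ₗ[ℝ] V) (ν : V) : Set (Module.Basis (Fin 6) ℝ W) :=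
  {b | ∃ c : Module.Basis (Fin 7) ℝ V, c 0 = ν ∧ (∀ i : Fin 6, c i.succ = L (b i)) ∧
    c.orientation = o}

/-- The `(1,1)`-part of a real symmetric bilinear form with respect to a complex structure `I`,
that is its `I`-invariant part: the real part of a Hermitian form. -/
def hermitianPart (I : V → V) (B : V → V → ℝ) (X Y : V) : ℝ :=
  (1 / 2 : ℝ) * (B X Y + B (I X) (I Y))

/-- The `2`-form `β` is the `(1,1)`-form corresponding to the (real part of the) Hermitian form `H`:
`β(X, Y) = H(I X, Y)`. On `ℂ³` the Euclidean metric corresponds to `∑ dxᵢ ∧ dyᵢ`. -/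
def IsFundamentalForm (I : V → V) (H : V → V → ℝ) (β : V [⋀^Fin 2]→ₗ[ℝ] ℝ) : Prop :=
  ∀ X Y, β ![X, Y] = H (I X) Y

/-- The real `2`-form `(i/2) dz ∧ dz̄ = dx ∧ dy` of a complex coordinate `z = x + i y`. -/
def areaForm (z : V →ₗ[ℝ] ℂ) : V [⋀^Fin 2]→ₗ[ℝ] ℝ :=
  wedge (oneForm (Complex.reLm ∘ₗ z)) (oneForm (Complex.imLm ∘ₗ z))

/-- Semi-positivity of a `4`-form `σ` of type `(2,2)` on a complex `3`-dimensional space `(V, I)`: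
in suitable complex linear coordinates `z₀, z₁, z₂`,
`σ = -¼ (λ₀ dz₁dz̄₁dz₂dz̄₂ + λ₁ dz₂dz̄₂dz₀dz̄₀ + λ₂ dz₀dz̄₀dz₁dz̄₁)`
with all `λᵢ ≥ 0` and some `λᵢ > 0`. -/
def IsSemiPositive (I : V → V) (σ : V [⋀^Fin 4]→ₗ[ℝ] ℝ) : Prop :=
  ∃ z : Fin 3 → V →ₗ[ℝ] ℂ, (∀ i v, z i (I v) = Complex.I * z i v) ∧
    Function.Bijective (fun v i => z i v) ∧
    ∃ l : Fin 3 → ℝ, (∀ i, 0 ≤ l i) ∧ (∃ i, 0 < l i) ∧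
      σ = l 0 • wedge (areaForm (z 1)) (areaForm (z 2))
        + l 1 • wedge (areaForm (z 2)) (areaForm (z 0))
        + l 2 • wedge (areaForm (z 0)) (areaForm (z 1))

variable [TopologicalSpace V]

/-- `I` is the complex structure defined by the definite `3`-form `ρ` and the orientation whose
positive bases form the set `P`: `ρ` is the real part of a form of type `(3,0)` for `I`, and `I`
induces the given orientation. -/
structure IsInducedComplexStructure (P : Set (Module.Basis (Fin 6) ℝ V)) (ρ : V [⋀^Fin 3]→L[ℝ] ℝ)
    (I : V →L[ℝ] V) : Prop where
  sq : ∀ v, I (I v) = -v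
  type : ∀ u v w, ρ ![I u, I v, w] = -ρ ![u, v, w]
  orientation : ∃ b ∈ P, b 1 = I (b 0) ∧ b 3 = I (b 2) ∧ b 5 = I (b 4)

/-- The complex structure `I_ρ` of a definite `3`-form on an oriented `6`-dimensional space. -/
def inducedComplexStructure (P : Set (Module.Basis (Fin 6) ℝ V)) (ρ : V [⋀^Fin 3]→L[ℝ] ℝ) :
    V →L[ℝ] V :=
  Classical.epsilon (IsInducedComplexStructure P ρ)

/-- The companion form `ρ̃`, for which `ρ + i ρ̃` has type `(3,0)` with respect to `I = I_ρ`. It is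
given by `ρ̃(u, v, w) = ρ(I u, I v, I w)`. -/
def companion (P : Set (Module.Basis (Fin 6) ℝ V)) (ρ : V [⋀^Fin 3]→L[ℝ] ℝ) :
    V [⋀^Fin 3]→L[ℝ] ℝ :=
  ρ.compContinuousLinearMap (inducedComplexStructure P ρ)

/-- The form `ρ + i ρ̃` is of type `(3,0)`, that is complex linear for `I_ρ`. -/
theorem companion_type {P : Set (Module.Basis (Fin 6) ℝ V)} {ρ : V [⋀^Fin 3]→L[ℝ] ℝ}
    (h : ∃ I, IsInducedComplexStructure P ρ I) (u v w : V) :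
    (ρ ![inducedComplexStructure P ρ u, v, w] : ℂ)
        + Complex.I * companion P ρ ![inducedComplexStructure P ρ u, v, w]
      = Complex.I * (ρ ![u, v, w] + Complex.I * companion P ρ ![u, v, w]) := by
  have hI : IsInducedComplexStructure P ρ (inducedComplexStructure P ρ) :=
    Classical.epsilon_spec h
  have hc : ∀ a b c : V, companion P ρ ![a, b, c] = ρ ![inducedComplexStructure P ρ a,
      inducedComplexStructure P ρ b, inducedComplexStructure P ρ c] := by
    intro a b c
    simp only [companion, ContinuousAlternatingMap.compContinuousLinearMap_apply]
    congr 1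
    ext i
    fin_cases i <;> rfl
  have hneg : ∀ a b c : V, ρ ![-a, b, c] = -ρ ![a, b, c] := by
    intro a b c
    have h1 := ρ.toAlternatingMap.map_update_neg ![a, b, c] 0 a
    have e1 : Function.update ![a, b, c] (0 : Fin 3) (-a) = ![-a, b, c] := by
      ext i; fin_cases i <;> rfl
    have e2 : Function.update ![a, b, c] (0 : Fin 3) a = ![a, b, c] := by
      ext i; fin_cases i <;> rfl
    rw [e1, e2] at h1
    exact h1
  have hswap : ∀ a b c : V, ρ ![a, b, c] = ρ ![b, c, a] := by
    intro a b c
    have h1 := ρ.toAlternatingMap.map_swap ![a, b, c] (i := 0) (j := 1) (by decide)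
    have h2 := ρ.toAlternatingMap.map_swap ![b, a, c] (i := 1) (j := 2) (by decide)
    have e1 : (![a, b, c] ∘ Equiv.swap (0 : Fin 3) 1 : Fin 3 → V) = ![b, a, c] := by
      ext i; fin_cases i <;> rfl
    have e2 : (![b, a, c] ∘ Equiv.swap (1 : Fin 3) 2 : Fin 3 → V) = ![b, c, a] := by
      ext i; fin_cases i <;> rfl
    rw [e1] at h1
    rw [e2] at h2
    change ρ ![b, a, c] = -ρ ![a, b, c] at h1
    change ρ ![b, c, a] = -ρ ![b, a, c] at h2
    linarith
  have k1 : companion P ρ ![inducedComplexStructure P ρ u, v, w] = ρ ![u, v, w] := by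
    rw [hc, hI.sq, hneg, hswap, hI.type, neg_neg, ← hswap]
  have k2 : companion P ρ ![u, v, w] = -ρ ![inducedComplexStructure P ρ u, v, w] := by
    rw [hc, hswap, hI.type, ← hswap]
  rw [k1, k2]
  push_cast
  linear_combination ((ρ ![inducedComplexStructure P ρ u, v, w] : ℂ)) * Complex.I_sq

/-- The volume element `vol_ρ = ¼ ρ ∧ ρ̃` of a definite `3`-form. -/
def volumeElement (P : Set (Module.Basis (Fin 6) ℝ V)) (ρ : V [⋀^Fin 3]→L[ℝ] ℝ) :
    V [⋀^Fin 6]→ₗ[ℝ] ℝ :=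
  (1 / 4 : ℝ) • wedge ρ.toAlternatingMap (companion P ρ).toAlternatingMap

end LinearAlgebra

/-! ### Differential forms and Riemannian geometry on a manifold

In Mathlib the tangent space `TangentSpace (𝓡 n) x` is the model space `ℝⁿ`, identified with it by
the derivative at `x` of the preferred chart `extChartAt (𝓡 n) x`. The local expressions below are
taken in this chart, and evaluated at `x` they give tensors on the tangent space at `x`. -/

section Manifold

variable {n : ℕ} {M : Type*} [TopologicalSpace M] [ChartedSpace (EuclideanSpace ℝ (Fin n)) M]

/-- A differential `k`-form on an `n`-manifold (a section, with no regularity required). -/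
abbrev DiffForm (n : ℕ) (M : Type*) [TopologicalSpace M]
    [ChartedSpace (EuclideanSpace ℝ (Fin n)) M] (k : ℕ) : Type _ :=
  ∀ x : M, TangentSpace (𝓡 n) x [⋀^Fin k]→L[ℝ] ℝ

/-- A field of bilinear forms on the tangent spaces. -/
abbrev BilinField (n : ℕ) (M : Type*) [TopologicalSpace M]
    [ChartedSpace (EuclideanSpace ℝ (Fin n)) M] : Type _ :=
  ∀ x : M, TangentSpace (𝓡 n) x →ₗ[ℝ] TangentSpace (𝓡 n) x →ₗ[ℝ] ℝ

/-- The derivative at `y` of the inverse of the preferred chart at `x`. -/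
def chartSymmDeriv (x : M) (y : EuclideanSpace ℝ (Fin n)) :
    EuclideanSpace ℝ (Fin n) →L[ℝ] TangentSpace (𝓡 n) ((extChartAt (𝓡 n) x).symm y) :=
  mfderiv 𝓘(ℝ, EuclideanSpace ℝ (Fin n)) (𝓡 n) (extChartAt (𝓡 n) x).symm y

/-- The local expression of a form in the preferred chart at `x`. -/
def formInChart {k : ℕ} (α : DiffForm n M k) (x : M) (y : EuclideanSpace ℝ (Fin n)) :
    EuclideanSpace ℝ (Fin n) [⋀^Fin k]→L[ℝ] ℝ :=
  (α ((extChartAt (𝓡 n) x).symm y)).compContinuousLinearMap (chartSymmDeriv x y)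

/-- The local expression of a field of bilinear forms in the preferred chart at `x`. -/
def bilinInChart (g : BilinField n M) (x : M) (y : EuclideanSpace ℝ (Fin n)) :
    EuclideanSpace ℝ (Fin n) →L[ℝ] EuclideanSpace ℝ (Fin n) →L[ℝ] ℝ :=
  ((g ((extChartAt (𝓡 n) x).symm y)).compl₁₂ (chartSymmDeriv x y).toLinearMap
    (chartSymmDeriv x y).toLinearMap).toContinuousBilinearMap

/-- Smooth differential forms. -/
def IsSmoothForm {k : ℕ} (α : DiffForm n M k) : Prop :=
  ∀ x : M, ContDiffOn ℝ ∞ (formInChart α x) (extChartAt (𝓡 n) x).target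

/-- The exterior derivative of a form on a manifold. -/
def extD {k : ℕ} (α : DiffForm n M k) : DiffForm n M (k + 1) :=
  fun x => (extDeriv (formInChart α x) (extChartAt (𝓡 n) x x) :
    EuclideanSpace ℝ (Fin n) [⋀^Fin (k + 1)]→L[ℝ] ℝ)

/-- Closed forms. -/
def IsClosedForm {k : ℕ} (α : DiffForm n M k) : Prop :=
  ∀ x : M, extD α x = 0

/-- The Christoffel symbols of a metric `G` on (an open subset of) `ℝⁿ`: `Γ(u, v)` is the vector with
`G(Γ(u, v), w) = ½ (∂_u G(v, w) + ∂_v G(u, w) - ∂_w G(u, v))` for all `w`. -/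
def christoffel
    (G : EuclideanSpace ℝ (Fin n) →
      EuclideanSpace ℝ (Fin n) →L[ℝ] EuclideanSpace ℝ (Fin n) →L[ℝ] ℝ)
    (y u v : EuclideanSpace ℝ (Fin n)) : EuclideanSpace ℝ (Fin n) :=
  (G y).inverse ((1 / 2 : ℝ) •
    (fderiv ℝ G y u v + fderiv ℝ G y v u - ((fderiv ℝ G y).flip u).flip v))

/-- The Christoffel symbols at `x` of the Levi-Civita connection of the metric `g`, in the preferred
chart at `x`. -/
def leviCivita (g : BilinField n M) (x : M) (u v : TangentSpace (𝓡 n) x) : TangentSpace (𝓡 n) x :=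
  christoffel (bilinInChart g x) (extChartAt (𝓡 n) x x) u v

/-- The covariant derivative `(∇_X α)(v₁, …, v_k)` at `x` of a form `α` for the Levi-Civita connection
of the metric `g`. -/
def covDerivForm {k : ℕ} (g : BilinField n M) (α : DiffForm n M k) (x : M)
    (X : TangentSpace (𝓡 n) x) (v : Fin k → TangentSpace (𝓡 n) x) : ℝ :=
  (fderiv ℝ (formInChart α x) (extChartAt (𝓡 n) x x) X :
      EuclideanSpace ℝ (Fin n) [⋀^Fin k]→L[ℝ] ℝ) v
    - ∑ i, α x (Function.update v i (leviCivita g x X (v i)))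

/-- Covariant constant forms. -/
def IsParallelForm {k : ℕ} (g : BilinField n M) (α : DiffForm n M k) : Prop :=
  ∀ x X v, covDerivForm g α x X v = 0

end Manifold

/-! ### `G₂`-structures and their hypersurfaces -/

section Hypersurface

variable {M : Type*} [TopologicalSpace M] [ChartedSpace (EuclideanSpace ℝ (Fin 7)) M]
  {N : Type*} [TopologicalSpace N] [ChartedSpace (EuclideanSpace ℝ (Fin 6)) N]

/-- A (pointwise) orientation of a `7`-manifold. -/
abbrev PointwiseOrientation (M : Type*) [TopologicalSpace M]
    [ChartedSpace (EuclideanSpace ℝ (Fin 7)) M] : Type _ :=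
  ∀ x : M, Orientation ℝ (TangentSpace (𝓡 7) x) (Fin 7)

/-- A `G₂`-structure on a `7`-manifold with orientation `o`: a smooth `3`-form which is positive at
every point. (The orientation is then continuous, because `φ` is.) -/
structure IsG2Structure (o : PointwiseOrientation M) (φ : DiffForm 7 M 3) : Prop where
  smooth : IsSmoothForm φ
  positive : ∀ x, IsPositiveForm (o x) (φ x).toAlternatingMap

/-- The Riemannian metric `g_φ` of a `G₂`-structure. -/
def g2Metric (φ : DiffForm 7 M 3) : BilinField 7 M :=
  fun x => inducedMetric (φ x).toAlternatingMap

/-- A `G₂`-structure is torsion-free if it is covariant constant for the Levi-Civita connection of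
the metric it induces. -/
def IsTorsionFree (φ : DiffForm 7 M 3) : Prop :=
  IsParallelForm (g2Metric φ) φ

/-- The differential at `p` of a map `f : N → M`. -/
def differential (f : N → M) (p : N) : TangentSpace (𝓡 6) p →L[ℝ] TangentSpace (𝓡 7) (f p) :=
  mfderiv (𝓡 6) (𝓡 7) f p

/-- A smooth unit normal field `ν` along an immersion `f : N → M`. -/
structure IsUnitNormal [IsManifold (𝓡 7) ∞ M] (g : BilinField 7 M) (f : N → M)
    (ν : ∀ p : N, TangentSpace (𝓡 7) (f p)) : Prop where
  smooth : ContMDiff (𝓡 6) (𝓡 7).tangent ∞ (fun p => (⟨f p, ν p⟩ : TangentBundle (𝓡 7) M))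
  unit : ∀ p, g (f p) (ν p) (ν p) = 1
  normal : ∀ p X, g (f p) (ν p) (differential f p X) = 0

/-- The second derivative `D²F(X, Y)` at `p` of the local expression `F` of a map `f : N → M` in the
preferred charts at `p` and `f p`. -/
def mapHessian (f : N → M) (p : N) (X Y : TangentSpace (𝓡 6) p) : TangentSpace (𝓡 7) (f p) :=
  (fderiv ℝ (fderiv ℝ (writtenInExtChartAt (𝓡 6) (𝓡 7) p f)) (extChartAt (𝓡 6) p p) X Y :
    EuclideanSpace ℝ (Fin 7))

/-- The second fundamental form `B(X, Y) = ⟨∇_X Y, ν⟩` of an immersion `f : N → M` with unit normal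
`ν`. In the preferred charts at `p` and `f p`, with `F` the local expression of `f`, the vector
`∇_X Y` is, up to a tangential term, `D²F(X, Y) + Γ(DF(X), DF(Y))`. -/
def secondFundamentalForm (g : BilinField 7 M) (f : N → M)
    (ν : ∀ p : N, TangentSpace (𝓡 7) (f p)) (p : N) (X Y : TangentSpace (𝓡 6) p) : ℝ :=
  g (f p)
    (mapHessian f p X Y + leviCivita g (f p) (differential f p X) (differential f p Y))
    (ν p)

/-- The mean curvature with respect to `ν`: the trace of the second fundamental form with respect to
the induced metric. -/
def meanCurvature (g : BilinField 7 M) (f : N → M)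
    (ν : ∀ p : N, TangentSpace (𝓡 7) (f p)) (p : N) : ℝ :=
  metricTrace 6
    ((g (f p)).compl₁₂ (differential f p).toLinearMap (differential f p).toLinearMap)
    (secondFundamentalForm g f ν p)

/-- The `3`-form `ρ = f^* φ`. -/
def rho (φ : DiffForm 7 M 3) (f : N → M) : DiffForm 6 N 3 :=
  fun p => (φ (f p)).compContinuousLinearMap (differential f p)

/-- The `2`-form `ω = f^* (i_ν φ)`. -/
def omega (φ : DiffForm 7 M 3) (f : N → M) (ν : ∀ p : N, TangentSpace (𝓡 7) (f p)) (p : N) :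
    TangentSpace (𝓡 6) p [⋀^Fin 2]→ₗ[ℝ] ℝ :=
  ((φ (f p)).toAlternatingMap.curryLeft (ν p)).compLinearMap (differential f p).toLinearMap

/-- The orientation of the hypersurface defined by `ν` and the orientation of `M`. -/
def hypersurfaceOrientation (o : PointwiseOrientation M) (f : N → M)
    (ν : ∀ p : N, TangentSpace (𝓡 7) (f p)) (p : N) :
    Set (Module.Basis (Fin 6) ℝ (TangentSpace (𝓡 6) p)) :=
  positiveBases (o (f p)) (differential f p).toLinearMap (ν p)

/-- The almost-complex structure `I_ρ` of the oriented hypersurface. -/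
def almostComplex (o : PointwiseOrientation M) (φ : DiffForm 7 M 3) (f : N → M)
    (ν : ∀ p : N, TangentSpace (𝓡 7) (f p)) (p : N) :
    TangentSpace (𝓡 6) p →L[ℝ] TangentSpace (𝓡 6) p :=
  inducedComplexStructure (hypersurfaceOrientation o f ν p) (rho φ f p)

/-- The `3`-form `ρ̃` of the oriented hypersurface. -/
def rhoTilde (o : PointwiseOrientation M) (φ : DiffForm 7 M 3) (f : N → M)
    (ν : ∀ p : N, TangentSpace (𝓡 7) (f p)) : DiffForm 6 N 3 :=
  fun p => companion (hypersurfaceOrientation o f ν p) (rho φ f p)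

/-- The `4`-form `dρ̃`. -/
def dRhoTilde (o : PointwiseOrientation M) (φ : DiffForm 7 M 3) (f : N → M)
    (ν : ∀ p : N, TangentSpace (𝓡 7) (f p)) (p : N) :
    TangentSpace (𝓡 6) p [⋀^Fin 4]→ₗ[ℝ] ℝ :=
  (extD (rhoTilde o φ f ν) p).toAlternatingMap

/-- The volume form `vol = vol_ρ = ¼ ρ ∧ ρ̃` of the oriented hypersurface. -/
def vol (o : PointwiseOrientation M) (φ : DiffForm 7 M 3) (f : N → M)
    (ν : ∀ p : N, TangentSpace (𝓡 7) (f p)) (p : N) :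
    TangentSpace (𝓡 6) p [⋀^Fin 6]→ₗ[ℝ] ℝ :=
  volumeElement (hypersurfaceOrientation o f ν p) (rho φ f p)

/-- The induced `SL(3,ℂ)`-structure `ρ` is mean-convex: `dρ̃` is semi-positive at every point. -/
def IsMeanConvex (o : PointwiseOrientation M) (φ : DiffForm 7 M 3) (f : N → M)
    (ν : ∀ p : N, TangentSpace (𝓡 7) (f p)) : Prop :=
  ∀ p, IsSemiPositive (almostComplex o φ f ν p) (dRhoTilde o φ f ν p)

/-- The `2`-form `β` on `T_p N` is `β_{1,1}`, the `(1,1)`-form corresponding to the `(1,1)`-part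
`B_{1,1}` of the second fundamental form. -/
def IsBeta11 (o : PointwiseOrientation M) (φ : DiffForm 7 M 3) (f : N → M)
    (ν : ∀ p : N, TangentSpace (𝓡 7) (f p)) (p : N)
    (β : TangentSpace (𝓡 6) p [⋀^Fin 2]→ₗ[ℝ] ℝ) : Prop :=
  IsFundamentalForm (almostComplex o φ f ν p)
    (hermitianPart (almostComplex o φ f ν p) (secondFundamentalForm (g2Metric φ) f ν p)) β

/-- The formula `μ = ½ (dρ̃ ∧ ω) vol⁻¹` at `p`: the `6`-form `vol` does not vanish, and
`½ dρ̃ ∧ ω = μ vol`. -/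
def MeanCurvatureFormula (o : PointwiseOrientation M) (φ : DiffForm 7 M 3) (f : N → M)
    (ν : ∀ p : N, TangentSpace (𝓡 7) (f p)) (p : N) : Prop :=
  vol o φ f ν p ≠ 0 ∧
    (1 / 2 : ℝ) • wedge (dRhoTilde o φ f ν p) (omega φ f ν p)
      = meanCurvature (g2Metric φ) f ν p • vol o φ f ν p

end Hypersurface

end G2Geometry

end

/-! All pointwise statements are read off one normal form. A positive 3-form has a positively
oriented basis e₀,…,e₆, with e₀ any prescribed unit vector, in which φ = e⁰¹² + e⁰³⁴ + e⁰⁵⁶ + e¹³⁵ −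
e¹⁴⁶ − e²³⁶ − e²⁴⁵ (`exists_isAdapted_unit`), and this basis is orthonormal for g_φ. For e₀ = ν the
tangent space of N becomes ℂ³ with ω its standard Kähler form, ρ + iρ̃ = dz₁∧dz₂∧dz₃ and I X = ν ×
X, where × is the cross product g(x × y, w) = φ(x, y, w). Hence ρ̃(X, Y, Z) = φ(ν × X, ν × Y, ν ×
Z). This expression involves no choice of frame, so it can be differentiated although the frames are
only chosen point by point.

Torsion-free case. If ∇φ = 0, then ∇_U(ν × X) = (∇_U ν) × X + ν × ∇_U X. The terms in ∇_U X are
symmetric in U and X and disappear from dρ̃. A tangential change a of ν changes ρ̃ by −(i_a ω) ∧ ω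
(`sum_tri_cross`), and ω(∇_U ν, X) = B(U, IX); alternating over U gives dρ̃ = 2 β₁₁ ∧ ω
(`sum_deriv_companion`, `extDeriv_of_parallel`).

Closed case. The identity ρ̃ ∧ ω = 0 on N gives dρ̃ ∧ ω = ρ̃ ∧ dω. By Cartan's formula dφ = 0 makes
dω the restriction of the Lie derivative of φ along ν, and ρ̃ ∧ η = −⟨ρ, η⟩ vol for 3-forms η. The
pairing of ρ with a variation of φ is the trace over TN of the induced variation of g_φ
(`IsAdapted.sum_cubeVariation`), and for the Lie derivative along ν this trace is −2μ. So dρ̃ ∧ ω =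
2μ vol (`wedge_extDeriv_of_closed`). A parallel form is closed, so the torsion-free case is covered
too.

Positivity. If dρ̃ is semi-positive, dρ̃ ∧ ω is positive on a complex basis dual to the coordinates
z, where vol is non-negative; hence μ > 0. -/

noncomputable section

namespace G2Geometry

/-! ### Signed sums over permutations. -/

section SignedSum

variable {V : Type*}

/-- The signed sum of the values of `F` over all rearrangements of `v`. -/
def signedSum {k : ℕ} (F : (Fin k → V) → ℝ) (v : Fin k → V) : ℝ :=
  ∑ σ : Equiv.Perm (Fin k), ((Equiv.Perm.sign σ : ℤ) : ℝ) * F (v ∘ σ)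

/-- The permutation of `Fin (k + 1)` sending `p` to `0` and `p.succAbove j` to `(e j).succ`. -/
def insertPerm {k : ℕ} (x : Fin (k + 1) × Equiv.Perm (Fin k)) : Equiv.Perm (Fin (k + 1)) :=
  Equiv.Perm.decomposeFin.symm (0, x.2) * x.1.cycleRange

theorem insertPerm_self {k : ℕ} (p : Fin (k + 1)) (e : Equiv.Perm (Fin k)) :
    insertPerm (p, e) p = 0 := by
  simp [insertPerm]

theorem insertPerm_succAbove {k : ℕ} (p : Fin (k + 1)) (e : Equiv.Perm (Fin k)) (j : Fin k) :
    insertPerm (p, e) (p.succAbove j) = (e j).succ := by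
  simp [insertPerm]

theorem sign_insertPerm {k : ℕ} (p : Fin (k + 1)) (e : Equiv.Perm (Fin k)) :
    Equiv.Perm.sign (insertPerm (p, e)) = (-1) ^ (p : ℕ) * Equiv.Perm.sign e := by
  rw [insertPerm, Equiv.Perm.sign_mul, Fin.sign_cycleRange, Equiv.Perm.decomposeFin.symm_sign]
  simp [mul_comm]

theorem insertPerm_bijective (k : ℕ) : Function.Bijective (insertPerm (k := k)) := by
  rw [Fintype.bijective_iff_injective_and_card]
  constructor
  · rintro ⟨p, e⟩ ⟨q, e'⟩ h
    have hpq : p = q := by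
      have h1 := insertPerm_self p e
      rw [h, ← insertPerm_self q e'] at h1
      exact (insertPerm (q, e')).injective h1
    subst hpq
    have : e = e' := by
      ext1 j
      have h1 := insertPerm_succAbove p e j
      rw [h, insertPerm_succAbove] at h1
      exact (Fin.succ_injective _ h1).symm
    rw [this]
  · simp [Fintype.card_perm, Nat.factorial_succ]

/-- A rearrangement of (x, w) is a position p for x together with a rearrangement of w; moving x to
position p takes p transpositions, which is the sign. -/
theorem signedSum_cons {k : ℕ} (F : (Fin (k + 1) → V) → ℝ) (x : V) (w : Fin k → V) :
    signedSum F (Matrix.vecCons x w)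
      = ∑ p : Fin (k + 1), (-1 : ℝ) ^ (p : ℕ) * signedSum (fun u => F (p.insertNth x u)) w := by
  unfold signedSum
  rw [← (Equiv.ofBijective _ (insertPerm_bijective k)).sum_comp, Fintype.sum_prod_type]
  refine Finset.sum_congr rfl fun p _ => ?_
  rw [Finset.mul_sum]
  refine Finset.sum_congr rfl fun e _ => ?_
  have h : Matrix.vecCons x w ∘ insertPerm (p, e) = p.insertNth x (w ∘ e) := by
    ext1 i
    refine p.succAboveCases ?_ (fun j => ?_) i
    · simp [insertPerm_self]
    · simp [insertPerm_succAbove]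
  rw [Equiv.ofBijective_apply, h, sign_insertPerm]
  push_cast
  ring

theorem signedSum_const_mul {k : ℕ} (c : ℝ) (F : (Fin k → V) → ℝ) (v : Fin k → V) :
    signedSum (fun u => c * F u) v = c * signedSum F v := by
  unfold signedSum
  rw [Finset.mul_sum]
  exact Finset.sum_congr rfl fun σ _ => by ring

theorem signedSum_cast {k l : ℕ} (h : k = l) (F : (Fin k → V) → ℝ) (v : Fin l → V) :
    signedSum F (v ∘ Fin.cast h) = signedSum (fun u => F (u ∘ Fin.cast h)) v := by
  subst h
  rfl

end SignedSum

/-! ### The wedge product evaluated on vectors: Leibniz rule and explicit expansions. -/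

section WedgeExpansion

variable {V : Type*} [AddCommGroup V] [Module ℝ V]

/-- The value of `α ⊗ β`. -/
def tensorValue {m n : ℕ} (α : V [⋀^Fin m]→ₗ[ℝ] ℝ) (β : V [⋀^Fin n]→ₗ[ℝ] ℝ)
    (v : Fin (m + n) → V) : ℝ :=
  α (v ∘ Fin.castAdd n) * β (v ∘ Fin.natAdd m)

/-- A shuffle is a class of permutations modulo those preserving the two blocks, and the m! n!
members of a class contribute equally. The full alternating sum needs no representatives of the
classes, so all computations with `wedge` pass through it. -/
theorem factorial_mul_wedge {m n : ℕ} (α : V [⋀^Fin m]→ₗ[ℝ] ℝ) (β : V [⋀^Fin n]→ₗ[ℝ] ℝ)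
    (v : Fin (m + n) → V) :
    (m.factorial * n.factorial : ℝ) * wedge α β v = signedSum (tensorValue α β) v := by
  have h := congrArg (fun γ => (LinearMap.mul' ℝ ℝ) (γ (v ∘ finSumFinEquiv)))
    (MultilinearMap.domCoprod_alternization_eq α β)
  simp only [MultilinearMap.alternatization_apply, Fintype.card_fin, AlternatingMap.smul_apply,
    map_nsmul, map_sum, MultilinearMap.domDomCongr_apply] at h
  have hw : wedge α β v = (LinearMap.mul' ℝ ℝ) (α.domCoprod β (v ∘ finSumFinEquiv)) := by
    simp [wedge, Function.comp_def]
  rw [hw]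
  rw [nsmul_eq_mul] at h
  push_cast at h
  rw [← h, signedSum, ← (Equiv.permCongr finSumFinEquiv).sum_comp]
  refine Finset.sum_congr rfl fun σ _ => ?_
  rw [Equiv.Perm.sign_permCongr]
  have e : ((Equiv.Perm.sign σ : ℤ) : ℝ) * tensorValue α β (v ∘ (Equiv.permCongr finSumFinEquiv) σ)
      = (Equiv.Perm.sign σ) • tensorValue α β (v ∘ (Equiv.permCongr finSumFinEquiv) σ) := by
    rw [Units.smul_def, zsmul_eq_mul]
  rw [e, Units.smul_def, map_zsmul, ← Units.smul_def]
  congr 1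
  simp [tensorValue, Function.comp_def, Equiv.permCongr_apply]

theorem wedge_fin_zero_right {m : ℕ} (α : V [⋀^Fin m]→ₗ[ℝ] ℝ) (β : V [⋀^Fin 0]→ₗ[ℝ] ℝ)
    (v : Fin m → V) : wedge α β v = α v * β ![] := by
  have h := factorial_mul_wedge α β v
  have h2 : signedSum (tensorValue α β) v = m.factorial * (α v * β ![]) := by
    unfold signedSum
    have : ∀ σ : Equiv.Perm (Fin (m + 0)), ((Equiv.Perm.sign σ : ℤ) : ℝ)
        * tensorValue α β (v ∘ σ) = α v * β ![] := by
      intro σ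
      have e1 : tensorValue α β (v ∘ σ) = α (v ∘ σ) * β ![] := by
        unfold tensorValue
        congr 2
        exact Subsingleton.elim _ _
      rw [e1, AlternatingMap.map_perm, Units.smul_def, zsmul_eq_mul]
      have : ((Equiv.Perm.sign σ : ℤ) : ℝ) * ((Equiv.Perm.sign σ : ℤ) : ℝ) = 1 := by
        exact_mod_cast Int.units_coe_mul_self (Equiv.Perm.sign σ)
      linear_combination (α v * β ![]) * this
    rw [Finset.sum_congr rfl fun σ _ => this σ]
    simp [Fintype.card_perm]
  rw [h2] at h
  have hm : (m.factorial : ℝ) ≠ 0 := by positivity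
  simp only [Nat.factorial_zero, Nat.cast_one, mul_one] at h
  exact mul_left_cancel₀ hm h

theorem wedge_fin_zero_left {n : ℕ} (α : V [⋀^Fin 0]→ₗ[ℝ] ℝ) (β : V [⋀^Fin n]→ₗ[ℝ] ℝ)
    (v : Fin (0 + n) → V) (w : Fin n → V) (hw : ∀ i, w i = v (Fin.natAdd 0 i)) :
    wedge α β v = α ![] * β w := by
  have h := factorial_mul_wedge α β v
  have h2 : signedSum (tensorValue α β) v = n.factorial * (α ![] * β w) := by
    unfold signedSum
    have : ∀ σ : Equiv.Perm (Fin (0 + n)), ((Equiv.Perm.sign σ : ℤ) : ℝ)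
        * tensorValue α β (v ∘ σ) = α ![] * β w := by
      intro σ
      have e1 : tensorValue α β (v ∘ σ)
          = α ![] * (β.domDomCongr (finCongr (Nat.zero_add n).symm)) (v ∘ σ) := by
        rw [AlternatingMap.domDomCongr_apply]
        unfold tensorValue
        congr 2
        · exact Subsingleton.elim _ _
        · ext1 i
          simp only [Function.comp_apply, finCongr_apply]
          congr 2
          ext
          simp
      have e2 : β w = (β.domDomCongr (finCongr (Nat.zero_add n).symm)) v := by
        simp only [AlternatingMap.domDomCongr_apply]
        congr 1
        ext1 i
        rw [hw]
        congr 1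
        ext
        simp
      rw [e1, AlternatingMap.map_perm, Units.smul_def, zsmul_eq_mul, ← e2]
      have : ((Equiv.Perm.sign σ : ℤ) : ℝ) * ((Equiv.Perm.sign σ : ℤ) : ℝ) = 1 := by
        exact_mod_cast Int.units_coe_mul_self (Equiv.Perm.sign σ)
      linear_combination (α ![] * β w) * this
    rw [Finset.sum_congr rfl fun σ _ => this σ]
    simp [Fintype.card_perm]
  rw [h2] at h
  have hm : (n.factorial : ℝ) ≠ 0 := by positivity
  simp only [Nat.factorial_zero, Nat.cast_one, one_mul] at h
  exact mul_left_cancel₀ hm h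

/-- The Leibniz rule for the contraction of a wedge product with a vector. -/
theorem wedge_cons {m n : ℕ} (α : V [⋀^Fin (m + 1)]→ₗ[ℝ] ℝ) (β : V [⋀^Fin (n + 1)]→ₗ[ℝ] ℝ)
    (x : V) (w : Fin (m + 1 + n) → V) (w' : Fin (m + (n + 1)) → V)
    (hw : w' = w ∘ Fin.cast (by omega)) :
    wedge α β (Matrix.vecCons x w : Fin (m + 1 + n + 1) → V)
      = wedge (α.curryLeft x) β w' + (-1) ^ (m + 1) * wedge α (β.curryLeft x) w := by
  have h := factorial_mul_wedge α β (Matrix.vecCons x w : Fin (m + 1 + n + 1) → V)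
  have h1 := factorial_mul_wedge (α.curryLeft x) β w'
  have h2 := factorial_mul_wedge α (β.curryLeft x) w
  have key : signedSum (k := m + 1 + (n + 1)) (tensorValue α β)
      (Matrix.vecCons x w : Fin (m + 1 + n + 1) → V)
      = (m + 1) * signedSum (tensorValue (α.curryLeft x) β) w'
        + (n + 1) * ((-1) ^ (m + 1) * signedSum (tensorValue α (β.curryLeft x)) w) := by
    have hs := signedSum_cons (k := m + 1 + n) (tensorValue (m := m + 1) (n := n + 1) α β) x w
    rw [hs, hw, signedSum_cast]
    -- The vector x lands either in an argument of α or in one of β. Within each block all positions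
    -- contribute equally; the resulting factors m + 1 and n + 1 account for the change in the
    -- factorials.
    have hsplit := Fin.sum_univ_add (a := m + 1) (b := n + 1)
      (fun p : Fin (m + 1 + (n + 1)) => (-1 : ℝ) ^ (p : ℕ) *
        signedSum (k := m + 1 + n)
          (fun u => tensorValue (m := m + 1) (n := n + 1) α β
            (Fin.insertNth (n := m + 1 + n) p x u)) w)
    refine hsplit.trans ?_
    congr 1
    · have : ∀ p : Fin (m + 1), (-1 : ℝ) ^ ((Fin.castAdd (n + 1) p : Fin _) : ℕ) *
          signedSum (k := m + 1 + n) (fun u => tensorValue (m := m + 1) (n := n + 1) α β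
            (Fin.insertNth (n := m + 1 + n) (Fin.castAdd (n + 1) p) x u)) w
          = signedSum (fun u => tensorValue (α.curryLeft x) β (u ∘ Fin.cast (by omega))) w := by
        intro p
        rw [← signedSum_const_mul]
        congr 1
        ext u
        have a1 : (Fin.insertNth (n := m + 1 + n) (Fin.castAdd (n + 1) p) x u
            : Fin (m + 1 + n + 1) → V) ∘ Fin.castAdd (n + 1)
            = p.insertNth x (fun j => u ((j.castAdd (n + 1)).cast (by omega))) := by
          ext1 i
          refine p.succAboveCases ?_ (fun j => ?_) i
          · exact (Fin.insertNth_apply_same (α := fun _ => V) (n := m + 1 + n)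
              (Fin.castAdd (n + 1) p) x u).trans (by simp)
          · have : Fin.castAdd (n + 1) (p.succAbove j) = Fin.succAbove (n := m + 1 + n)
                (Fin.castAdd (n + 1) p) ((j.castAdd (n + 1)).cast (by omega)) := by
              ext
              simp only [Fin.succAbove, Fin.lt_def, Fin.val_castAdd, Fin.val_castSucc,
                Fin.val_cast, apply_ite Fin.val, Fin.val_succ]
            rw [Function.comp_apply, this, Fin.insertNth_apply_succAbove,
              Fin.insertNth_apply_succAbove]
        have a2 : (Fin.insertNth (n := m + 1 + n) (Fin.castAdd (n + 1) p) x u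
            : Fin (m + 1 + (n + 1)) → V)
              ∘ (Fin.natAdd (m + 1) : Fin (n + 1) → Fin (m + 1 + (n + 1)))
            = (fun j : Fin (n + 1) => u ((Fin.natAdd m j).cast (by omega))) := by
          ext1 j
          have : Fin.natAdd (m + 1) j = Fin.succAbove (n := m + 1 + n)
              (Fin.castAdd (n + 1) p) ((j.natAdd m).cast (by omega)) := by
            ext
            have hp := p.2
            simp only [Fin.succAbove, Fin.lt_def, Fin.val_castAdd, Fin.val_castSucc, Fin.val_natAdd,
              Fin.val_cast, apply_ite Fin.val, Fin.val_succ]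
            split_ifs <;> omega
          rw [Function.comp_apply, this, Fin.insertNth_apply_succAbove]
        unfold tensorValue
        rw [a1, a2, AlternatingMap.map_insertNth, AlternatingMap.curryLeft_apply_apply]
        have : ((-1 : ℝ) ^ (p : ℕ)) * ((-1 : ℝ) ^ (p : ℕ)) = 1 := by
          rw [← mul_pow]; simp
        simp only [Fin.val_castAdd, Function.comp_def]
        linear_combination (α (Matrix.vecCons x (fun j => u ((j.castAdd (n + 1)).cast (by omega))))
          * β (fun j => u ((j.natAdd m).cast (by omega)))) * this
      rw [Finset.sum_congr rfl fun p _ => this p]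
      simp
    · have : ∀ p : Fin (n + 1), (-1 : ℝ) ^ ((Fin.natAdd (m + 1) p : Fin _) : ℕ) *
          signedSum (k := m + 1 + n) (fun u => tensorValue (m := m + 1) (n := n + 1) α β
            (Fin.insertNth (n := m + 1 + n) (Fin.natAdd (m + 1) p) x u)) w
          = (-1) ^ (m + 1) * signedSum (tensorValue α (β.curryLeft x)) w := by
        intro p
        rw [← signedSum_const_mul, ← signedSum_const_mul]
        congr 1
        ext u
        have a1 : (Fin.insertNth (n := m + 1 + n) (Fin.natAdd (m + 1) p) x u
            : Fin (m + 1 + n + 1) → V) ∘ Fin.castAdd (n + 1) = u ∘ Fin.castAdd n := by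
          ext1 j
          have : Fin.castAdd (n + 1) j = Fin.succAbove (n := m + 1 + n)
              (Fin.natAdd (m + 1) p) (j.castAdd n) := by
            ext
            have hj := j.2
            simp only [Fin.succAbove, Fin.lt_def, Fin.val_castAdd, Fin.val_castSucc, Fin.val_natAdd,
              apply_ite Fin.val, Fin.val_succ]
            split_ifs <;> omega
          rw [Function.comp_apply, this, Fin.insertNth_apply_succAbove, Function.comp_apply]
        have a2 : (Fin.insertNth (n := m + 1 + n) (Fin.natAdd (m + 1) p) x u
            : Fin (m + 1 + (n + 1)) → V)
              ∘ (Fin.natAdd (m + 1) : Fin (n + 1) → Fin (m + 1 + (n + 1)))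
            = p.insertNth x (u ∘ Fin.natAdd (m + 1)) := by
          ext1 i
          refine p.succAboveCases ?_ (fun j => ?_) i
          · exact (Fin.insertNth_apply_same (α := fun _ => V) (n := m + 1 + n)
              (Fin.natAdd (m + 1) p) x u).trans (by simp)
          · have : Fin.natAdd (m + 1) (p.succAbove j) = Fin.succAbove (n := m + 1 + n)
                (Fin.natAdd (m + 1) p) (j.natAdd (m + 1)) := by
              ext
              simp only [Fin.succAbove, Fin.lt_def, Fin.val_natAdd, Fin.val_castSucc,
                apply_ite Fin.val, Fin.val_succ]
              split_ifs <;> omega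
            rw [Function.comp_apply, this, Fin.insertNth_apply_succAbove,
              Fin.insertNth_apply_succAbove, Function.comp_apply]
        unfold tensorValue
        rw [a1, a2, AlternatingMap.map_insertNth, AlternatingMap.curryLeft_apply_apply]
        have : ((-1 : ℝ) ^ (p : ℕ)) * ((-1 : ℝ) ^ (p : ℕ)) = 1 := by
          rw [← mul_pow]; simp
        simp only [Fin.val_natAdd, pow_add]
        linear_combination ((-1 : ℝ) ^ m * (-1) ^ 1 * α (u ∘ Fin.castAdd n)
          * β (Matrix.vecCons x (u ∘ Fin.natAdd (m + 1)))) * this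
      rw [Finset.sum_congr rfl fun p _ => this p]
      simp
  have hm : ((m + 1).factorial * (n + 1).factorial : ℝ) ≠ 0 := by positivity
  apply mul_left_cancel₀ hm
  rw [h, key, ← h1, ← h2]
  simp only [Nat.factorial_succ]
  push_cast
  ring

/-- This and the following expansions support all later coordinate computations. Each peels off the
first vector by `wedge_cons` and uses the expansions in one degree less; the last one is what
evaluates (i_u φ)² ∧ φ on seven vectors. -/
theorem wedge_one_one (α : V [⋀^Fin 1]→ₗ[ℝ] ℝ) (β : V [⋀^Fin 1]→ₗ[ℝ] ℝ)
    (a b : V) :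
    wedge α β ![a, b]
      = α ![a] * β ![b] - α ![b] * β ![a] := by
  rw [wedge_cons (m := 0) (n := 0) α β a ![b]
    ![b] rfl, wedge_fin_zero_left _ _ ![b] ![b] (fun i => by fin_cases i; rfl),
    wedge_fin_zero_right]
  simp only [AlternatingMap.curryLeft_apply_apply]
  ring

theorem wedge_one_two (α : V [⋀^Fin 1]→ₗ[ℝ] ℝ) (β : V [⋀^Fin 2]→ₗ[ℝ] ℝ)
    (a b c : V) :
    wedge α β ![a, b, c]
      = α ![a] * β ![b, c] - α ![b] * β ![a, c] + α ![c] * β ![a, b] := by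
  rw [wedge_cons (m := 0) (n := 1) α β a ![b, c]
    ![b, c] rfl, wedge_fin_zero_left _ _ ![b, c] ![b, c] (fun i => by fin_cases i <;> rfl),
    wedge_one_one]
  simp only [AlternatingMap.curryLeft_apply_apply]
  ring

theorem wedge_two_one (α : V [⋀^Fin 2]→ₗ[ℝ] ℝ) (β : V [⋀^Fin 1]→ₗ[ℝ] ℝ)
    (a b c : V) :
    wedge α β ![a, b, c]
      = α ![a, b] * β ![c] - α ![a, c] * β ![b] + α ![b, c] * β ![a] := by
  rw [wedge_cons (m := 1) (n := 0) α β a ![b, c]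
    ![b, c] rfl, wedge_one_one, wedge_fin_zero_right]
  simp only [AlternatingMap.curryLeft_apply_apply]
  ring

theorem wedge_one_three (α : V [⋀^Fin 1]→ₗ[ℝ] ℝ) (β : V [⋀^Fin 3]→ₗ[ℝ] ℝ)
    (a b c d : V) :
    wedge α β ![a, b, c, d]
      = α ![a] * β ![b, c, d] - α ![b] * β ![a, c, d] + α ![c] * β ![a, b, d]
        - α ![d] * β ![a, b, c] := by
  rw [wedge_cons (m := 0) (n := 2) α β a ![b, c, d]
    ![b, c, d] rfl, wedge_fin_zero_left _ _ ![b, c, d] ![b, c, d] (fun i => by fin_cases i <;> rfl),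
    wedge_one_two]
  simp only [AlternatingMap.curryLeft_apply_apply]
  ring

theorem wedge_two_two (α : V [⋀^Fin 2]→ₗ[ℝ] ℝ) (β : V [⋀^Fin 2]→ₗ[ℝ] ℝ)
    (a b c d : V) :
    wedge α β ![a, b, c, d]
      = α ![a, b] * β ![c, d] - α ![a, c] * β ![b, d] + α ![a, d] * β ![b, c]
        + α ![b, c] * β ![a, d] - α ![b, d] * β ![a, c] + α ![c, d] * β ![a, b] := by
  rw [wedge_cons (m := 1) (n := 1) α β a ![b, c, d]
    ![b, c, d] rfl, wedge_one_two, wedge_two_one]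
  simp only [AlternatingMap.curryLeft_apply_apply]
  ring

theorem wedge_three_one (α : V [⋀^Fin 3]→ₗ[ℝ] ℝ) (β : V [⋀^Fin 1]→ₗ[ℝ] ℝ)
    (a b c d : V) :
    wedge α β ![a, b, c, d]
      = α ![a, b, c] * β ![d] - α ![a, b, d] * β ![c] + α ![a, c, d] * β ![b]
        - α ![b, c, d] * β ![a] := by
  rw [wedge_cons (m := 2) (n := 0) α β a ![b, c, d]
    ![b, c, d] rfl, wedge_two_one, wedge_fin_zero_right]
  simp only [AlternatingMap.curryLeft_apply_apply]
  ring

theorem wedge_two_three (α : V [⋀^Fin 2]→ₗ[ℝ] ℝ) (β : V [⋀^Fin 3]→ₗ[ℝ] ℝ)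
    (a b c d e : V) :
    wedge α β ![a, b, c, d, e]
      = α ![a, b] * β ![c, d, e] - α ![a, c] * β ![b, d, e] + α ![a, d] * β ![b, c, e]
        - α ![a, e] * β ![b, c, d] + α ![b, c] * β ![a, d, e] - α ![b, d] * β ![a, c, e]
        + α ![b, e] * β ![a, c, d] + α ![c, d] * β ![a, b, e] - α ![c, e] * β ![a, b, d]
        + α ![d, e] * β ![a, b, c] := by
  rw [wedge_cons (m := 1) (n := 2) α β a ![b, c, d, e]
    ![b, c, d, e] rfl, wedge_one_three, wedge_two_two]
  simp only [AlternatingMap.curryLeft_apply_apply]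
  ring

theorem wedge_three_two (α : V [⋀^Fin 3]→ₗ[ℝ] ℝ) (β : V [⋀^Fin 2]→ₗ[ℝ] ℝ)
    (a b c d e : V) :
    wedge α β ![a, b, c, d, e]
      = α ![a, b, c] * β ![d, e] - α ![a, b, d] * β ![c, e] + α ![a, b, e] * β ![c, d]
        + α ![a, c, d] * β ![b, e] - α ![a, c, e] * β ![b, d] + α ![a, d, e] * β ![b, c]
        - α ![b, c, d] * β ![a, e] + α ![b, c, e] * β ![a, d] - α ![b, d, e] * β ![a, c]
        + α ![c, d, e] * β ![a, b] := by
  rw [wedge_cons (m := 2) (n := 1) α β a ![b, c, d, e]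
    ![b, c, d, e] rfl, wedge_two_two, wedge_three_one]
  simp only [AlternatingMap.curryLeft_apply_apply]
  ring

theorem wedge_four_one (α : V [⋀^Fin 4]→ₗ[ℝ] ℝ) (β : V [⋀^Fin 1]→ₗ[ℝ] ℝ)
    (a b c d e : V) :
    wedge α β ![a, b, c, d, e]
      = α ![a, b, c, d] * β ![e] - α ![a, b, c, e] * β ![d] + α ![a, b, d, e] * β ![c]
        - α ![a, c, d, e] * β ![b] + α ![b, c, d, e] * β ![a] := by
  rw [wedge_cons (m := 3) (n := 0) α β a ![b, c, d, e]
    ![b, c, d, e] rfl, wedge_three_one, wedge_fin_zero_right]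
  simp only [AlternatingMap.curryLeft_apply_apply]
  ring

theorem wedge_three_three (α : V [⋀^Fin 3]→ₗ[ℝ] ℝ) (β : V [⋀^Fin 3]→ₗ[ℝ] ℝ)
    (a b c d e f : V) :
    wedge α β ![a, b, c, d, e, f]
      = α ![a, b, c] * β ![d, e, f] - α ![a, b, d] * β ![c, e, f] + α ![a, b, e] * β ![c, d, f]
        - α ![a, b, f] * β ![c, d, e] + α ![a, c, d] * β ![b, e, f] - α ![a, c, e] * β ![b, d, f]
        + α ![a, c, f] * β ![b, d, e] + α ![a, d, e] * β ![b, c, f] - α ![a, d, f] * β ![b, c, e]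
        + α ![a, e, f] * β ![b, c, d] - α ![b, c, d] * β ![a, e, f] + α ![b, c, e] * β ![a, d, f]
        - α ![b, c, f] * β ![a, d, e] - α ![b, d, e] * β ![a, c, f] + α ![b, d, f] * β ![a, c, e]
        - α ![b, e, f] * β ![a, c, d] + α ![c, d, e] * β ![a, b, f] - α ![c, d, f] * β ![a, b, e]
        + α ![c, e, f] * β ![a, b, d] - α ![d, e, f] * β ![a, b, c] := by
  rw [wedge_cons (m := 2) (n := 2) α β a ![b, c, d, e, f]
    ![b, c, d, e, f] rfl, wedge_two_three, wedge_three_two]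
  simp only [AlternatingMap.curryLeft_apply_apply]
  ring

theorem wedge_four_two (α : V [⋀^Fin 4]→ₗ[ℝ] ℝ) (β : V [⋀^Fin 2]→ₗ[ℝ] ℝ)
    (a b c d e f : V) :
    wedge α β ![a, b, c, d, e, f]
      = α ![a, b, c, d] * β ![e, f] - α ![a, b, c, e] * β ![d, f] + α ![a, b, c, f] * β ![d, e]
        + α ![a, b, d, e] * β ![c, f] - α ![a, b, d, f] * β ![c, e] + α ![a, b, e, f] * β ![c, d]
        - α ![a, c, d, e] * β ![b, f] + α ![a, c, d, f] * β ![b, e] - α ![a, c, e, f] * β ![b, d]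
        + α ![a, d, e, f] * β ![b, c] + α ![b, c, d, e] * β ![a, f] - α ![b, c, d, f] * β ![a, e]
        + α ![b, c, e, f] * β ![a, d] - α ![b, d, e, f] * β ![a, c]
        + α ![c, d, e, f] * β ![a, b] := by
  rw [wedge_cons (m := 3) (n := 1) α β a ![b, c, d, e, f]
    ![b, c, d, e, f] rfl, wedge_three_two, wedge_four_one]
  simp only [AlternatingMap.curryLeft_apply_apply]
  ring

theorem wedge_four_three (α : V [⋀^Fin 4]→ₗ[ℝ] ℝ) (β : V [⋀^Fin 3]→ₗ[ℝ] ℝ)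
    (a b c d e f g : V) :
    wedge α β ![a, b, c, d, e, f, g]
      = α ![a, b, c, d] * β ![e, f, g] - α ![a, b, c, e] * β ![d, f, g]
        + α ![a, b, c, f] * β ![d, e, g] - α ![a, b, c, g] * β ![d, e, f]
        + α ![a, b, d, e] * β ![c, f, g] - α ![a, b, d, f] * β ![c, e, g]
        + α ![a, b, d, g] * β ![c, e, f] + α ![a, b, e, f] * β ![c, d, g]
        - α ![a, b, e, g] * β ![c, d, f] + α ![a, b, f, g] * β ![c, d, e]
        - α ![a, c, d, e] * β ![b, f, g] + α ![a, c, d, f] * β ![b, e, g]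
        - α ![a, c, d, g] * β ![b, e, f] - α ![a, c, e, f] * β ![b, d, g]
        + α ![a, c, e, g] * β ![b, d, f] - α ![a, c, f, g] * β ![b, d, e]
        + α ![a, d, e, f] * β ![b, c, g] - α ![a, d, e, g] * β ![b, c, f]
        + α ![a, d, f, g] * β ![b, c, e] - α ![a, e, f, g] * β ![b, c, d]
        + α ![b, c, d, e] * β ![a, f, g] - α ![b, c, d, f] * β ![a, e, g]
        + α ![b, c, d, g] * β ![a, e, f] + α ![b, c, e, f] * β ![a, d, g]
        - α ![b, c, e, g] * β ![a, d, f] + α ![b, c, f, g] * β ![a, d, e]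
        - α ![b, d, e, f] * β ![a, c, g] + α ![b, d, e, g] * β ![a, c, f]
        - α ![b, d, f, g] * β ![a, c, e] + α ![b, e, f, g] * β ![a, c, d]
        + α ![c, d, e, f] * β ![a, b, g] - α ![c, d, e, g] * β ![a, b, f]
        + α ![c, d, f, g] * β ![a, b, e] - α ![c, e, f, g] * β ![a, b, d]
        + α ![d, e, f, g] * β ![a, b, c] := by
  rw [wedge_cons (m := 3) (n := 2) α β a ![b, c, d, e, f, g]
    ![b, c, d, e, f, g] rfl, wedge_three_three, wedge_four_two]
  simp only [AlternatingMap.curryLeft_apply_apply]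
  ring

end WedgeExpansion

/-! ### Bilinearity of the wedge product. -/

section WedgeLinear

variable {V : Type*} [AddCommGroup V] [Module ℝ V]

theorem wedge_add_left {m n : ℕ} (α α' : V [⋀^Fin m]→ₗ[ℝ] ℝ) (β : V [⋀^Fin n]→ₗ[ℝ] ℝ) :
    wedge (α + α') β = wedge α β + wedge α' β := by
  ext v
  apply mul_left_cancel₀ (show (m.factorial * n.factorial : ℝ) ≠ 0 by positivity)
  rw [AlternatingMap.add_apply, mul_add, factorial_mul_wedge, factorial_mul_wedge,
    factorial_mul_wedge, signedSum, signedSum, signedSum, ← Finset.sum_add_distrib]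
  refine Finset.sum_congr rfl fun σ _ => ?_
  simp only [tensorValue, AlternatingMap.add_apply]
  ring

theorem wedge_add_right {m n : ℕ} (α : V [⋀^Fin m]→ₗ[ℝ] ℝ) (β β' : V [⋀^Fin n]→ₗ[ℝ] ℝ) :
    wedge α (β + β') = wedge α β + wedge α β' := by
  ext v
  apply mul_left_cancel₀ (show (m.factorial * n.factorial : ℝ) ≠ 0 by positivity)
  rw [AlternatingMap.add_apply, mul_add, factorial_mul_wedge, factorial_mul_wedge,
    factorial_mul_wedge, signedSum, signedSum, signedSum, ← Finset.sum_add_distrib]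
  refine Finset.sum_congr rfl fun σ _ => ?_
  simp only [tensorValue, AlternatingMap.add_apply]
  ring

theorem wedge_smul_left {m n : ℕ} (c : ℝ) (α : V [⋀^Fin m]→ₗ[ℝ] ℝ) (β : V [⋀^Fin n]→ₗ[ℝ] ℝ) :
    wedge (c • α) β = c • wedge α β := by
  ext v
  apply mul_left_cancel₀ (show (m.factorial * n.factorial : ℝ) ≠ 0 by positivity)
  rw [AlternatingMap.smul_apply, smul_eq_mul, mul_left_comm, factorial_mul_wedge,
    factorial_mul_wedge, signedSum, signedSum, Finset.mul_sum]
  refine Finset.sum_congr rfl fun σ _ => ?_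
  simp only [tensorValue, AlternatingMap.smul_apply, smul_eq_mul]
  ring

theorem wedge_smul_right {m n : ℕ} (c : ℝ) (α : V [⋀^Fin m]→ₗ[ℝ] ℝ) (β : V [⋀^Fin n]→ₗ[ℝ] ℝ) :
    wedge α (c • β) = c • wedge α β := by
  ext v
  apply mul_left_cancel₀ (show (m.factorial * n.factorial : ℝ) ≠ 0 by positivity)
  rw [AlternatingMap.smul_apply, smul_eq_mul, mul_left_comm, factorial_mul_wedge,
    factorial_mul_wedge, signedSum, signedSum, Finset.mul_sum]
  refine Finset.sum_congr rfl fun σ _ => ?_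
  simp only [tensorValue, AlternatingMap.smul_apply, smul_eq_mul]
  ring

theorem wedge_two_comm (α β : V [⋀^Fin 2]→ₗ[ℝ] ℝ) : wedge α β = wedge β α := by
  ext v
  have hv : v = ![v 0, v 1, v 2, v 3] := by ext i; fin_cases i <;> rfl
  rw [hv, wedge_two_two, wedge_two_two]
  ring

/-- Alternating maps agree if they agree on strictly increasing families of basis vectors. -/
theorem ext_alternating_strictMono {ι : Type*} [LinearOrder ι] {n : ℕ}
    {f g : V [⋀^Fin n]→ₗ[ℝ] ℝ} (e : Module.Basis ι ℝ V)
    (h : ∀ v : Fin n → ι, StrictMono v → (f fun i => e (v i)) = g fun i => e (v i)) : f = g := by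
  refine Module.Basis.ext_alternating e fun v hv => ?_
  have hs : StrictMono (v ∘ Tuple.sort v) :=
    (Tuple.monotone_sort v).strictMono_of_injective (hv.comp (Tuple.sort v).injective)
  have h1 := h _ hs
  have e1 := f.map_perm (fun i => e (v i)) (Tuple.sort v)
  have e2 := g.map_perm (fun i => e (v i)) (Tuple.sort v)
  simp only [Function.comp_def] at e1 e2 h1
  rw [e1, e2] at h1
  exact smul_left_cancel _ h1

end WedgeLinear

/-! ### 3-forms as trilinear maps, and the polarised form of u ↦ (i_u φ)² ∧ φ. -/

section ThreeForms

variable {V : Type*} [AddCommGroup V] [Module ℝ V]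

theorem map_swap_zero_one (φ : V [⋀^Fin 3]→ₗ[ℝ] ℝ) (x y z : V) :
    φ ![y, x, z] = -φ ![x, y, z] := by
  rw [← φ.map_swap ![x, y, z] (i := 0) (j := 1) (by decide)]
  congr 1
  ext i
  fin_cases i <;> rfl

theorem map_swap_one_two (φ : V [⋀^Fin 3]→ₗ[ℝ] ℝ) (x y z : V) :
    φ ![x, z, y] = -φ ![x, y, z] := by
  rw [← φ.map_swap ![x, y, z] (i := 1) (j := 2) (by decide)]
  congr 1
  ext i
  fin_cases i <;> rfl

theorem map_rotate (φ : V [⋀^Fin 3]→ₗ[ℝ] ℝ) (x y z : V) : φ ![y, z, x] = φ ![x, y, z] := by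
  rw [map_swap_one_two, map_swap_zero_one, neg_neg]

/-- A `3`-form as a trilinear map. -/
def tri (φ : V [⋀^Fin 3]→ₗ[ℝ] ℝ) : V →ₗ[ℝ] V →ₗ[ℝ] V →ₗ[ℝ] ℝ :=
  LinearMap.mk₂ ℝ
    (fun x y =>
      { toFun := fun z => φ ![x, y, z]
        map_add' := fun z z' => by
          rw [← map_rotate φ x y, ← map_rotate φ x y, ← map_rotate φ x y, ← map_rotate φ y,
            ← map_rotate φ y, ← map_rotate φ y, AlternatingMap.map_vecCons_add]
        map_smul' := fun c z => by
          rw [← map_rotate φ x y, ← map_rotate φ x y, ← map_rotate φ y,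
            ← map_rotate φ y, AlternatingMap.map_vecCons_smul, RingHom.id_apply] })
    (fun x x' y => by ext z; exact φ.map_vecCons_add _ _ _)
    (fun c x y => by ext z; exact φ.map_vecCons_smul _ _ _)
    (fun x y y' => by
      ext z
      change φ ![x, y + y', z] = φ ![x, y, z] + φ ![x, y', z]
      rw [← map_rotate, ← map_rotate φ x y, ← map_rotate φ x y', AlternatingMap.map_vecCons_add])
    (fun c x y => by
      ext z
      change φ ![x, c • y, z] = c • φ ![x, y, z]
      rw [← map_rotate, ← map_rotate φ x y, AlternatingMap.map_vecCons_smul])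

theorem tri_apply (φ : V [⋀^Fin 3]→ₗ[ℝ] ℝ) (x y z : V) : tri φ x y z = φ ![x, y, z] := rfl

theorem tri_swap (φ : V [⋀^Fin 3]→ₗ[ℝ] ℝ) (x y z : V) : tri φ y x z = -tri φ x y z :=
  map_swap_zero_one φ x y z

theorem tri_swap' (φ : V [⋀^Fin 3]→ₗ[ℝ] ℝ) (x y z : V) : tri φ x z y = -tri φ x y z :=
  map_swap_one_two φ x y z

theorem tri_rotate (φ : V [⋀^Fin 3]→ₗ[ℝ] ℝ) (x y z : V) : tri φ y z x = tri φ x y z :=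
  map_rotate φ x y z

theorem tri_self (φ : V [⋀^Fin 3]→ₗ[ℝ] ℝ) (x z : V) : tri φ x x z = 0 := by
  have := tri_swap φ x x z
  linarith

theorem tri_self' (φ : V [⋀^Fin 3]→ₗ[ℝ] ℝ) (x z : V) : tri φ z x x = 0 := by
  have := tri_swap' φ z x x
  linarith

theorem tri_self'' (φ : V [⋀^Fin 3]→ₗ[ℝ] ℝ) (x z : V) : tri φ x z x = 0 := by
  rw [tri_swap', tri_self, neg_zero]

/-- The symmetric bilinear form `(u, v) ↦ (i_u φ ∧ i_v φ ∧ φ)(c)`. -/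
def cubeForm (φ : V [⋀^Fin 3]→ₗ[ℝ] ℝ) (c : Fin 7 → V) : V →ₗ[ℝ] V →ₗ[ℝ] ℝ :=
  LinearMap.mk₂ ℝ (fun u v => wedge (wedge (φ.curryLeft u) (φ.curryLeft v)) φ c)
    (fun u u' v => by
      rw [map_add, wedge_add_left, wedge_add_left, AlternatingMap.add_apply])
    (fun a u v => by
      rw [map_smul, wedge_smul_left, wedge_smul_left, AlternatingMap.smul_apply])
    (fun u v v' => by
      rw [map_add, wedge_add_right, wedge_add_left, AlternatingMap.add_apply])
    (fun a u v => by
      rw [map_smul, wedge_smul_right, wedge_smul_left, AlternatingMap.smul_apply])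

theorem cubeForm_apply (φ : V [⋀^Fin 3]→ₗ[ℝ] ℝ) (c : Fin 7 → V) (u v : V) :
    cubeForm φ c u v = wedge (wedge (φ.curryLeft u) (φ.curryLeft v)) φ c := by
  rw [cubeForm, LinearMap.mk₂_apply]

theorem cubeForm_self (φ : V [⋀^Fin 3]→ₗ[ℝ] ℝ) (c : Fin 7 → V) (u : V) :
    cubeForm φ c u u = contractionCube φ u c := by
  rw [cubeForm_apply, contractionCube]

theorem cubeForm_symm (φ : V [⋀^Fin 3]→ₗ[ℝ] ℝ) (c : Fin 7 → V) (u v : V) :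
    cubeForm φ c u v = cubeForm φ c v u := by
  rw [cubeForm_apply, wedge_two_comm, cubeForm_apply]

attribute [irreducible] cubeForm

/-- The 7-forms form a line, so changing the seven arguments only multiplies by a determinant:
`cubeForm` is one symmetric form up to scale. -/
theorem cubeForm_eq_det_mul (φ : V [⋀^Fin 3]→ₗ[ℝ] ℝ) (b : Module.Basis (Fin 7) ℝ V)
    (c : Fin 7 → V) (u v : V) : cubeForm φ c u v = b.det c * cubeForm φ b u v := by
  rw [cubeForm_apply, AlternatingMap.eq_smul_basis_det b
    (wedge (wedge (φ.curryLeft u) (φ.curryLeft v)) φ : V [⋀^Fin 7]→ₗ[ℝ] ℝ),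
    AlternatingMap.smul_apply, smul_eq_mul, mul_comm, cubeForm_apply]

end ThreeForms

/-! ### Linear systems and extension of independent families. -/

section LinearSystems

variable {V : Type*} [AddCommGroup V] [Module ℝ V]

/-- Solvability of a finite linear system. -/
theorem exists_forall_apply_eq {ι : Type*} [Fintype ι] (f : ι → V →ₗ[ℝ] ℝ) (y : ι → ℝ)
    (h : ∀ a : ι → ℝ, (∀ x, ∑ i, a i * f i x = 0) → ∑ i, a i * y i = 0) :
    ∃ x, ∀ i, f i x = y i := by
  classical
  by_contra hne
  have hy : y ∉ LinearMap.range (LinearMap.pi f) := by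
    rintro ⟨x, hx⟩
    exact hne ⟨x, fun i => by rw [← hx]; rfl⟩
  -- A functional vanishing on the range but not at y: its coefficients are a linear relation
  -- between the f i that y violates.
  obtain ⟨g, hg, hker⟩ := Submodule.exists_le_ker_of_notMem hy
  have hexp : ∀ z : ι → ℝ, g z = ∑ i, g (Pi.single i 1) * z i := by
    intro z
    conv_lhs => rw [LinearMap.pi_apply_eq_sum_univ g z]
    refine Finset.sum_congr rfl fun i _ => ?_
    rw [smul_eq_mul, mul_comm]
    congr 2
    ext j
    simp [Pi.single_apply, eq_comm]
  apply hg
  rw [hexp]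
  refine h _ fun x => ?_
  rw [← hexp (fun i => f i x)]
  exact hker ⟨x, rfl⟩

theorem exists_linearIndependent_extend [FiniteDimensional ℝ V] (d : ℕ) :
    ∀ (n : ℕ) (v : Fin n → V), LinearIndependent ℝ v → n + d ≤ Module.finrank ℝ V →
      ∃ w : Fin (n + d) → V, LinearIndependent ℝ w ∧ ∀ i, w (Fin.castAdd d i) = v i := by
  induction d with
  | zero => exact fun n v hv _ => ⟨v, hv, fun i => rfl⟩
  | succ d ih =>
    intro n v hv hn
    obtain ⟨w, hw, hwv⟩ := ih n v hv (by omega)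
    obtain ⟨x, hx⟩ := exists_linearIndependent_snoc_of_lt_finrank hw (by omega)
    refine ⟨Fin.snoc w x, hx, fun i => ?_⟩
    rw [← hwv i]
    exact Fin.snoc_castSucc (α := fun _ => V) x w (Fin.castAdd d i)

end LinearSystems

/-! ### The model 3-form on ℝ⁷. -/

section StandardForm

variable {V : Type*} [AddCommGroup V] [Module ℝ V]

/-- The `3 × 3` minor of the coordinates `a, b, c` of three vectors. -/
def minor (a b c : Fin 7) (x y z : Fin 7 → ℝ) : ℝ :=
  x a * (y b * z c - y c * z b) - x b * (y a * z c - y c * z a) + x c * (y a * z b - y b * z a)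

/-- The model `3`-form on `ℝ⁷` for `t = 1`; the parameter rescales part of the terms. -/
def modelForm (t : ℝ) (x y z : Fin 7 → ℝ) : ℝ :=
  minor 0 1 2 x y z + minor 0 3 4 x y z + t * minor 0 5 6 x y z + minor 1 3 5 x y z
    - t * minor 1 4 6 x y z - minor 2 3 6 x y z - t * minor 2 4 5 x y z

/-- The basis `e` is adapted to the `3`-form `φ`: in its coordinates `φ` is the model form. -/
def IsAdapted (φ : V [⋀^Fin 3]→ₗ[ℝ] ℝ) (e : Module.Basis (Fin 7) ℝ V) : Prop :=
  ∀ x y z, tri φ x y z = modelForm 1 (e.repr x) (e.repr y) (e.repr z)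

theorem oneForm_apply (θ : V →ₗ[ℝ] ℝ) (x : V) : oneForm θ ![x] = θ x := rfl

/-- The alternating map of the minor `a, b, c`. -/
def minorForm (e : Module.Basis (Fin 7) ℝ V) (a b c : Fin 7) : V [⋀^Fin 3]→ₗ[ℝ] ℝ :=
  wedge (wedge (oneForm (e.coord a)) (oneForm (e.coord b))) (oneForm (e.coord c))

theorem minorForm_apply (e : Module.Basis (Fin 7) ℝ V) (a b c : Fin 7) (x y z : V) :
    minorForm e a b c ![x, y, z] = minor a b c (e.repr x) (e.repr y) (e.repr z) := by
  rw [minorForm, wedge_two_one]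
  simp only [wedge_one_one, oneForm_apply, Module.Basis.coord_apply, minor]
  ring

/-- The alternating map given by the model form in the coordinates of `e`. -/
def modelAlt (e : Module.Basis (Fin 7) ℝ V) (t : ℝ) : V [⋀^Fin 3]→ₗ[ℝ] ℝ :=
  minorForm e 0 1 2 + minorForm e 0 3 4 + t • minorForm e 0 5 6 + minorForm e 1 3 5
    - t • minorForm e 1 4 6 - minorForm e 2 3 6 - t • minorForm e 2 4 5

theorem modelAlt_apply (e : Module.Basis (Fin 7) ℝ V) (t : ℝ) (x y z : V) :
    modelAlt e t ![x, y, z] = modelForm t (e.repr x) (e.repr y) (e.repr z) := by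
  simp only [modelAlt, modelForm, AlternatingMap.add_apply, AlternatingMap.sub_apply,
    AlternatingMap.smul_apply, minorForm_apply, smul_eq_mul]

/-- A `3`-form is determined by its values on increasing triples of basis vectors. -/
theorem tri_eq_modelForm {φ : V [⋀^Fin 3]→ₗ[ℝ] ℝ} {e : Module.Basis (Fin 7) ℝ V} {t : ℝ}
    (h : ∀ i j k : Fin 7, i < j → j < k → tri φ (e i) (e j) (e k)
      = modelForm t (Pi.single i 1) (Pi.single j 1) (Pi.single k 1)) (x y z : V) :
    tri φ x y z = modelForm t (e.repr x) (e.repr y) (e.repr z) := by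
  have hφ : φ = modelAlt e t := by
    refine ext_alternating_strictMono e fun v hv => ?_
    have h1 := h (v 0) (v 1) (v 2) (hv (by decide)) (hv (by decide))
    have hv' : (fun i => e (v i)) = ![e (v 0), e (v 1), e (v 2)] := by
      ext1 i; fin_cases i <;> rfl
    rw [hv', modelAlt_apply, ← tri_apply, h1]
    congr 1 <;> simp [Finsupp.single_eq_pi_single]
  rw [tri_apply, ← modelAlt_apply, ← hφ]

end StandardForm

/-! ### Existence of adapted frames for a positive 3-form. -/

section AdaptedFrame

variable {V : Type*} [AddCommGroup V] [Module ℝ V]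

theorem finrank_of_basis (b : Module.Basis (Fin 7) ℝ V) : Module.finrank ℝ V = 7 := by
  rw [Module.finrank_eq_card_basis b, Fintype.card_fin]

/-- The contraction of a positive `3`-form with a non-zero vector has a one-dimensional kernel. -/
theorem exists_smul_of_tri_eq_zero {φ : V [⋀^Fin 3]→ₗ[ℝ] ℝ} (b : Module.Basis (Fin 7) ℝ V)
    (hH : ∀ u, u ≠ 0 → cubeForm φ b u u ≠ 0) {v x : V} (hv : v ≠ 0)
    (h : ∀ z, tri φ v x z = 0) : ∃ t : ℝ, x = t • v := by
  by_contra hne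
  have hli : LinearIndependent ℝ ![v, x] := by
    rw [LinearIndependent.pair_iff' hv]
    exact fun a ha => hne ⟨a, ha.symm⟩
  have hfin := finrank_of_basis b
  have : FiniteDimensional ℝ V := b.finiteDimensional_of_finite
  obtain ⟨w, hw, hwv⟩ := exists_linearIndependent_extend 5 2 ![v, x] hli (by omega)
  have hwv0 : w 0 = v := hwv 0
  have hwv1 : w 1 = x := hwv 1
  have hdet : b.det w ≠ 0 := by
    let c := basisOfLinearIndependentOfCardEqFinrank hw (by simp [hfin])
    have hc : ⇑c = w := coe_basisOfLinearIndependentOfCardEqFinrank hw _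
    rw [← hc]
    exact (b.isUnit_det c).ne_zero
  -- In each term of (i_v φ)² ∧ φ on a basis starting with v, x, a factor i_v φ that receives v or x
  -- vanishes; otherwise both go into the last factor, which is then φ(v, x, ·) = 0. This
  -- contradicts non-degeneracy at v.
  have h0 : cubeForm φ w v v = 0 := by
    have hw7 : w = ![v, x, w 2, w 3, w 4, w 5, w 6] := by
      ext1 i
      fin_cases i
      exacts [hwv0, hwv1, rfl, rfl, rfl, rfl, rfl]
    rw [hw7, cubeForm_apply, wedge_four_three]
    simp only [wedge_two_two, AlternatingMap.curryLeft_apply_apply, ← tri_apply, h, tri_self]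
    ring
  rw [cubeForm_eq_det_mul φ b] at h0
  exact (mul_ne_zero hdet (hH v hv)) h0

/-- The first three vectors of an adapted frame, the first one in a given direction. -/
theorem exists_associative_triple {φ : V [⋀^Fin 3]→ₗ[ℝ] ℝ} (b : Module.Basis (Fin 7) ℝ V)
    (hH : ∀ u, u ≠ 0 → 0 < cubeForm φ b u u) {ν : V} (hν : ν ≠ 0) :
    ∃ (s k : ℝ) (u v w : V), 0 < s ∧ u = s • ν ∧ cubeForm φ b u v = 0 ∧ cubeForm φ b u w = 0 ∧
      cubeForm φ b v w = 0 ∧ cubeForm φ b v v = cubeForm φ b u u ∧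
      cubeForm φ b w w = cubeForm φ b u u ∧ tri φ u v w = 1 ∧ u ≠ 0 ∧
      ∀ x, tri φ v w x = k * cubeForm φ b u x := by
  have hfin := finrank_of_basis b
  have : FiniteDimensional ℝ V := b.finiteDimensional_of_finite
  set H := cubeForm φ b with hHdef
  have hsymm : ∀ x y, H x y = H y x := cubeForm_symm φ b
  obtain ⟨v, hvker, hv⟩ : ∃ v, H ν v = 0 ∧ v ≠ 0 := by
    have := LinearMap.ker_ne_bot_of_finrank_lt (f := H ν) (by simp [hfin])
    obtain ⟨v, hv, hv0⟩ := Submodule.exists_mem_ne_zero_of_ne_bot this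
    exact ⟨v, hv, hv0⟩
  -- The kernel of i_v φ is the line of v, so its image is the annihilator of v. It contains H(ν,
  -- ·)/H(ν, ν) because v is orthogonal to ν. The normalisation makes φ(ν, v, w₀) = 1.
  obtain ⟨w₀, hw₀⟩ : ∃ w₀, ∀ x, tri φ v w₀ x = H ν x / H ν ν := by
    obtain ⟨w₀, hw₀⟩ := exists_forall_apply_eq (fun j => (tri φ v).flip (b j))
      (fun j => H ν (b j) / H ν ν) (by
        intro a ha
        have hx : ∀ y, tri φ v (∑ i, a i • b i) y = 0 := by
          intro y
          rw [← neg_eq_zero, ← tri_swap', map_sum, ← ha y]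
          simp
        obtain ⟨t, ht⟩ := exists_smul_of_tri_eq_zero b (fun u hu => (hH u hu).ne') hv hx
        have : ∑ i, a i * (H ν (b i) / H ν ν) = H ν (∑ i, a i • b i) / H ν ν := by
          rw [map_sum, Finset.sum_div]
          exact Finset.sum_congr rfl fun i _ => by rw [map_smul, smul_eq_mul]; ring
        rw [this, ht, map_smul, hvker, smul_zero, zero_div])
    refine ⟨w₀, fun x => ?_⟩
    have : tri φ v w₀ = (1 / H ν ν) • H ν := by
      refine b.ext fun i => ?_
      have := hw₀ i
      simp only [LinearMap.flip_apply] at this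
      rw [this, LinearMap.smul_apply, smul_eq_mul]
      ring
    rw [this, LinearMap.smul_apply, smul_eq_mul]
    ring
  clear_value H
  have hA := hH ν hν
  have hB := hH v hv
  have hνw₀ : H ν w₀ = 0 := by
    have := hw₀ w₀
    rw [tri_self', eq_comm, div_eq_zero_iff] at this
    exact this.resolve_right hA.ne'
  -- Subtracting a multiple of v makes w orthogonal to v and does not change φ(v, w, ·).
  set w := w₀ - (H v w₀ / H v v) • v with hw
  have htri : ∀ x, tri φ v w x = H ν x / H ν ν := by
    intro x
    rw [hw, map_sub, map_smul, LinearMap.sub_apply, LinearMap.smul_apply, tri_self, hw₀]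
    simp
  have hνw : H ν w = 0 := by rw [hw, map_sub, map_smul, hνw₀, hvker]; simp
  have hvw : H v w = 0 := by
    rw [hw, map_sub, map_smul, smul_eq_mul]
    field_simp
    ring
  have htri1 : tri φ ν v w = 1 := by
    rw [← tri_rotate, htri, div_self hA.ne']
  have hw0 : w ≠ 0 := by
    rintro h
    rw [h, map_zero] at htri1
    exact zero_ne_one htri1
  have hC := hH w hw0
  set A := H ν ν with hAdef
  set B := H v v with hBdef
  set C := H w w with hCdef
  -- With H-lengths A^½, B^½, C^½, rescaling all three vectors to length s multiplies φ(ν, v, w) = 1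
  -- by s³/(√A √B √C); the cube root brings it back to 1.
  set s : ℝ := (√A * √B * √C) ^ (1 / 3 : ℝ) with hs
  have hprod : 0 < √A * √B * √C := by positivity
  have hs0 : 0 < s := by positivity
  have hs3 : s ^ 3 = √A * √B * √C := by
    rw [hs, ← Real.rpow_natCast, ← Real.rpow_mul hprod.le]
    norm_num
  have hsA : √A * √A = A := Real.mul_self_sqrt hA.le
  have hsB : √B * √B = B := Real.mul_self_sqrt hB.le
  have hsC : √C * √C = C := Real.mul_self_sqrt hC.le
  have hA' : √A ≠ 0 := (Real.sqrt_pos.2 hA).ne'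
  have hB' : √B ≠ 0 := (Real.sqrt_pos.2 hB).ne'
  have hC' : √C ≠ 0 := (Real.sqrt_pos.2 hC).ne'
  have nA : s / √A * (s / √A * A) = s ^ 2 := by field_simp; rw [pow_two, hsA]
  refine ⟨s / √A, s / √B * (s / √C) / (s / √A) / A, (s / √A) • ν, (s / √B) • v, (s / √C) • w,
    by positivity, rfl, ?_, ?_, ?_, ?_, ?_, ?_, ?_, ?_⟩
  · simp only [map_smul, LinearMap.smul_apply, hvker, smul_zero]
  · simp only [map_smul, LinearMap.smul_apply, hνw, smul_zero]
  · simp only [map_smul, LinearMap.smul_apply, hvw, smul_zero]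
  · simp only [map_smul, LinearMap.smul_apply, smul_eq_mul, ← hAdef, ← hBdef, nA]
    field_simp
    rw [pow_two, hsB]
  · simp only [map_smul, LinearMap.smul_apply, smul_eq_mul, ← hAdef, ← hCdef, nA]
    field_simp
    rw [pow_two, hsC]
  · simp only [map_smul, LinearMap.smul_apply, htri1, smul_eq_mul]
    field_simp
    linarith
  · exact smul_ne_zero (by positivity) hν
  · intro x
    simp only [map_smul, LinearMap.smul_apply, htri, smul_eq_mul]
    field_simp

/-- The values of `cubeForm` on the vectors of a partially adapted frame. -/
theorem cubeForm_partial_frame {φ : V [⋀^Fin 3]→ₗ[ℝ] ℝ} {u v w e₃ e₄ e₅ e₆ : V}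
    {c : Fin 7 → V} (hc : c = ![u, v, w, e₃, e₄, e₅, e₆])
    (huvw : tri φ u v w = 1)
    (huv3 : tri φ u v e₃ = 0) (huv4 : tri φ u v e₄ = 0) (huv5 : tri φ u v e₅ = 0)
    (huv6 : tri φ u v e₆ = 0)
    (huw3 : tri φ u w e₃ = 0) (huw4 : tri φ u w e₄ = 0) (huw5 : tri φ u w e₅ = 0)
    (huw6 : tri φ u w e₆ = 0)
    (hvw3 : tri φ v w e₃ = 0) (hvw4 : tri φ v w e₄ = 0) (hvw5 : tri φ v w e₅ = 0)
    (hvw6 : tri φ v w e₆ = 0)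
    (hu34 : tri φ u e₃ e₄ = 1) (hu35 : tri φ u e₃ e₅ = 0) (hu36 : tri φ u e₃ e₆ = 0)
    (hv34 : tri φ v e₃ e₄ = 0) (hv35 : tri φ v e₃ e₅ = 1) (hv36 : tri φ v e₃ e₆ = 0)
    (hw34 : tri φ w e₃ e₄ = 0) (hw35 : tri φ w e₃ e₅ = 0) (hw36 : tri φ w e₃ e₆ = -1)
    (hu45 : tri φ u e₄ e₅ = 0) (hu46 : tri φ u e₄ e₆ = 0) (hv45 : tri φ v e₄ e₅ = 0) :
    cubeForm φ c u u = 6 * tri φ u e₅ e₆ ∧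
    cubeForm φ c v v = -6 * tri φ v e₄ e₆ ∧
    cubeForm φ c w w = -6 * tri φ w e₄ e₅ ∧
    cubeForm φ c u v = 3 * tri φ v e₅ e₆ ∧
    cubeForm φ c u w = 3 * tri φ w e₅ e₆ ∧
    cubeForm φ c v w = -3 * tri φ w e₄ e₆ ∧
    cubeForm φ c u e₃ = 3 * tri φ e₃ e₅ e₆ ∧
    cubeForm φ c u e₄ = 3 * tri φ e₄ e₅ e₆ ∧
    cubeForm φ c u e₅ = 3 * tri φ u e₅ e₆ * tri φ e₃ e₄ e₅ ∧
    cubeForm φ c u e₆ = 3 * tri φ u e₅ e₆ * tri φ e₃ e₄ e₆ := by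
  refine ⟨?_, ?_, ?_, ?_, ?_, ?_, ?_, ?_, ?_, ?_⟩ <;>
  · rw [hc, cubeForm_apply, wedge_four_three]
    simp only [wedge_two_two, AlternatingMap.curryLeft_apply_apply, ← tri_apply]
    simp only [tri_self, tri_self',
      tri_swap φ u v, tri_swap φ u w, tri_swap φ u e₃, tri_swap φ u e₄,
      tri_swap φ u e₅, tri_swap φ u e₆, tri_swap φ v w,
      (fun x => tri_swap' φ x v w), tri_swap φ v e₃, (fun x => tri_swap' φ x v e₃),
      tri_swap φ v e₄, (fun x => tri_swap' φ x v e₄), tri_swap φ v e₅,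
      (fun x => tri_swap' φ x v e₅), tri_swap φ v e₆, (fun x => tri_swap' φ x v e₆),
      tri_swap φ w e₃, (fun x => tri_swap' φ x w e₃), tri_swap φ w e₄,
      (fun x => tri_swap' φ x w e₄), tri_swap φ w e₅, (fun x => tri_swap' φ x w e₅),
      tri_swap φ w e₆, (fun x => tri_swap' φ x w e₆), tri_swap φ e₃ e₄,
      (fun x => tri_swap' φ x e₃ e₄), tri_swap φ e₃ e₅, (fun x => tri_swap' φ x e₃ e₅),
      tri_swap φ e₃ e₆, (fun x => tri_swap' φ x e₃ e₆), tri_swap φ e₄ e₅,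
      (fun x => tri_swap' φ x e₄ e₅), tri_swap φ e₄ e₆, (fun x => tri_swap' φ x e₄ e₆),
      tri_swap φ e₅ e₆, (fun x => tri_swap' φ x e₅ e₆),
      huvw, huv3, huv4, huv5, huv6, huw3, huw4, huw5, huw6, hvw3, hvw4, hvw5, hvw6, hu34, hu35,
      hu36, hv34, hv35, hv36, hw34, hw35, hw36, hu45, hu46, hv45, mul_zero, zero_mul, neg_zero,
      add_zero, zero_add, sub_zero, zero_sub, mul_one, one_mul]
    ring

/-- In an adapted basis, `cubeForm` is six times the Euclidean scalar product. -/
theorem IsAdapted.cubeForm_eq {φ : V [⋀^Fin 3]→ₗ[ℝ] ℝ} {e : Module.Basis (Fin 7) ℝ V}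
    (h : IsAdapted φ e) (u v : V) : cubeForm φ e u v = 6 * ∑ i, e.repr u i * e.repr v i := by
  have he : ⇑e = ![e 0, e 1, e 2, e 3, e 4, e 5, e 6] := by ext1 i; fin_cases i <;> rfl
  rw [he, cubeForm_apply, wedge_four_three]
  simp only [wedge_two_two, AlternatingMap.curryLeft_apply_apply, ← tri_apply]
  simp [h _ _ _, modelForm, minor, Fin.sum_univ_seven]
  ring

/-- Only the terms 034, 135, 236 of the model contain the index 3, and these do not involve t. The
value is therefore available before the sign of t is known, and fixes the orientation of the frame.
-/
theorem cubeForm_model_fourth {φ : V [⋀^Fin 3]→ₗ[ℝ] ℝ} {e : Module.Basis (Fin 7) ℝ V} {t : ℝ}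
    (h : ∀ x y z, tri φ x y z = modelForm t (e.repr x) (e.repr y) (e.repr z)) :
    cubeForm φ e (e 3) (e 3) = 6 := by
  have he : ⇑e = ![e 0, e 1, e 2, e 3, e 4, e 5, e 6] := by ext1 i; fin_cases i <;> rfl
  rw [he, cubeForm_apply, wedge_four_three]
  simp only [wedge_two_two, AlternatingMap.curryLeft_apply_apply, ← tri_apply]
  simp [h, modelForm, minor]
  norm_num

theorem mem_increasing_triples : ∀ i j k : Fin 7, i < j → j < k → (i, j, k) ∈
    [((0 : Fin 7), (1 : Fin 7), (2 : Fin 7)), (0, 1, 3), (0, 1, 4), (0, 1, 5), (0, 1, 6), (0, 2, 3),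
      (0, 2, 4), (0, 2, 5), (0, 2, 6), (0, 3, 4), (0, 3, 5), (0, 3, 6), (0, 4, 5), (0, 4, 6),
      (0, 5, 6), (1, 2, 3), (1, 2, 4), (1, 2, 5), (1, 2, 6), (1, 3, 4), (1, 3, 5), (1, 3, 6),
      (1, 4, 5), (1, 4, 6), (1, 5, 6), (2, 3, 4), (2, 3, 5), (2, 3, 6), (2, 4, 5), (2, 4, 6),
      (2, 5, 6), (3, 4, 5), (3, 4, 6), (3, 5, 6), (4, 5, 6)] := by
  decide

/-- A 3-form in dimension 7 has 35 components: the first 25 hypotheses are the normalisations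
achieved by choosing the frame, the other ten are those forced by the values of `cubeForm`. -/
theorem tri_eq_modelForm_of_partial_frame {φ : V [⋀^Fin 3]→ₗ[ℝ] ℝ} {u v w e₃ e₄ e₅ e₆ : V} {t : ℝ}
    {e : Module.Basis (Fin 7) ℝ V} (he : ⇑e = ![u, v, w, e₃, e₄, e₅, e₆])
    (huvw : tri φ u v w = 1)
    (huv3 : tri φ u v e₃ = 0) (huv4 : tri φ u v e₄ = 0) (huv5 : tri φ u v e₅ = 0)
    (huv6 : tri φ u v e₆ = 0)
    (huw3 : tri φ u w e₃ = 0) (huw4 : tri φ u w e₄ = 0) (huw5 : tri φ u w e₅ = 0)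
    (huw6 : tri φ u w e₆ = 0)
    (hvw3 : tri φ v w e₃ = 0) (hvw4 : tri φ v w e₄ = 0) (hvw5 : tri φ v w e₅ = 0)
    (hvw6 : tri φ v w e₆ = 0)
    (hu34 : tri φ u e₃ e₄ = 1) (hu35 : tri φ u e₃ e₅ = 0) (hu36 : tri φ u e₃ e₆ = 0)
    (hv34 : tri φ v e₃ e₄ = 0) (hv35 : tri φ v e₃ e₅ = 1) (hv36 : tri φ v e₃ e₆ = 0)
    (hw34 : tri φ w e₃ e₄ = 0) (hw35 : tri φ w e₃ e₅ = 0) (hw36 : tri φ w e₃ e₆ = -1)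
    (hu45 : tri φ u e₄ e₅ = 0) (hu46 : tri φ u e₄ e₆ = 0) (hv45 : tri φ v e₄ e₅ = 0)
    (ht : tri φ u e₅ e₆ = t) (m1 : tri φ v e₄ e₆ = -t) (m2 : tri φ w e₄ e₅ = -t)
    (m3 : tri φ v e₅ e₆ = 0) (m4 : tri φ w e₅ e₆ = 0) (m5 : tri φ w e₄ e₆ = 0)
    (m6 : tri φ e₃ e₅ e₆ = 0) (m7 : tri φ e₄ e₅ e₆ = 0) (m8 : tri φ e₃ e₄ e₅ = 0)
    (m9 : tri φ e₃ e₄ e₆ = 0) (x y z : V) :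
    tri φ x y z = modelForm t (e.repr x) (e.repr y) (e.repr z) := by
  refine tri_eq_modelForm (fun i j k hij hjk => ?_) x y z
  have := mem_increasing_triples i j k hij hjk
  simp only [List.mem_cons, Prod.mk.injEq, List.not_mem_nil, or_false] at this
  rcases this with ⟨rfl, rfl, rfl⟩ | ⟨rfl, rfl, rfl⟩ | ⟨rfl, rfl, rfl⟩ | ⟨rfl, rfl, rfl⟩ | ⟨rfl, rfl,
    rfl⟩ | ⟨rfl, rfl, rfl⟩ | ⟨rfl, rfl, rfl⟩ | ⟨rfl, rfl, rfl⟩ | ⟨rfl, rfl, rfl⟩ | ⟨rfl,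
    rfl, rfl⟩ | ⟨rfl, rfl, rfl⟩ | ⟨rfl, rfl, rfl⟩ | ⟨rfl, rfl, rfl⟩ | ⟨rfl, rfl, rfl⟩ |
    ⟨rfl, rfl, rfl⟩ | ⟨rfl, rfl, rfl⟩ | ⟨rfl, rfl, rfl⟩ | ⟨rfl, rfl, rfl⟩ | ⟨rfl, rfl,
    rfl⟩ | ⟨rfl, rfl, rfl⟩ | ⟨rfl, rfl, rfl⟩ | ⟨rfl, rfl, rfl⟩ | ⟨rfl, rfl, rfl⟩ | ⟨rfl,
    rfl, rfl⟩ | ⟨rfl, rfl, rfl⟩ | ⟨rfl, rfl, rfl⟩ | ⟨rfl, rfl, rfl⟩ | ⟨rfl, rfl, rfl⟩ |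
    ⟨rfl, rfl, rfl⟩ | ⟨rfl, rfl, rfl⟩ | ⟨rfl, rfl, rfl⟩ | ⟨rfl, rfl, rfl⟩ | ⟨rfl, rfl,
    rfl⟩ | ⟨rfl, rfl, rfl⟩ | ⟨rfl, rfl, rfl⟩ <;>
  simp [he, modelForm, minor, huvw, huv3, huv4, huv5, huv6, huw3, huw4, huw5, huw6, hvw3,
    hvw4, hvw5, hvw6, hu34, hu35, hu36, hv34, hv35, hv36, hw34, hw35, hw36, hu45, hu46, hv45,
    ht, m1, m2, m3, m4, m5, m6, m7, m8, m9]

/-- Scaling e₃ by √t and e₄, e₅, e₆ by 1/√t leaves the components 034, 135, 236 unchanged and turns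
the coefficients ±t into ±1. The first three vectors, hence the prescribed direction, stay fixed. -/
theorem exists_isAdapted_of_modelForm {φ : V [⋀^Fin 3]→ₗ[ℝ] ℝ} {e : Module.Basis (Fin 7) ℝ V}
    {t : ℝ} (hmodel : ∀ x y z, tri φ x y z = modelForm t (e.repr x) (e.repr y) (e.repr z))
    (htpos : 0 < t) : ∃ e' : Module.Basis (Fin 7) ℝ V, e' 0 = e 0 ∧ IsAdapted φ e' := by
  set r := √t with hr
  have hr0 : r ≠ 0 := (Real.sqrt_pos.2 htpos).ne'
  have hr2 : r * r = t := Real.mul_self_sqrt htpos.le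
  have hunit : ∀ i, IsUnit ((![1, 1, 1, r, r⁻¹, r⁻¹, r⁻¹] : Fin 7 → ℝ) i) := by
    intro i
    fin_cases i <;> simp [hr0]
  have hadapted : IsAdapted φ (e.isUnitSMul hunit) := by
    refine tri_eq_modelForm fun i j k hij hjk => ?_
    have hmem := mem_increasing_triples i j k hij hjk
    simp only [Module.Basis.isUnitSMul_apply, map_smul, LinearMap.smul_apply, hmodel,
      Module.Basis.repr_self, smul_eq_mul]
    simp only [List.mem_cons, Prod.mk.injEq, List.not_mem_nil, or_false] at hmem
    rcases hmem with ⟨rfl, rfl, rfl⟩ | ⟨rfl, rfl, rfl⟩ | ⟨rfl, rfl, rfl⟩ | ⟨rfl, rfl, rfl⟩ | ⟨rfl, rfl,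
      rfl⟩ | ⟨rfl, rfl, rfl⟩ | ⟨rfl, rfl, rfl⟩ | ⟨rfl, rfl, rfl⟩ | ⟨rfl, rfl, rfl⟩ | ⟨rfl,
      rfl, rfl⟩ | ⟨rfl, rfl, rfl⟩ | ⟨rfl, rfl, rfl⟩ | ⟨rfl, rfl, rfl⟩ | ⟨rfl, rfl, rfl⟩ |
      ⟨rfl, rfl, rfl⟩ | ⟨rfl, rfl, rfl⟩ | ⟨rfl, rfl, rfl⟩ | ⟨rfl, rfl, rfl⟩ | ⟨rfl, rfl,
      rfl⟩ | ⟨rfl, rfl, rfl⟩ | ⟨rfl, rfl, rfl⟩ | ⟨rfl, rfl, rfl⟩ | ⟨rfl, rfl, rfl⟩ | ⟨rfl,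
      rfl, rfl⟩ | ⟨rfl, rfl, rfl⟩ | ⟨rfl, rfl, rfl⟩ | ⟨rfl, rfl, rfl⟩ | ⟨rfl, rfl, rfl⟩ |
      ⟨rfl, rfl, rfl⟩ | ⟨rfl, rfl, rfl⟩ | ⟨rfl, rfl, rfl⟩ | ⟨rfl, rfl, rfl⟩ | ⟨rfl, rfl,
      rfl⟩ | ⟨rfl, rfl, rfl⟩ | ⟨rfl, rfl, rfl⟩ <;>
    simp [modelForm, minor, hr0, ← hr2]
  exact ⟨e.isUnitSMul hunit, by simp [Module.Basis.isUnitSMul_apply], hadapted⟩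

/-- On an adapted basis (i_u φ)² ∧ φ is positive for u = e₀, and positivity of φ says the same for
bases of orientation o, so the change of basis has positive determinant. -/
theorem IsAdapted.orientation_eq {o : Orientation ℝ V (Fin 7)} {φ : V [⋀^Fin 3]→ₗ[ℝ] ℝ}
    (hφ : IsPositiveForm o φ) {b e : Module.Basis (Fin 7) ℝ V} (hb : b.orientation = o)
    (h : IsAdapted φ e) : e.orientation = o := by
  rw [← hb, eq_comm, Module.Basis.orientation_eq_iff_det_pos]
  have h6 := h.cubeForm_eq (e 0) (e 0)
  rw [cubeForm_eq_det_mul φ b] at h6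
  have hpos := hφ _ (e.ne_zero 0) b hb
  rw [← cubeForm_self] at hpos
  simp only [Module.Basis.repr_self] at h6
  rw [Fin.sum_univ_seven] at h6
  simp at h6
  by_contra hle
  linarith [mul_nonpos_of_nonpos_of_nonneg (not_lt.1 hle) hpos.le]

set_option maxHeartbeats 1000000 in
/-- A positive `3`-form has an adapted, positively oriented basis whose first vector has a given
direction. -/
theorem exists_isAdapted {o : Orientation ℝ V (Fin 7)} {φ : V [⋀^Fin 3]→ₗ[ℝ] ℝ}
    (hφ : IsPositiveForm o φ) (b' : Module.Basis (Fin 7) ℝ V) {ν : V} (hν : ν ≠ 0) :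
    ∃ (e : Module.Basis (Fin 7) ℝ V) (s : ℝ), 0 < s ∧ e 0 = s • ν ∧ e.orientation = o ∧
      IsAdapted φ e := by
  have hfin := finrank_of_basis b'
  have : FiniteDimensional ℝ V := b'.finiteDimensional_of_finite
  obtain ⟨b, hb⟩ : ∃ b : Module.Basis (Fin 7) ℝ V, b.orientation = o :=
    ⟨b'.adjustToOrientation o, b'.orientation_adjustToOrientation o⟩
  have hH : ∀ u, u ≠ 0 → 0 < cubeForm φ b u u := fun u hu => by
    rw [cubeForm_self]; exact hφ u hu b hb
  obtain ⟨s, k, u, v, w, hs, hu, huv, huw, hvw, hvv, hww, huvw, hu0, hvwx⟩ :=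
    exists_associative_triple b hH hν
  -- Three linear conditions in dimension 7 leave a non-zero vector. Since φ(v, w, ·) is a multiple
  -- of H(u, ·), such a vector also has φ(v, w, e₃) = 0.
  obtain ⟨e₃, h3, he₃⟩ : ∃ e₃ : V, (cubeForm φ b u e₃ = 0 ∧ tri φ u v e₃ = 0 ∧
      tri φ u w e₃ = 0) ∧ e₃ ≠ 0 := by
    have := LinearMap.ker_ne_bot_of_finrank_lt
      (f := LinearMap.pi ![cubeForm φ b u, tri φ u v, tri φ u w]) (by simp [hfin])
    obtain ⟨x, hx, hx0⟩ := Submodule.exists_mem_ne_zero_of_ne_bot this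
    rw [LinearMap.mem_ker] at hx
    exact ⟨x, ⟨congrFun hx 0, congrFun hx 1, congrFun hx 2⟩, hx0⟩
  have huu := hH u hu0
  have htw : ∀ x, cubeForm φ b u x = 0 → tri φ v w x = 0 := fun x hx => by
    rw [hvwx, hx, mul_zero]
  -- The hypothesis puts b0 u + b1 v + b2 w in the kernel of i_{e₃} φ, which is the line of e₃. The
  -- functionals H(u, ·), φ(u, v, ·), φ(u, w, ·) vanish on e₃ and detect b0, b2 and b1 respectively.
  have hzero : ∀ b0 b1 b2 : ℝ, (∀ z, tri φ (b0 • u + b1 • v + b2 • w) e₃ z = 0) →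
      b0 = 0 ∧ b1 = 0 ∧ b2 = 0 := by
    intro b0 b1 b2 hz
    obtain ⟨t, ht⟩ := exists_smul_of_tri_eq_zero b (fun u hu => (hH u hu).ne') he₃
      (x := b0 • u + b1 • v + b2 • w) (fun z => by rw [tri_swap, hz, neg_zero])
    have t0 := congrArg (cubeForm φ b u) ht
    have t1 := congrArg (tri φ u v) ht
    have t2 := congrArg (tri φ u w) ht
    simp only [map_add, map_smul, smul_eq_mul, h3, huv, huw, mul_zero, add_zero, huvw, tri_self',
      tri_self'', tri_swap' φ u v w, zero_add, mul_one, mul_neg] at t0 t1 t2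
    exact ⟨(mul_eq_zero.1 t0).resolve_right huu.ne', by linarith, by linarith⟩
  -- The six functionals are independent: evaluating a relation at u, w, v removes the first three
  -- coefficients, and `hzero` removes the others.
  have hsolve : ∀ y0 y1 y2 : ℝ, ∃ x, cubeForm φ b u x = 0 ∧ tri φ u v x = 0 ∧ tri φ u w x = 0 ∧
      tri φ u e₃ x = y0 ∧ tri φ v e₃ x = y1 ∧ tri φ w e₃ x = y2 := by
    intro y0 y1 y2
    obtain ⟨x, hx⟩ := exists_forall_apply_eq
      ![cubeForm φ b u, tri φ u v, tri φ u w, tri φ u e₃, tri φ v e₃, tri φ w e₃]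
      ![0, 0, 0, y0, y1, y2] (by
        intro a ha
        simp only [Fin.sum_univ_six, Matrix.cons_val] at ha ⊢
        have q0 := ha u
        have q1 := ha w
        have q2 := ha v
        have r0 : tri φ v e₃ u = 0 := by rw [tri_rotate, h3.2.1]
        have r1 : tri φ w e₃ u = 0 := by rw [tri_rotate, h3.2.2]
        have r2 : tri φ u e₃ w = 0 := by rw [tri_swap', h3.2.2, neg_zero]
        have r3 : tri φ v e₃ w = 0 := by rw [tri_swap', htw e₃ h3.1, neg_zero]
        have r4 : tri φ u e₃ v = 0 := by rw [tri_swap', h3.2.1, neg_zero]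
        have r5 : tri φ w e₃ v = 0 := by rw [tri_rotate, htw e₃ h3.1]
        simp only [tri_self', tri_self'', huv, huw, huvw, r0, r1, r2, r3, r4, r5, mul_zero, add_zero,
          zero_add, mul_one, tri_swap' φ u v w, mul_neg] at q0 q1 q2
        have a0 : a 0 = 0 := (mul_eq_zero.1 q0).resolve_right huu.ne'
        have a2 : a 2 = 0 := by linarith
        obtain ⟨a3, a4, a5⟩ := hzero (a 3) (a 4) (a 5) (fun z => by
          have := ha z
          rw [a0, q1, a2] at this
          simp only [map_add, map_smul, LinearMap.add_apply, LinearMap.smul_apply, smul_eq_mul]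
          linarith)
        rw [a3, a4, a5]
        ring)
    exact ⟨x, hx 0, hx 1, hx 2, hx 3, hx 4, hx 5⟩
  -- The prescribed values are those of the model: components 034 and 135 equal 1, component 236
  -- equals −1.
  obtain ⟨f₄, f41, f42, f43, f44, f45, f46⟩ := hsolve 1 0 0
  obtain ⟨f₅, f51, f52, f53, f54, f55, f56⟩ := hsolve 0 1 0
  obtain ⟨f₆, f61, f62, f63, f64, f65, f66⟩ := hsolve 0 0 (-1)
  -- Adding a multiple of e₃ affects none of the six prescribed values. The three multiples are
  -- chosen to kill φ(u, e₄, e₆), φ(u, e₄, e₅) and φ(v, e₄, e₅).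
  obtain ⟨e₆, he₆⟩ : ∃ e₆, e₆ = f₆ + (tri φ u f₄ f₆) • e₃ := ⟨_, rfl⟩
  obtain ⟨e₅, he₅⟩ : ∃ e₅, e₅ = f₅ + (tri φ u f₄ f₅) • e₃ := ⟨_, rfl⟩
  obtain ⟨e₄, he₄⟩ : ∃ e₄, e₄ = f₄ + (-tri φ v f₄ f₅) • e₃ := ⟨_, rfl⟩
  obtain ⟨h31, h32, h33⟩ := h3
  have lin : ∀ {ℓ : V →ₗ[ℝ] ℝ} {x y : V} {c : ℝ}, y = x + c • e₃ → ℓ e₃ = 0 → ℓ y = ℓ x := by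
    intro ℓ x y c hy hl
    rw [hy, map_add, map_smul, hl, smul_zero, add_zero]
  have g41 := (lin he₄ h31).trans f41
  have g42 := (lin he₄ h32).trans f42
  have g43 := (lin he₄ h33).trans f43
  have g44 := (lin he₄ (tri_self' φ e₃ u)).trans f44
  have g45 := (lin he₄ (tri_self' φ e₃ v)).trans f45
  have g46 := (lin he₄ (tri_self' φ e₃ w)).trans f46
  have g51 := (lin he₅ h31).trans f51
  have g52 := (lin he₅ h32).trans f52
  have g53 := (lin he₅ h33).trans f53
  have g54 := (lin he₅ (tri_self' φ e₃ u)).trans f54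
  have g55 := (lin he₅ (tri_self' φ e₃ v)).trans f55
  have g56 := (lin he₅ (tri_self' φ e₃ w)).trans f56
  have g61 := (lin he₆ h31).trans f61
  have g62 := (lin he₆ h32).trans f62
  have g63 := (lin he₆ h33).trans f63
  have g64 := (lin he₆ (tri_self' φ e₃ u)).trans f64
  have g65 := (lin he₆ (tri_self' φ e₃ v)).trans f65
  have g66 := (lin he₆ (tri_self' φ e₃ w)).trans f66
  have hu46 : tri φ u e₄ e₆ = 0 := by
    rw [he₄, he₆]
    simp only [map_add, map_smul, LinearMap.add_apply, LinearMap.smul_apply, smul_eq_mul,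
      tri_self', f64, tri_swap' φ u e₃ f₄, f44]
    ring
  have hu45 : tri φ u e₄ e₅ = 0 := by
    rw [he₄, he₅]
    simp only [map_add, map_smul, LinearMap.add_apply, LinearMap.smul_apply, smul_eq_mul,
      tri_self', f54, tri_swap' φ u e₃ f₄, f44]
    ring
  have hv45 : tri φ v e₄ e₅ = 0 := by
    rw [he₄, he₅]
    simp only [map_add, map_smul, LinearMap.add_apply, LinearMap.smul_apply, smul_eq_mul,
      tri_self', f55, tri_swap' φ v e₃ f₄, f45]
    ring
  clear lin f41 f42 f43 f44 f45 f46 f51 f52 f53 f54 f55 f56 f61 f62 f63 f64 f65 f66 he₄ he₅ he₆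
  have hli : LinearIndependent ℝ ![u, v, w, e₃, e₄, e₅, e₆] := by
    rw [Fintype.linearIndependent_iff]
    intro g hg
    simp only [Fin.sum_univ_seven, Matrix.cons_val] at hg
    have q0 := congrArg (cubeForm φ b u) hg
    have q1 := congrArg (tri φ u v) hg
    have q2 := congrArg (tri φ u w) hg
    simp only [map_add, map_smul, smul_eq_mul, map_zero, huv, huw, h31, h32, h33, g41, g42, g43,
      g51, g52, g53, g61, g62, g63, tri_self', tri_self'', tri_swap' φ u v w, huvw, mul_zero,
      add_zero, zero_add, mul_one, mul_neg] at q0 q1 q2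
    have a0 : g 0 = 0 := (mul_eq_zero.1 q0).resolve_right huu.ne'
    have a1 : g 1 = 0 := by linarith
    rw [a0, a1, q1] at hg
    have q3 := congrArg (tri φ u e₃) hg
    have q4 := congrArg (tri φ v e₃) hg
    have q5 := congrArg (tri φ w e₃) hg
    simp only [map_add, map_smul, smul_eq_mul, map_zero, tri_self', g44, g54, g64, g45, g55, g65,
      g46, g56, g66, mul_zero, zero_mul, add_zero, zero_add, mul_one, mul_neg] at q3 q4 q5
    have a6 : g 6 = 0 := by linarith
    rw [q3, q4, a6] at hg
    have a3 : g 3 = 0 := by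
      simp only [zero_smul, zero_add, add_zero] at hg
      exact (smul_eq_zero.1 hg).resolve_right he₃
    intro i
    fin_cases i
    exacts [a0, a1, q1, a3, q3, q4, a6]
  have hcard : Fintype.card (Fin 7) = Module.finrank ℝ V := by simp [hfin]
  obtain ⟨e, he⟩ : ∃ e : Module.Basis (Fin 7) ℝ V, ⇑e = ![u, v, w, e₃, e₄, e₅, e₆] :=
    ⟨_, coe_basisOfLinearIndependentOfCardEqFinrank hli hcard⟩
  obtain ⟨k1, k2, k3, k4, k5, k6, k7, k8, k9, k10⟩ := cubeForm_partial_frame he huvw h32 g42 g52 g62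
    h33 g43 g53 g63 (htw _ h31) (htw _ g41) (htw _ g51) (htw _ g61) g44 g54 g64 g45 g55 g65 g46 g56
    g66 hu45 hu46 hv45
  have hκ : b.det e ≠ 0 := (b.isUnit_det e).ne_zero
  -- In terms of H the left-hand sides are known: u, v, w are orthogonal of equal length and e₃,…,e₆
  -- are orthogonal to u. So the ten relations determine the ten remaining components in terms of t.
  simp only [cubeForm_eq_det_mul φ b e, huv, huw, hvw, hvv, hww, h31, g41, g51, g61, mul_zero]
    at k1 k2 k3 k4 k5 k6 k7 k8 k9 k10
  set t := tri φ u e₅ e₆ with ht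
  have ht0 : t ≠ 0 := by
    intro h0
    rw [h0, mul_zero] at k1
    exact mul_ne_zero hκ huu.ne' k1
  have m1 : tri φ v e₄ e₆ = -t := by linarith
  have m2 : tri φ w e₄ e₅ = -t := by linarith
  have m3 : tri φ v e₅ e₆ = 0 := by linarith
  have m4 : tri φ w e₅ e₆ = 0 := by linarith
  have m5 : tri φ w e₄ e₆ = 0 := by linarith
  have m6 : tri φ e₃ e₅ e₆ = 0 := by linarith
  have m7 : tri φ e₄ e₅ e₆ = 0 := by linarith
  have m8 : tri φ e₃ e₄ e₅ = 0 := by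
    have := k9.symm
    rw [mul_assoc] at this
    simpa [ht0] using this
  have m9 : tri φ e₃ e₄ e₆ = 0 := by
    have := k10.symm
    rw [mul_assoc] at this
    simpa [ht0] using this
  have hmodel := tri_eq_modelForm_of_partial_frame he huvw h32 g42 g52 g62
    h33 g43 g53 g63 (htw _ h31) (htw _ g41) (htw _ g51) (htw _ g61) g44 g54 g64 g45 g55 g65 g46 g56
    g66 hu45 hu46 hv45 ht.symm m1 m2 m3 m4 m5 m6 m7 m8 m9
  -- For every t the value of `cubeForm` at e₃ in the new basis is 6, while H(e₃, e₃) > 0; so κ =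
  -- `b.det e` is positive. The relation κ H(u, u) = 6t then gives the sign of t.
  have hκpos : 0 < b.det e := by
    have h6 := cubeForm_model_fourth hmodel
    rw [cubeForm_eq_det_mul φ b] at h6
    have hpos := hH (e 3) (e.ne_zero 3)
    by_contra hle
    linarith [mul_nonpos_of_nonpos_of_nonneg (not_lt.1 hle) hpos.le]
  have htpos : 0 < t := by
    have := mul_pos hκpos huu
    linarith
  obtain ⟨e', he', hadapted⟩ := exists_isAdapted_of_modelForm hmodel htpos
  refine ⟨e', s, hs, ?_, hadapted.orientation_eq hφ hb, hadapted⟩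
  rw [he', he, ← hu]
  rfl

end AdaptedFrame

/-! ### Euclidean structures given by a basis, and traces. -/

section FrameMetric

variable {V : Type*} [AddCommGroup V] [Module ℝ V]

/-- The Euclidean structure for which the basis `e` is orthonormal. -/
def frameMetric {n : ℕ} (e : Module.Basis (Fin n) ℝ V) : V →ₗ[ℝ] V →ₗ[ℝ] ℝ :=
  ∑ i, (e.coord i).smulRight (e.coord i)

theorem frameMetric_apply {n : ℕ} (e : Module.Basis (Fin n) ℝ V) (u v : V) :
    frameMetric e u v = ∑ i, e.repr u i * e.repr v i := by
  simp [frameMetric]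

theorem frameMetric_self {n : ℕ} (e : Module.Basis (Fin n) ℝ V) :
    IsOrthonormalFrame (frameMetric e) e := by
  intro i j
  simp [frameMetric_apply, Finsupp.single_apply]

theorem frameMetric_basis {n : ℕ} (e : Module.Basis (Fin n) ℝ V) (u : V) (i : Fin n) :
    frameMetric e u (e i) = e.repr u i := by
  simp [frameMetric_apply, Finsupp.single_apply]

theorem frameMetric_symm {n : ℕ} (e : Module.Basis (Fin n) ℝ V) (u v : V) :
    frameMetric e u v = frameMetric e v u := by
  simp only [frameMetric_apply, mul_comm]

theorem frameMetric_pos {n : ℕ} (e : Module.Basis (Fin n) ℝ V) (u : V) (hu : u ≠ 0) :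
    0 < frameMetric e u u := by
  rw [frameMetric_apply]
  refine lt_of_le_of_ne (Finset.sum_nonneg fun i _ => mul_self_nonneg _) fun h => hu ?_
  have h1 := (Finset.sum_eq_zero_iff_of_nonneg fun i _ => mul_self_nonneg _).1 h.symm
  apply e.repr.map_eq_zero_iff.1
  ext i
  exact mul_self_eq_zero.1 (h1 i (Finset.mem_univ i))

/-- The trace of a bilinear form does not depend on the orthonormal frame. -/
theorem sum_isOrthonormalFrame {n : ℕ} (e : Module.Basis (Fin n) ℝ V) {e' : Fin n → V}
    (he' : IsOrthonormalFrame (frameMetric e) e') (B : V →ₗ[ℝ] V →ₗ[ℝ] ℝ) :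
    ∑ i, B (e' i) (e' i) = ∑ i, B (e i) (e i) := by
  let O : Matrix (Fin n) (Fin n) ℝ := fun i j => e.repr (e' i) j
  have h1 : O * O.transpose = 1 := by
    ext i j
    rw [Matrix.mul_apply, Matrix.one_apply, ← he' i j, frameMetric_apply]
    rfl
  -- For square matrices orthonormality of the rows gives that of the columns, which is what the
  -- trace needs.
  have h2 : O.transpose * O = 1 := mul_eq_one_comm.1 h1
  have h3 : ∀ j k, ∑ i, O i j * O i k = if j = k then 1 else 0 := by
    intro j k
    have := congrFun (congrFun h2 j) k
    rwa [Matrix.mul_apply, Matrix.one_apply] at this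
  have h4 : ∀ i, B (e' i) (e' i) = ∑ j, ∑ k, O i j * O i k * B (e j) (e k) := by
    intro i
    conv_lhs => rw [← e.sum_repr (e' i)]
    simp only [map_sum, map_smul, LinearMap.sum_apply, LinearMap.smul_apply, smul_eq_mul,
      Finset.mul_sum]
    rw [Finset.sum_comm]
    refine Finset.sum_congr rfl fun j _ => Finset.sum_congr rfl fun k _ => ?_
    simp only [O]
    ring
  simp only [h4]
  rw [Finset.sum_comm]
  refine Finset.sum_congr rfl fun j _ => ?_
  rw [Finset.sum_comm]
  simp only [← Finset.sum_mul, h3]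
  simp

theorem metricTrace_eq {n : ℕ} (e : Module.Basis (Fin n) ℝ V) (B : V →ₗ[ℝ] V →ₗ[ℝ] ℝ) :
    metricTrace n (frameMetric e) (fun x y => B x y) = ∑ i, B (e i) (e i) :=
  sum_isOrthonormalFrame e (Classical.epsilon_spec ⟨⇑e, frameMetric_self e⟩) B

end FrameMetric

/-! ### The induced metric is the one making adapted frames orthonormal. -/

section InducedMetric

variable {V : Type*} [AddCommGroup V] [Module ℝ V]

/-- The numbers φ(x, y, e_k) are the components of the cross product, and |x × y|² = |x|²|y|² − ⟨x,
y⟩². -/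
theorem sum_sq_modelForm (x y : Fin 7 → ℝ) :
    ∑ k, modelForm 1 x y (Pi.single k 1) ^ 2
      = (∑ i, x i * x i) * (∑ i, y i * y i) - (∑ i, x i * y i) ^ 2 := by
  simp [Fin.sum_univ_seven, modelForm, minor]
  ring

/-- The previous identity gives 1 for each ordered pair i ≠ j and 0 for i = j, in total 49 − 7 = 42.
Each increasing triple is counted six times, so |φ|² = 7. -/
theorem IsAdapted.sum_sq {φ : V [⋀^Fin 3]→ₗ[ℝ] ℝ} {e : Module.Basis (Fin 7) ℝ V}
    (h : IsAdapted φ e) : ∑ i, ∑ j, ∑ k, tri φ (e i) (e j) (e k) ^ 2 = 42 := by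
  have : ∀ i j, ∑ k, tri φ (e i) (e j) (e k) ^ 2 = 1 - (if i = j then 1 else 0) := by
    intro i j
    simp only [h _ _ _, Module.Basis.repr_self, Finsupp.single_eq_pi_single]
    rw [sum_sq_modelForm]
    simp [Pi.single_apply, eq_comm]
  simp only [this]
  simp
  norm_num

/-- The frame is exchanged in one slot at a time; in each slot the sum is the trace of a form ℓ ⊗ ℓ,
which is frame independent. -/
theorem IsAdapted.sum_sq_orthonormal {φ : V [⋀^Fin 3]→ₗ[ℝ] ℝ} {e : Module.Basis (Fin 7) ℝ V}
    (h : IsAdapted φ e) {e' : Fin 7 → V} (he' : IsOrthonormalFrame (frameMetric e) e') :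
    ∑ i, ∑ j, ∑ k, tri φ (e' i) (e' j) (e' k) ^ 2 = 42 := by
  have hsq : ∀ ℓ : V →ₗ[ℝ] ℝ, ∑ i, ℓ (e' i) ^ 2 = ∑ i, ℓ (e i) ^ 2 := by
    intro ℓ
    have := sum_isOrthonormalFrame e he' (ℓ.smulRight ℓ)
    simpa [pow_two] using this
  rw [← h.sum_sq]
  calc ∑ i, ∑ j, ∑ k, tri φ (e' i) (e' j) (e' k) ^ 2
      = ∑ i, ∑ j, ∑ k, tri φ (e' i) (e' j) (e k) ^ 2 :=
        Finset.sum_congr rfl fun i _ => Finset.sum_congr rfl fun j _ => hsq _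
    _ = ∑ i, ∑ k, ∑ j, tri φ (e' i) (e' j) (e k) ^ 2 :=
        Finset.sum_congr rfl fun i _ => Finset.sum_comm
    _ = ∑ i, ∑ k, ∑ j, tri φ (e' i) (e j) (e k) ^ 2 :=
        Finset.sum_congr rfl fun i _ => Finset.sum_congr rfl fun k _ =>
          hsq ((tri φ (e' i)).flip (e k))
    _ = ∑ k, ∑ j, ∑ i, tri φ (e' i) (e j) (e k) ^ 2 := by
        rw [Finset.sum_comm]
        exact Finset.sum_congr rfl fun k _ => Finset.sum_comm
    _ = ∑ k, ∑ j, ∑ i, tri φ (e i) (e j) (e k) ^ 2 :=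
        Finset.sum_congr rfl fun k _ => Finset.sum_congr rfl fun j _ =>
          hsq (((tri φ).flip (e j)).flip (e k))
    _ = ∑ i, ∑ j, ∑ k, tri φ (e i) (e j) (e k) ^ 2 := by
        rw [Finset.sum_comm' (t' := Finset.univ) (s' := fun _ => Finset.univ) (by simp)]
        rw [Finset.sum_congr rfl fun j _ => Finset.sum_comm]
        rw [Finset.sum_comm]

theorem IsAdapted.contractionCube_eq {φ : V [⋀^Fin 3]→ₗ[ℝ] ℝ} {e : Module.Basis (Fin 7) ℝ V}
    (h : IsAdapted φ e) (u : V) :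
    contractionCube φ u = frameMetric e u u • ((6 : ℝ) • e.det) := by
  rw [AlternatingMap.eq_smul_basis_det e (contractionCube φ u), ← cubeForm_self, h.cubeForm_eq,
    ← frameMetric_apply, smul_smul, mul_comm]

theorem IsAdapted.isInducedMetric {φ : V [⋀^Fin 3]→ₗ[ℝ] ℝ} {e : Module.Basis (Fin 7) ℝ V}
    (h : IsAdapted φ e) : IsInducedMetric φ (frameMetric e) where
  symm := frameMetric_symm e
  pos := frameMetric_pos e
  conformal := ⟨_, h.contractionCube_eq⟩
  norm_sq := fun e' he' => by
    have := h.sum_sq_orthonormal he'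
    simp only [tri_apply] at this
    rw [this]
    norm_num

/-- The conformal condition, polarised, gives g = c · `frameMetric e`. The g-orthonormal frame e/√c
has |φ|² = 7c⁻³, so the normalisation forces c = 1. This uniqueness identifies the metric picked by
`Classical.epsilon`. -/
theorem IsAdapted.eq_frameMetric {φ : V [⋀^Fin 3]→ₗ[ℝ] ℝ} {e : Module.Basis (Fin 7) ℝ V}
    (h : IsAdapted φ e) {g : V →ₗ[ℝ] V →ₗ[ℝ] ℝ} (hg : IsInducedMetric φ g) :
    g = frameMetric e := by
  obtain ⟨τ, hτ⟩ := hg.conformal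
  have h1 : ∀ u, g u u * τ e = 6 * frameMetric e u u := by
    intro u
    have := congrArg (fun T => T e) (hτ u)
    simp only [h.contractionCube_eq, AlternatingMap.smul_apply, smul_eq_mul,
      Module.Basis.det_self] at this
    linarith
  have hτ0 : τ e ≠ 0 := by
    intro h0
    have := h1 (e 0)
    rw [h0, mul_zero] at this
    linarith [frameMetric_pos e (e 0) (e.ne_zero 0)]
  set c := 6 / τ e with hc
  have h2 : ∀ u, g u u = c * frameMetric e u u := by
    intro u
    rw [hc, div_mul_eq_mul_div, eq_div_iff hτ0, h1]
  have h3 : ∀ u v, g u v = c * frameMetric e u v := by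
    intro u v
    have a := h2 (u + v)
    have a1 := h2 u
    have a2 := h2 v
    simp only [map_add, LinearMap.add_apply] at a
    have s1 := hg.symm v u
    have s2 := frameMetric_symm e v u
    rw [s1, s2, a1, a2] at a
    linarith
  have hcpos : 0 < c := by
    have := h2 (e 0)
    rw [frameMetric_self e 0 0, if_pos rfl, mul_one] at this
    rw [← this]
    exact hg.pos _ (e.ne_zero 0)
  have hs : (√c)⁻¹ * (√c)⁻¹ * c = 1 := by
    have h0 : √c ≠ 0 := (Real.sqrt_pos.2 hcpos).ne'
    have := Real.mul_self_sqrt hcpos.le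
    field_simp
    rw [pow_two, this]
  have h4 := hg.norm_sq (fun i => (√c)⁻¹ • e i) (by
    intro i j
    simp only [map_smul, LinearMap.smul_apply, smul_eq_mul, h3, frameMetric_self e i j]
    split_ifs
    · linarith
    · simp)
  simp only [← tri_apply, map_smul, LinearMap.smul_apply, smul_eq_mul, mul_pow, ← Finset.mul_sum]
    at h4
  rw [h.sum_sq] at h4
  have hc1 : c = 1 := by
    have h5 : ((√c)⁻¹ ^ 2) ^ 3 = 1 := by linarith
    have h6 : (√c)⁻¹ ^ 2 = 1 := by
      have hnn : (0 : ℝ) ≤ (√c)⁻¹ ^ 2 := by positivity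
      exact (pow_eq_one_iff_of_nonneg hnn (by norm_num)).1 h5
    rw [pow_two] at h6
    rw [h6] at hs
    linarith
  ext u v
  rw [h3, hc1, one_mul]

theorem IsAdapted.inducedMetric_eq {φ : V [⋀^Fin 3]→ₗ[ℝ] ℝ} {e : Module.Basis (Fin 7) ℝ V}
    (h : IsAdapted φ e) : inducedMetric φ = frameMetric e :=
  h.eq_frameMetric (Classical.epsilon_spec ⟨_, h.isInducedMetric⟩)

/-- An adapted frame starting with a given unit vector. -/
theorem exists_isAdapted_unit {o : Orientation ℝ V (Fin 7)} {φ : V [⋀^Fin 3]→ₗ[ℝ] ℝ}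
    (hφ : IsPositiveForm o φ) (b : Module.Basis (Fin 7) ℝ V) {ν : V}
    (hν : inducedMetric φ ν ν = 1) :
    ∃ e : Module.Basis (Fin 7) ℝ V, e 0 = ν ∧ e.orientation = o ∧ IsAdapted φ e := by
  have hν0 : ν ≠ 0 := by
    rintro rfl
    simp at hν
  obtain ⟨e, s, hs, he0, heo, he⟩ := exists_isAdapted hφ b hν0
  refine ⟨e, ?_, heo, he⟩
  have h1 := frameMetric_self e 0 0
  rw [if_pos rfl, he0, ← he.inducedMetric_eq] at h1
  simp only [map_smul, LinearMap.smul_apply, smul_eq_mul, hν, mul_one] at h1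
  have : s = 1 := by nlinarith
  rw [he0, this, one_smul]

variable {W : Type*} [AddCommGroup W] [Module ℝ W]

theorem IsAdapted.map {φ : V [⋀^Fin 3]→ₗ[ℝ] ℝ} {e : Module.Basis (Fin 7) ℝ V}
    (h : IsAdapted φ e) (S : W ≃ₗ[ℝ] V) :
    IsAdapted (φ.compLinearMap (S : W →ₗ[ℝ] V)) (e.map S.symm) := by
  intro x y z
  have : tri (φ.compLinearMap (S : W →ₗ[ℝ] V)) x y z = tri φ (S x) (S y) (S z) := by
    simp only [tri_apply, AlternatingMap.compLinearMap_apply]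
    congr 1
    ext i
    fin_cases i <;> rfl
  rw [this, h]
  rfl

theorem IsAdapted.inducedMetric_compLinearMap {φ : V [⋀^Fin 3]→ₗ[ℝ] ℝ}
    {e : Module.Basis (Fin 7) ℝ V} (h : IsAdapted φ e) (S : W ≃ₗ[ℝ] V) (x y : W) :
    inducedMetric (φ.compLinearMap (S : W →ₗ[ℝ] V)) x y = inducedMetric φ (S x) (S y) := by
  rw [(h.map S).inducedMetric_eq, h.inducedMetric_eq, frameMetric_apply, frameMetric_apply]
  rfl

end InducedMetric

/-! ### Real parts of forms of type (3,0). -/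

section ComplexType

variable {W : Type*} [AddCommGroup W] [Module ℝ W]

theorem tri_compLinearMap {V : Type*} [AddCommGroup V] [Module ℝ V] (φ : V [⋀^Fin 3]→ₗ[ℝ] ℝ)
    (L : W →ₗ[ℝ] V) (x y z : W) : tri (φ.compLinearMap L) x y z = tri φ (L x) (L y) (L z) := by
  simp only [tri_apply, AlternatingMap.compLinearMap_apply]
  congr 1
  ext i
  fin_cases i <;> rfl

/-- The `3`-form `ρ` is the real part of a form of type `(3,0)` for the complex structure `I`. -/
structure IsComplexType (ρ : W [⋀^Fin 3]→ₗ[ℝ] ℝ) (I : W →ₗ[ℝ] W) : Prop where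
  sq : ∀ v, I (I v) = -v
  type : ∀ u v w, tri ρ (I u) (I v) w = -tri ρ u v w

namespace IsComplexType

variable {ρ : W [⋀^Fin 3]→ₗ[ℝ] ℝ} {I : W →ₗ[ℝ] W}

/-- Applying `type` to u and I v, with I² = −1, moves I between slots. With the variants below,
every value of ρ on a complex basis reduces to ρ(x, y, z) and ρ(Ix, y, z). -/
theorem tri_shift (h : IsComplexType ρ I) (u v w : W) : tri ρ (I u) v w = tri ρ u (I v) w := by
  have := h.type u (I v) w
  rw [h.sq, map_neg, LinearMap.neg_apply] at this
  linarith

theorem tri_self_zero (h : IsComplexType ρ I) (u w : W) : tri ρ u (I u) w = 0 := by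
  have h1 := h.tri_shift u u w
  rw [tri_swap] at h1
  linarith

theorem tri_self_two (h : IsComplexType ρ I) (u w : W) : tri ρ w u (I u) = 0 := by
  rw [← tri_rotate, h.tri_self_zero]

theorem tri_move_one (h : IsComplexType ρ I) (u v w : W) : tri ρ u (I v) w = tri ρ (I u) v w :=
  (h.tri_shift u v w).symm

theorem tri_move_two (h : IsComplexType ρ I) (u v w : W) : tri ρ u v (I w) = tri ρ (I u) v w := by
  rw [tri_swap', ← h.tri_shift, tri_swap', neg_neg]

/-- The value of `ρ ∧ ρ̃` on a complex basis is non-negative. -/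
theorem wedge_complex_basis (h : IsComplexType ρ I) (x y z : W) :
    wedge ρ (ρ.compLinearMap I) ![x, I x, y, I y, z, I z]
      = 4 * (tri ρ x y z ^ 2 + tri ρ (I x) y z ^ 2) := by
  -- The right-hand side is 4|Ω(x, y, z)|² for Ω = ρ + iρ̃, as the imaginary part is ρ̃(x, y, z) =
  -- −ρ(Ix, y, z).
  rw [wedge_three_three]
  simp only [← tri_apply, tri_compLinearMap, h.sq, map_neg, LinearMap.neg_apply,
    h.tri_self_zero, h.tri_self_two,
    h.tri_move_one, h.tri_move_two]
  ring

end IsComplexType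

end ComplexType

/-! ### Adapted frames along a hyperplane and the complex structure of φ restricted to it. -/

section TangentFrame

variable {V W : Type*} [AddCommGroup V] [Module ℝ V] [AddCommGroup W] [Module ℝ W]

/-- Adapted bases `e` of `V` and `t` of the hyperplane `L : W → V` with normal vector `ν`: the first
vector of `e` is `ν`, and the others are the images of the vectors of `t`. -/
structure IsTangentFrame (φ : V [⋀^Fin 3]→ₗ[ℝ] ℝ) (ν : V) (L : W →ₗ[ℝ] V)
    (e : Module.Basis (Fin 7) ℝ V) (t : Module.Basis (Fin 6) ℝ W) : Prop where
  adapted : IsAdapted φ e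
  zero : e 0 = ν
  succ : ∀ i, L (t i) = e i.succ

/-- The image of L is orthogonal to e₀, so the coordinates 1,…,6 of L form an injective map between
spaces of dimension 6; t is the preimage of the standard basis. -/
theorem exists_isTangentFrame {φ : V [⋀^Fin 3]→ₗ[ℝ] ℝ} {ν : V} {L : W →ₗ[ℝ] V}
    (hL : Function.Injective L) (b : Module.Basis (Fin 6) ℝ W) {e : Module.Basis (Fin 7) ℝ V}
    (he : IsAdapted φ e) (he0 : e 0 = ν) (hν : ∀ X, inducedMetric φ ν (L X) = 0) :
    ∃ t : Module.Basis (Fin 6) ℝ W, IsTangentFrame φ ν L e t := by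
  have h0 : ∀ X, e.repr (L X) 0 = 0 := by
    intro X
    rw [← frameMetric_basis, he0, frameMetric_symm, ← he.inducedMetric_eq, hν]
  let T : W →ₗ[ℝ] (Fin 6 → ℝ) := LinearMap.pi fun i => (e.coord i.succ).comp L
  have hT : Function.Injective T := by
    rw [← LinearMap.ker_eq_bot, LinearMap.ker_eq_bot']
    intro X hX
    apply hL
    rw [map_zero]
    apply e.repr.map_eq_zero_iff.1
    ext i
    refine Fin.cases (h0 X) (fun j => ?_) i
    exact congrFun hX j
  have hfin : Module.finrank ℝ W = Module.finrank ℝ (Fin 6 → ℝ) := by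
    rw [Module.finrank_eq_card_basis b]
    simp
  have : FiniteDimensional ℝ W := b.finiteDimensional_of_finite
  let E := LinearMap.linearEquivOfInjective T hT hfin
  refine ⟨Module.Basis.ofEquivFun E, he, he0, fun i => ?_⟩
  apply e.repr.injective
  have hE : ∀ X j, e.repr (L X) (Fin.succ j) = E X j := fun X j => rfl
  ext k
  rw [Module.Basis.repr_self]
  refine Fin.cases ?_ (fun j => ?_) k
  · rw [h0]
    simp
  · rw [hE]
    simp [Finsupp.single_apply, Pi.single_apply, eq_comm]

namespace IsTangentFrame

variable {φ : V [⋀^Fin 3]→ₗ[ℝ] ℝ} {ν : V} {L : W →ₗ[ℝ] V} {e : Module.Basis (Fin 7) ℝ V}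
  {t : Module.Basis (Fin 6) ℝ W}

theorem repr_zero (h : IsTangentFrame φ ν L e t) (X : W) : e.repr (L X) 0 = 0 := by
  conv_lhs => rw [← t.sum_repr X]
  simp only [map_sum, map_smul, h.succ, Module.Basis.repr_self, Finsupp.coe_finsetSum,
    Finset.sum_apply, Finsupp.smul_apply]
  simp

theorem repr_succ (h : IsTangentFrame φ ν L e t) (X : W) (i : Fin 6) :
    e.repr (L X) i.succ = t.repr X i := by
  conv_lhs => rw [← t.sum_repr X]
  simp only [map_sum, map_smul, h.succ, Module.Basis.repr_self, Finsupp.coe_finsetSum,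
    Finset.sum_apply, Finsupp.smul_apply]
  simp [Finsupp.single_apply]

theorem repr_one (h : IsTangentFrame φ ν L e t) (X : W) : e.repr (L X) 1 = t.repr X 0 :=
  h.repr_succ X 0

theorem repr_two (h : IsTangentFrame φ ν L e t) (X : W) : e.repr (L X) 2 = t.repr X 1 :=
  h.repr_succ X 1

theorem repr_three (h : IsTangentFrame φ ν L e t) (X : W) : e.repr (L X) 3 = t.repr X 2 :=
  h.repr_succ X 2

theorem repr_four (h : IsTangentFrame φ ν L e t) (X : W) : e.repr (L X) 4 = t.repr X 3 :=
  h.repr_succ X 3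

theorem repr_five (h : IsTangentFrame φ ν L e t) (X : W) : e.repr (L X) 5 = t.repr X 4 :=
  h.repr_succ X 4

theorem repr_six (h : IsTangentFrame φ ν L e t) (X : W) : e.repr (L X) 6 = t.repr X 5 :=
  h.repr_succ X 5

/-- The restriction of `φ` to the hyperplane in coordinates. -/
theorem tri_eq (h : IsTangentFrame φ ν L e t) (X Y Z : W) :
    tri φ (L X) (L Y) (L Z)
      = t.repr X 0 * (t.repr Y 2 * t.repr Z 4 - t.repr Y 4 * t.repr Z 2)
        - t.repr X 2 * (t.repr Y 0 * t.repr Z 4 - t.repr Y 4 * t.repr Z 0)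
        + t.repr X 4 * (t.repr Y 0 * t.repr Z 2 - t.repr Y 2 * t.repr Z 0)
        - (t.repr X 0 * (t.repr Y 3 * t.repr Z 5 - t.repr Y 5 * t.repr Z 3)
        - t.repr X 3 * (t.repr Y 0 * t.repr Z 5 - t.repr Y 5 * t.repr Z 0)
        + t.repr X 5 * (t.repr Y 0 * t.repr Z 3 - t.repr Y 3 * t.repr Z 0))
        - (t.repr X 1 * (t.repr Y 2 * t.repr Z 5 - t.repr Y 5 * t.repr Z 2)
        - t.repr X 2 * (t.repr Y 1 * t.repr Z 5 - t.repr Y 5 * t.repr Z 1)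
        + t.repr X 5 * (t.repr Y 1 * t.repr Z 2 - t.repr Y 2 * t.repr Z 1))
        - (t.repr X 1 * (t.repr Y 3 * t.repr Z 4 - t.repr Y 4 * t.repr Z 3)
        - t.repr X 3 * (t.repr Y 1 * t.repr Z 4 - t.repr Y 4 * t.repr Z 1)
        + t.repr X 4 * (t.repr Y 1 * t.repr Z 3 - t.repr Y 3 * t.repr Z 1)) := by
  rw [h.adapted]
  simp only [modelForm, minor, h.repr_zero, h.repr_one, h.repr_two, h.repr_three, h.repr_four,
    h.repr_five, h.repr_six]
  ring

/-- The contraction of `φ` with the normal vector in coordinates. -/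
theorem tri_normal_eq (h : IsTangentFrame φ ν L e t) (X Y : W) :
    tri φ ν (L X) (L Y)
      = t.repr X 0 * t.repr Y 1 - t.repr X 1 * t.repr Y 0
        + (t.repr X 2 * t.repr Y 3 - t.repr X 3 * t.repr Y 2)
        + (t.repr X 4 * t.repr Y 5 - t.repr X 5 * t.repr Y 4) := by
  rw [h.adapted, ← h.zero]
  simp [modelForm, minor, h.repr_zero, h.repr_one, h.repr_two, h.repr_three, h.repr_four,
    h.repr_five, h.repr_six]

end IsTangentFrame

/-- The complex structure for which `t 1 = I (t 0)`, `t 3 = I (t 2)`, `t 5 = I (t 4)`. -/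
def frameComplex (t : Module.Basis (Fin 6) ℝ W) : W →ₗ[ℝ] W :=
  t.constr ℝ ![t 1, -t 0, t 3, -t 2, t 5, -t 4]

theorem frameComplex_basis (t : Module.Basis (Fin 6) ℝ W) (i : Fin 6) :
    frameComplex t (t i) = ![t 1, -t 0, t 3, -t 2, t 5, -t 4] i := by
  simp [frameComplex]

theorem frameComplex_apply (t : Module.Basis (Fin 6) ℝ W) (X : W) :
    frameComplex t X = t.repr X 0 • t 1 - t.repr X 1 • t 0 + t.repr X 2 • t 3 - t.repr X 3 • t 2
      + t.repr X 4 • t 5 - t.repr X 5 • t 4 := by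
  conv_lhs => rw [← t.sum_repr X]
  rw [map_sum]
  simp only [map_smul, frameComplex_basis, Fin.sum_univ_six, Matrix.cons_val, smul_neg]
  abel

theorem repr_frameComplex (t : Module.Basis (Fin 6) ℝ W) (X : W) :
    t.repr (frameComplex t X) 0 = -t.repr X 1 ∧ t.repr (frameComplex t X) 1 = t.repr X 0 ∧
    t.repr (frameComplex t X) 2 = -t.repr X 3 ∧ t.repr (frameComplex t X) 3 = t.repr X 2 ∧
    t.repr (frameComplex t X) 4 = -t.repr X 5 ∧ t.repr (frameComplex t X) 5 = t.repr X 4 := by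
  rw [frameComplex_apply]
  simp

theorem frameComplex_sq (t : Module.Basis (Fin 6) ℝ W) (X : W) :
    frameComplex t (frameComplex t X) = -X := by
  rw [frameComplex_apply]
  simp only [repr_frameComplex]
  conv_rhs => rw [← t.sum_repr X]
  simp only [Fin.sum_univ_six, neg_smul]
  abel

namespace IsTangentFrame

variable {φ : V [⋀^Fin 3]→ₗ[ℝ] ℝ} {ν : V} {L : W →ₗ[ℝ] V} {e : Module.Basis (Fin 7) ℝ V}
  {t : Module.Basis (Fin 6) ℝ W}

/-- In the coordinates z_k = t^{2k} + i t^{2k+1}, k = 0, 1, 2, the restriction of φ is Re(dz₀ ∧ dz₁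
∧ dz₂) and `frameComplex t` is multiplication by i. -/
theorem isComplexType_frameComplex (h : IsTangentFrame φ ν L e t) :
    IsComplexType (φ.compLinearMap L) (frameComplex t) where
  sq := frameComplex_sq t
  type := fun u v w => by
    simp only [tri_compLinearMap, h.tri_eq, repr_frameComplex]
    ring

set_option maxHeartbeats 1000000 in
/-- The complex structure of `ρ = φ|_W` is unique up to sign. -/
theorem eq_or_eq_neg_of_isComplexType (h : IsTangentFrame φ ν L e t) {I : W →ₗ[ℝ] W}
    (hI : IsComplexType (φ.compLinearMap L) I) :
    ∃ c : ℝ, c * c = 1 ∧ ∀ X, I X = c • frameComplex t X := by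
  have key : ∀ i j k, tri φ (L (I (t i))) (L (t j)) (L (t k))
      = tri φ (L (t i)) (L (I (t j))) (L (t k)) := by
    intro i j k
    have := hI.tri_shift (t i) (t j) (t k)
    simpa only [tri_compLinearMap] using this
  -- With a repeated index, φ(I tᵢ, tᵢ, t_k) = φ(tᵢ, I tᵢ, t_k) forces both sides to vanish; this
  -- removes the entries of I tᵢ outside its complex line. The mixed relations `a1`,…,`a10` then tie
  -- the three diagonal blocks together.
  have k00 := fun k => key 0 0 k
  have k11 := fun k => key 1 1 k
  have k22 := fun k => key 2 2 k
  have k33 := fun k => key 3 3 k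
  have k44 := fun k => key 4 4 k
  have k55 := fun k => key 5 5 k
  simp only [h.tri_eq, Module.Basis.repr_self] at key k00 k11 k22 k33 k44 k55
  have z02 := k00 4
  have z03 := k00 5
  have z04 := k00 2
  have z05 := k00 3
  have z12 := k11 5
  have z13 := k11 4
  have z14 := k11 3
  have z15 := k11 2
  have z20 := k22 4
  have z21 := k22 5
  have z24 := k22 0
  have z25 := k22 1
  have z30 := k33 5
  have z31 := k33 4
  have z34 := k33 1
  have z35 := k33 0
  have z40 := k44 2
  have z41 := k44 3
  have z42 := k44 0
  have z43 := k44 1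
  have z50 := k55 3
  have z51 := k55 2
  have z52 := k55 1
  have z53 := k55 0
  have a1 := key 0 2 4
  have a2 := key 0 2 5
  have a3 := key 0 4 2
  have a4 := key 0 4 3
  have a5 := key 1 2 4
  have a6 := key 1 2 5
  have a7 := key 3 0 4
  have a8 := key 3 0 5
  have a9 := key 5 0 2
  have a10 := key 5 0 3
  clear key k00 k11 k22 k33 k44 k55
  simp at z02 z03 z04 z05 z12 z13 z14 z15 z20 z21 z24 z25 z30 z31 z34 z35 z40 z41 z42 z43 z50 z51
  simp at z52 z53 a1 a2 a3 a4 a5 a6 a7 a8 a9 a10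
  set a := t.repr (I (t 0)) 0 with ha
  set b := t.repr (I (t 0)) 1 with hb
  -- So I = a + bJ with J = `frameComplex t`. Then I² = −1 reads a² − b² = −1 and 2ab = 0, whence a
  -- = 0 and b² = 1.
  have hbasis : ∀ i, I (t i) = a • t i + b • frameComplex t (t i) := by
    intro i
    apply t.repr.injective
    ext k
    fin_cases i <;> fin_cases k <;> simp [repr_frameComplex] <;> linarith
  have hlin : I = a • LinearMap.id + b • frameComplex t := by
    refine t.ext fun i => ?_
    rw [hbasis]
    rfl
  have happ : ∀ X, I X = a • X + b • frameComplex t X := fun X => by rw [hlin]; rfl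
  have hsq := hI.sq (t 0)
  rw [happ, happ] at hsq
  simp only [map_add, map_smul, frameComplex_sq] at hsq
  have q0 := congrArg (fun x => t.repr x 0) hsq
  have q1 := congrArg (fun x => t.repr x 1) hsq
  simp [repr_frameComplex] at q0 q1
  have hab : a * b = 0 := by linarith
  have ha0 : a = 0 := by
    rcases mul_eq_zero.1 hab with h0 | h0
    · exact h0
    · rw [h0] at q0
      nlinarith [mul_self_nonneg a]
  refine ⟨b, ?_, fun X => by rw [happ, ha0, zero_smul, zero_add]⟩
  rw [ha0] at q0
  linarith

/-- The value of `ρ ∧ ρ̃` on the frame. -/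
theorem wedge_frameComplex (h : IsTangentFrame φ ν L e t) :
    wedge (φ.compLinearMap L) ((φ.compLinearMap L).compLinearMap (frameComplex t)) t = 4 := by
  have ht : ⇑t = ![t 0, frameComplex t (t 0), t 2, frameComplex t (t 2), t 4,
      frameComplex t (t 4)] := by
    ext1 i
    fin_cases i <;> simp [frameComplex_basis]
  rw [ht, h.isComplexType_frameComplex.wedge_complex_basis]
  simp [tri_compLinearMap, h.tri_eq, repr_frameComplex]

theorem mem_positiveBases {o : Orientation ℝ V (Fin 7)} (h : IsTangentFrame φ ν L e t)
    (ho : e.orientation = o) : t ∈ positiveBases o L ν :=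
  ⟨e, h.zero, fun i => (h.succ i).symm, ho⟩

/-- The pull-back of i_ν det_e to the hyperplane is det_t, since both equal 1 on t. -/
theorem det_pos_of_mem_positiveBases {o : Orientation ℝ V (Fin 7)} (h : IsTangentFrame φ ν L e t)
    (ho : e.orientation = o) {b : Module.Basis (Fin 6) ℝ W} (hb : b ∈ positiveBases o L ν) :
    0 < t.det b := by
  obtain ⟨c, hc0, hc, hco⟩ := hb
  have hdet : 0 < e.det c := by
    rw [← Module.Basis.orientation_eq_iff_det_pos, ho, hco]
  let D : W [⋀^Fin 6]→ₗ[ℝ] ℝ := (e.det.curryLeft ν).compLinearMap L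
  have hD : ∀ v : Fin 6 → W, D v = e.det (Matrix.vecCons ν fun i => L (v i)) := fun v => by
    rw [AlternatingMap.compLinearMap_apply, AlternatingMap.curryLeft_apply_apply]
  have hDt : D t = 1 := by
    rw [hD, ← e.det_self]
    congr 1
    ext1 i
    refine Fin.cases ?_ (fun j => ?_) i
    · exact h.zero.symm
    · exact h.succ j
  have hDb : D b = e.det c := by
    rw [hD]
    congr 1
    ext1 i
    refine Fin.cases ?_ (fun j => ?_) i
    · exact hc0.symm
    · exact (hc j).symm
  rw [AlternatingMap.eq_smul_basis_det t D, AlternatingMap.smul_apply, hDt, one_smul] at hDb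
  rwa [hDb]

end IsTangentFrame

end TangentFrame

section TangentFrame

variable {V W : Type*} [AddCommGroup V] [Module ℝ V] [AddCommGroup W] [Module ℝ W]

theorem eq_zero_of_apply_five {Θ : W [⋀^Fin 5]→ₗ[ℝ] ℝ}
    (h : ∀ x₀ x₁ x₂ x₃ x₄, Θ ![x₀, x₁, x₂, x₃, x₄] = 0) : Θ = 0 := by
  refine AlternatingMap.ext fun v => ?_
  have hv : v = ![v 0, v 1, v 2, v 3, v 4] := by
    ext1 i
    fin_cases i <;> rfl
  rw [hv, h, AlternatingMap.zero_apply]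

namespace IsTangentFrame

variable {φ : V [⋀^Fin 3]→ₗ[ℝ] ℝ} {ν : V} {L : W →ₗ[ℝ] V} {e : Module.Basis (Fin 7) ℝ V}
  {t : Module.Basis (Fin 6) ℝ W}

/-- The complex structure of `ρ = φ|_W` compatible with the orientation is unique. -/
theorem eq_frameComplex {o : Orientation ℝ V (Fin 7)} (h : IsTangentFrame φ ν L e t)
    (ho : e.orientation = o) {I : W →ₗ[ℝ] W} (hI : IsComplexType (φ.compLinearMap L) I)
    {b : Module.Basis (Fin 6) ℝ W} (hb : b ∈ positiveBases o L ν) (hb1 : b 1 = I (b 0))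
    (hb3 : b 3 = I (b 2)) (hb5 : b 5 = I (b 4)) (X : W) : I X = frameComplex t X := by
  obtain ⟨c, hc, hIc⟩ := h.eq_or_eq_neg_of_isComplexType hI
  -- Since c³ = c, the sign c passes from I to ρ̃ and so to ρ ∧ ρ̃. On a complex basis ρ ∧ ρ̃ is
  -- non-negative, while for c = −1 it would be negative on a positive basis.
  have hcomp : (φ.compLinearMap L).compLinearMap I
      = c • (φ.compLinearMap L).compLinearMap (frameComplex t) := by
    have hc3 : c ^ 3 = c := by rw [pow_succ, pow_two, hc, one_mul]
    ext v
    have := (φ.compLinearMap L).map_smul_univ (fun _ => c) (fun i => frameComplex t (v i))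
    simp only [Finset.prod_const, Finset.card_univ, Fintype.card_fin, hc3] at this
    rw [AlternatingMap.smul_apply, AlternatingMap.compLinearMap_apply _ (frameComplex t), ← this,
      AlternatingMap.compLinearMap_apply _ I]
    simp only [hIc]
  have hb' : ⇑b = ![b 0, I (b 0), b 2, I (b 2), b 4, I (b 4)] := by
    ext1 i
    fin_cases i
    exacts [rfl, hb1, rfl, hb3, rfl, hb5]
  have hΘ : 0 ≤ wedge (φ.compLinearMap L) ((φ.compLinearMap L).compLinearMap I) b := by
    rw [hb', hI.wedge_complex_basis]
    positivity
  have hdet : ∀ Θ : W [⋀^Fin 6]→ₗ[ℝ] ℝ, Θ b = Θ t * t.det b := fun Θ => by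
    conv_lhs => rw [AlternatingMap.eq_smul_basis_det t Θ]
    rfl
  have hwedge : wedge (φ.compLinearMap L) ((φ.compLinearMap L).compLinearMap I) b
      = c * (4 * t.det b) := by
    rw [hcomp, wedge_smul_right, AlternatingMap.smul_apply, smul_eq_mul, ← h.wedge_frameComplex]
    exact congrArg (c * ·) (hdet _)
  have hpos := h.det_pos_of_mem_positiveBases ho hb
  have hc0 : 0 ≤ c := by
    by_contra hneg
    have h1 : c * (4 * t.det b) < 0 := mul_neg_of_neg_of_pos (not_le.1 hneg) (by linarith)
    rw [← hwedge] at h1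
    linarith
  have hc1 : c = 1 := by nlinarith
  rw [hIc, hc1, one_smul]

section Induced

variable [TopologicalSpace W] {o : Orientation ℝ V (Fin 7)} {ρ : W [⋀^Fin 3]→L[ℝ] ℝ}

/-- The structure `frameComplex t` meets all the conditions, so the one chosen by
`Classical.epsilon` meets them as well, and uniqueness identifies the two. -/
theorem inducedComplexStructure_apply [IsTopologicalAddGroup W] [ContinuousSMul ℝ W] [T2Space W]
    (h : IsTangentFrame φ ν L e t) (ho : e.orientation = o)
    (hρ : ρ.toAlternatingMap = φ.compLinearMap L) (X : W) :
    inducedComplexStructure (positiveBases o L ν) ρ X = frameComplex t X := by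
  have : FiniteDimensional ℝ W := t.finiteDimensional_of_finite
  have htype : ∀ u v w, ρ ![u, v, w] = tri (φ.compLinearMap L) u v w := fun u v w => by
    rw [← hρ]
    rfl
  have hex : IsInducedComplexStructure (positiveBases o L ν) ρ
      (LinearMap.toContinuousLinearMap (frameComplex t)) := by
    refine ⟨frameComplex_sq t, fun u v w => ?_, t, h.mem_positiveBases ho, ?_, ?_, ?_⟩
    · rw [htype, htype]
      exact h.isComplexType_frameComplex.type u v w
    all_goals simp [frameComplex_basis]
  have hI : IsInducedComplexStructure (positiveBases o L ν) ρ
      (inducedComplexStructure (positiveBases o L ν) ρ) := Classical.epsilon_spec ⟨_, hex⟩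
  obtain ⟨b, hb, hb1, hb3, hb5⟩ := hI.orientation
  refine h.eq_frameComplex ho (I := (inducedComplexStructure (positiveBases o L ν) ρ).toLinearMap)
    ⟨hI.sq, fun u v w => ?_⟩ hb hb1 hb3 hb5 X
  rw [← htype, ← htype]
  exact hI.type u v w

theorem toAlternatingMap_companion [IsTopologicalAddGroup W] [ContinuousSMul ℝ W] [T2Space W]
    (h : IsTangentFrame φ ν L e t) (ho : e.orientation = o)
    (hρ : ρ.toAlternatingMap = φ.compLinearMap L) :
    (companion (positiveBases o L ν) ρ).toAlternatingMap
      = (φ.compLinearMap L).compLinearMap (frameComplex t) := by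
  rw [← hρ]
  ext v
  change ρ (fun i => inducedComplexStructure (positiveBases o L ν) ρ (v i))
    = ρ (fun i => frameComplex t (v i))
  simp only [h.inducedComplexStructure_apply ho hρ]

theorem volumeElement_frame [IsTopologicalAddGroup W] [ContinuousSMul ℝ W] [T2Space W]
    (h : IsTangentFrame φ ν L e t) (ho : e.orientation = o)
    (hρ : ρ.toAlternatingMap = φ.compLinearMap L) :
    volumeElement (positiveBases o L ν) ρ t = 1 := by
  rw [volumeElement, AlternatingMap.smul_apply, h.toAlternatingMap_companion ho hρ, hρ,
    h.wedge_frameComplex]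
  norm_num

end Induced

/-- On the hyperplane, the complex structure is the cross product with the normal vector. -/
theorem apply_frameComplex (h : IsTangentFrame φ ν L e t) (X : W) {c : V}
    (hc : ∀ w, frameMetric e c w = tri φ ν (L X) w) : L (frameComplex t X) = c := by
  apply e.repr.injective
  ext i
  rw [← frameMetric_basis e c, hc, h.adapted, ← h.zero]
  fin_cases i <;> simp [modelForm, minor, h.repr_zero, h.repr_one, h.repr_two, h.repr_three,
    h.repr_four, h.repr_five, h.repr_six, repr_frameComplex]

/-- The forms `ρ̃` and `ω` satisfy `ρ̃ ∧ ω = 0`. -/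
theorem wedge_frameComplex_normal (h : IsTangentFrame φ ν L e t) :
    wedge ((φ.compLinearMap L).compLinearMap (frameComplex t)) ((φ.curryLeft ν).compLinearMap L)
      = 0 := by
  have hω : ∀ X Y, (φ.curryLeft ν).compLinearMap L ![X, Y] = tri φ ν (L X) (L Y) := fun X Y => by
    rw [AlternatingMap.compLinearMap_apply, AlternatingMap.curryLeft_apply_apply, tri_apply]
    congr 1
    ext1 i
    fin_cases i <;> rfl
  have hρ : ∀ X Y Z, (φ.compLinearMap L).compLinearMap (frameComplex t) ![X, Y, Z]
      = tri φ (L (frameComplex t X)) (L (frameComplex t Y)) (L (frameComplex t Z)) :=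
    fun X Y Z => by rw [← tri_apply, tri_compLinearMap, tri_compLinearMap]
  refine eq_zero_of_apply_five fun x₀ x₁ x₂ x₃ x₄ => ?_
  rw [wedge_three_two]
  simp only [hω, hρ, h.tri_eq, h.tri_normal_eq, repr_frameComplex]
  ring

end IsTangentFrame

end TangentFrame

/-! ### First-order identities behind the two formulas. -/

section Jets

variable {V W : Type*} [AddCommGroup V] [Module ℝ V] [AddCommGroup W] [Module ℝ W]

/-- A bilinear form vanishing on the diagonal, as an alternating form. -/
def twoForm (b : W →ₗ[ℝ] W →ₗ[ℝ] ℝ) (hb : ∀ x, b x x = 0) : W [⋀^Fin 2]→ₗ[ℝ] ℝ where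
  toFun v := b (v 0) (v 1)
  map_update_add' v i x y := by
    fin_cases i <;> simp [Function.update]
  map_update_smul' v i c x := by
    fin_cases i <;> simp [Function.update]
  map_eq_zero_of_eq' v i j hv hij := by
    have h : v 0 = v 1 := by
      fin_cases i <;> fin_cases j
      exacts [absurd rfl hij, hv, hv.symm, absurd rfl hij]
    rw [h, hb]

namespace IsTangentFrame

variable {φ : V [⋀^Fin 3]→ₗ[ℝ] ℝ} {ν : V} {L : W →ₗ[ℝ] V} {e : Module.Basis (Fin 7) ℝ V}
  {t : Module.Basis (Fin 6) ℝ W}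

theorem frameMetric_eq (h : IsTangentFrame φ ν L e t) (X Y : W) :
    frameMetric e (L X) (L Y) = frameMetric t X Y := by
  rw [frameMetric_apply, frameMetric_apply, Fin.sum_univ_succ, h.repr_zero, zero_mul, zero_add]
  simp only [h.repr_succ]

/-- This is the relation ω(X, Y) = g(IX, Y) between ω and the Hermitian metric, with I moved across
g by orthogonality. -/
theorem normal_eq_metric (h : IsTangentFrame φ ν L e t) (X Y : W) :
    tri φ ν (L X) (L Y) = -frameMetric t X (frameComplex t Y) := by
  rw [h.tri_normal_eq, frameMetric_apply, Fin.sum_univ_six]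
  simp only [repr_frameComplex]
  ring

theorem exists_tangent_eq (h : IsTangentFrame φ ν L e t) {v : V} (hv : frameMetric e v ν = 0) :
    ∃ a, v = L a := by
  refine ⟨∑ i : Fin 6, e.repr v i.succ • t i, ?_⟩
  conv_lhs => rw [← e.sum_repr v, Fin.sum_univ_succ]
  rw [← h.zero, frameMetric_basis] at hv
  rw [hv, zero_smul, zero_add, map_sum]
  simp only [map_smul, h.succ]

/-- The variation of `ρ̃` when the normal vector moves in a tangential direction `a`. -/
theorem sum_tri_cross (h : IsTangentFrame φ ν L e t) {a : W} {c : W → V}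
    (hc : ∀ X w, frameMetric e (c X) w = tri φ (L a) (L X) w) (X Y Z : W) :
    tri φ (c X) (L (frameComplex t Y)) (L (frameComplex t Z))
      + tri φ (L (frameComplex t X)) (c Y) (L (frameComplex t Z))
      + tri φ (L (frameComplex t X)) (L (frameComplex t Y)) (c Z)
      = -(tri φ ν (L a) (L X) * tri φ ν (L Y) (L Z) - tri φ ν (L a) (L Y) * tri φ ν (L X) (L Z)
        + tri φ ν (L a) (L Z) * tri φ ν (L X) (L Y)) := by
  have hrepr : ∀ X i, e.repr (c X) i = tri φ (L a) (L X) (e i) := fun X i => by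
    rw [← frameMetric_basis, hc]
  have hval : ∀ X Y Z, tri φ (c X) (L Y) (L Z)
      = ∑ i, tri φ (L a) (L X) (e i) * tri φ (e i) (L Y) (L Z) := fun X Y Z => by
    conv_lhs => rw [← e.sum_repr (c X)]
    simp only [map_sum, LinearMap.sum_apply, map_smul, LinearMap.smul_apply, smul_eq_mul, hrepr]
  have h2 : ∀ X Y Z, tri φ (L Y) (c X) (L Z) = -tri φ (c X) (L Y) (L Z) := fun X Y Z =>
    tri_swap _ _ _ _
  have h3 : ∀ X Y Z, tri φ (L Y) (L Z) (c X) = tri φ (c X) (L Y) (L Z) := fun X Y Z =>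
    tri_rotate _ _ _ _
  simp only [h2, h3, hval, h.tri_normal_eq, h.adapted (L a), h.adapted (e _), Fin.sum_univ_seven]
  simp only [modelForm, minor, h.repr_zero, h.repr_one, h.repr_two, h.repr_three, h.repr_four,
    h.repr_five, h.repr_six, repr_frameComplex, Module.Basis.repr_self]
  simp
  ring

/-- The exterior derivative of `ρ̃` in terms of the second fundamental form `B`, when the covariant
derivative of `φ` vanishes. Here `N U` is the covariant derivative of the normal vector, `S U X`
that of `L X`, and `C U X` that of `L (I X)`. -/
theorem sum_deriv_companion (h : IsTangentFrame φ ν L e t) {B : W →ₗ[ℝ] W →ₗ[ℝ] ℝ}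
    (hB : ∀ X Y, B X Y = B Y X) {N : W → V} (hN : ∀ U, frameMetric e (N U) ν = 0)
    (hNB : ∀ U X, frameMetric e (N U) (L X) = -B U X) {S : W → W → V}
    (hS : ∀ U X, S U X = S X U) {C : W → W → V}
    (hC : ∀ U X w, frameMetric e (C U X) w = tri φ (N U) (L X) w + tri φ ν (S U X) w)
    {D : W → W → W → W → ℝ}
    (hD : ∀ U X Y Z, D U X Y Z = tri φ (C U X) (L (frameComplex t Y)) (L (frameComplex t Z))
      + tri φ (L (frameComplex t X)) (C U Y) (L (frameComplex t Z))
      + tri φ (L (frameComplex t X)) (L (frameComplex t Y)) (C U Z))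
    {β : W → W → ℝ} (hβ : ∀ X Y, β X Y = 1 / 2 * (B (frameComplex t X) Y - B X (frameComplex t Y)))
    (U X Y Z : W) :
    D U X Y Z - D X U Y Z + D Y U X Z - D Z U X Y
      = 2 * (β U X * tri φ ν (L Y) (L Z) - β U Y * tri φ ν (L X) (L Z)
        + β U Z * tri φ ν (L X) (L Y) + β X Y * tri φ ν (L U) (L Z)
        - β X Z * tri φ ν (L U) (L Y) + β Y Z * tri φ ν (L U) (L X)) := by
  have hcross : ∀ x y, ∃ c, ∀ w, frameMetric e c w = tri φ x y w := fun x y => by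
    refine ⟨∑ i, tri φ x y (e i) • e i, fun w => ?_⟩
    conv_rhs => rw [← e.sum_repr w]
    simp only [map_sum, LinearMap.sum_apply, map_smul, LinearMap.smul_apply, smul_eq_mul]
    refine Finset.sum_congr rfl fun i _ => ?_
    rw [frameMetric_symm, frameMetric_basis, mul_comm]
  choose cross hcross using hcross
  have hinj : ∀ x y, (∀ w, frameMetric e x w = frameMetric e y w) → x = y := fun x y hxy => by
    apply e.repr.injective
    ext i
    rw [← frameMetric_basis, ← frameMetric_basis, hxy]
  have hC' : ∀ U X, C U X = cross (N U) (L X) + cross ν (S U X) := fun U X => by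
    refine hinj _ _ fun w => ?_
    rw [hC, map_add, LinearMap.add_apply, hcross, hcross]
  -- The covariant derivative of the unit normal is tangential. Writing it as L(a U), the relation
  -- between ω and g turns −B(U, ·) into ω(a U, X) = B(U, IX).
  choose a ha using fun U => h.exists_tangent_eq (hN U)
  have haB : ∀ U X, tri φ ν (L (a U)) (L X) = B U (frameComplex t X) := fun U X => by
    rw [h.normal_eq_metric, ← h.frameMetric_eq, ← ha, hNB, neg_neg]
  have hP : ∀ U X Y Z, D U X Y Z
      = -(B U (frameComplex t X) * tri φ ν (L Y) (L Z)
          - B U (frameComplex t Y) * tri φ ν (L X) (L Z)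
          + B U (frameComplex t Z) * tri φ ν (L X) (L Y))
        + (tri φ (cross ν (S U X)) (L (frameComplex t Y)) (L (frameComplex t Z))
          + tri φ (L (frameComplex t X)) (cross ν (S U Y)) (L (frameComplex t Z))
          + tri φ (L (frameComplex t X)) (L (frameComplex t Y)) (cross ν (S U Z))) := by
    intro U X Y Z
    have := h.sum_tri_cross (a := a U) (c := fun X => cross (N U) (L X))
      (fun X w => by rw [hcross, ha]) X Y Z
    simp only [haB] at this
    rw [hD, ← this]
    simp only [hC', map_add, LinearMap.add_apply]
    ring
  have hsw : ∀ x y z, tri φ y x z = -tri φ x y z := fun x y z => tri_swap φ x y z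
  have hrot : ∀ x y z, tri φ y z x = tri φ x y z := fun x y z => tri_rotate φ x y z
  have hBs : ∀ X Y, B (frameComplex t X) Y = B Y (frameComplex t X) := fun X Y => hB _ _
  -- Only now is the alternating sum formed: the terms in ν × S(U, X) cancel by symmetry of S, and
  -- those in B combine in pairs into 2β ∧ ω.
  rw [hP U, hP X, hP Y, hP Z, hS X U, hS Y U, hS Z U, hS Y X, hS Z X, hS Z Y]
  simp only [hβ, hBs]
  simp only [hsw (cross ν _), hrot (cross ν _)]
  ring

/-- The value of `ρ̃ ∧ dω` on the frame. -/
theorem sum_deriv_normal (h : IsTangentFrame φ ν L e t) {η : V [⋀^Fin 3]→ₗ[ℝ] ℝ} {n : W → V}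
    {D : W → W → W → ℝ}
    (hD : ∀ U X Y, D U X Y = tri η (L U) (L X) (L Y) + tri φ (n U) (L X) (L Y)
      - tri φ (n X) (L U) (L Y) + tri φ (n Y) (L U) (L X)) :
    D (t 0) (t 2) (t 4) - D (t 0) (t 3) (t 5) - D (t 1) (t 2) (t 5) - D (t 1) (t 3) (t 4)
      = tri η (e 1) (e 3) (e 5) - tri η (e 1) (e 4) (e 6) - tri η (e 2) (e 3) (e 6)
        - tri η (e 2) (e 4) (e 5) + 2 * ∑ i, frameMetric e (n (t i)) (L (t i)) := by
  have had : ∀ U, ∀ x y, tri φ (n U) x y = _ := fun U x y => h.adapted (n U) x y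
  -- The left-hand side is the contraction with ρ. Each frame vector occurs in exactly two of its
  -- four monomials, which gives the factor 2 in front of the trace of n.
  simp only [hD, h.succ, Fin.sum_univ_six, frameMetric_basis, had]
  simp [modelForm, minor]
  ring

/-- If `ρ̃ ∧ ω = 0` to first order, then `dρ̃ ∧ ω = ρ̃ ∧ dω`. -/
theorem wedge_deriv_eq (h : IsTangentFrame φ ν L e t) {Dρ : W → W [⋀^Fin 3]→ₗ[ℝ] ℝ}
    {Dω : W → W [⋀^Fin 2]→ₗ[ℝ] ℝ}
    (hD : ∀ U, wedge (Dρ U) ((φ.curryLeft ν).compLinearMap L)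
      + wedge ((φ.compLinearMap L).compLinearMap (frameComplex t)) (Dω U) = 0)
    {dρ : W [⋀^Fin 4]→ₗ[ℝ] ℝ}
    (hdρ : ∀ U X Y Z, dρ ![U, X, Y, Z] = Dρ U ![X, Y, Z] - Dρ X ![U, Y, Z] + Dρ Y ![U, X, Z]
      - Dρ Z ![U, X, Y])
    {dω : W → W → W → ℝ}
    (hdω : ∀ U X Y, dω U X Y = Dω U ![X, Y] - Dω X ![U, Y] + Dω Y ![U, X]) :
    wedge dρ ((φ.curryLeft ν).compLinearMap L) t
      = -(dω (t 0) (t 2) (t 4) - dω (t 0) (t 3) (t 5) - dω (t 1) (t 2) (t 5)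
        - dω (t 1) (t 3) (t 4)) := by
  have hω : ∀ X Y, (φ.curryLeft ν).compLinearMap L ![X, Y] = tri φ ν (L X) (L Y) := fun X Y => by
    rw [AlternatingMap.compLinearMap_apply, AlternatingMap.curryLeft_apply_apply, tri_apply]
    congr 1
    ext1 i
    fin_cases i <;> rfl
  have hρ : ∀ X Y Z, (φ.compLinearMap L).compLinearMap (frameComplex t) ![X, Y, Z]
      = tri φ (L (frameComplex t X)) (L (frameComplex t Y)) (L (frameComplex t Z)) :=
    fun X Y Z => by rw [← tri_apply, tri_compLinearMap, tri_compLinearMap]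
  have key : ∀ U a b c d f, wedge (Dρ U) ((φ.curryLeft ν).compLinearMap L) ![a, b, c, d, f]
      + wedge ((φ.compLinearMap L).compLinearMap (frameComplex t)) (Dω U) ![a, b, c, d, f] = 0 :=
    fun U a b c d f => by
      rw [← AlternatingMap.add_apply, hD, AlternatingMap.zero_apply]
  have ht : ⇑t = ![t 0, t 1, t 2, t 3, t 4, t 5] := by
    ext1 i
    fin_cases i <;> rfl
  -- Differentiating along each frame vector and evaluating on the other five; the alternating sum
  -- of the six relations is d(ρ̃ ∧ ω)(t₀,…,t₅) = 0.
  have k0 := key (t 0) (t 1) (t 2) (t 3) (t 4) (t 5)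
  have k1 := key (t 1) (t 0) (t 2) (t 3) (t 4) (t 5)
  have k2 := key (t 2) (t 0) (t 1) (t 3) (t 4) (t 5)
  have k3 := key (t 3) (t 0) (t 1) (t 2) (t 4) (t 5)
  have k4 := key (t 4) (t 0) (t 1) (t 2) (t 3) (t 5)
  have k5 := key (t 5) (t 0) (t 1) (t 2) (t 3) (t 4)
  have hval : wedge dρ ((φ.curryLeft ν).compLinearMap L) t
      = dρ ![t 2, t 3, t 4, t 5] + dρ ![t 0, t 1, t 4, t 5] + dρ ![t 0, t 1, t 2, t 3] := by
    rw [ht, wedge_four_two]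
    simp only [hω, h.tri_normal_eq, Module.Basis.repr_self]
    simp
    ring
  rw [hval]
  simp only [wedge_three_two, hω, hρ, h.tri_normal_eq, h.tri_eq, repr_frameComplex,
    Module.Basis.repr_self] at k0 k1 k2 k3 k4 k5
  simp at k0 k1 k2 k3 k4 k5
  simp only [hdρ, hdω]
  linarith

end IsTangentFrame

end Jets

/-! ### Variation of (i_u φ)² ∧ φ with φ. -/

section CubeVariation

variable {V : Type*} [AddCommGroup V] [Module ℝ V]

/-- The derivative of `cubeForm` at `φ` in the direction `η`. -/
def cubeVariation (φ η : V [⋀^Fin 3]→ₗ[ℝ] ℝ) (c : Fin 7 → V) (u v : V) : ℝ :=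
  wedge (wedge (η.curryLeft u) (φ.curryLeft v)) φ c
    + wedge (wedge (φ.curryLeft u) (η.curryLeft v)) φ c
    + wedge (wedge (φ.curryLeft u) (φ.curryLeft v)) η c

theorem cubeVariation_self (φ η : V [⋀^Fin 3]→ₗ[ℝ] ℝ) (c : Fin 7 → V) (u : V) :
    cubeVariation φ η c u u = 2 * wedge (wedge (η.curryLeft u) (φ.curryLeft u)) φ c
      + wedge (wedge (φ.curryLeft u) (φ.curryLeft u)) η c := by
  rw [cubeVariation, wedge_two_comm (φ.curryLeft u) (η.curryLeft u)]
  ring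

-- Only diagonal values are needed, since the variation enters the mean curvature through traces.
-- The constant agrees with homogeneity: for η = φ both sides are 18, three times the value 6 of the
-- cubic expression `cubeForm`.
set_option maxHeartbeats 1000000 in
theorem IsAdapted.cubeVariation_basis {φ : V [⋀^Fin 3]→ₗ[ℝ] ℝ} {e : Module.Basis (Fin 7) ℝ V}
    (h : IsAdapted φ e) (η : V [⋀^Fin 3]→ₗ[ℝ] ℝ) (i : Fin 7) :
    cubeVariation φ η e (e i) (e i)
      = 3 * ∑ j, ∑ k, tri φ (e i) (e j) (e k) * tri η (e i) (e j) (e k) := by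
  have he : ⇑e = ![e 0, e 1, e 2, e 3, e 4, e 5, e 6] := by ext1 i; fin_cases i <;> rfl
  have hφ : ∀ i j k, tri φ (e i) (e j) (e k)
      = modelForm 1 (fun l => if i = l then 1 else 0) (fun l => if j = l then 1 else 0)
          (fun l => if k = l then 1 else 0) := fun i j k => by
    rw [h]
    simp only [Module.Basis.repr_self]
    congr 1 <;> ext l <;> rw [Finsupp.single_apply]
  obtain ⟨T, hT⟩ : ∃ T : Fin 7 → Fin 7 → Fin 7 → ℝ, ∀ i j k, tri η (e i) (e j) (e k) = T i j k :=
    ⟨_, fun _ _ _ => rfl⟩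
  -- The side conditions allow an exchange only towards increasing order, so rewriting sorts the
  -- indices and stops.
  have h1 : ∀ i j k, j < i → T i j k = -T j i k := fun i j k _ => by
    rw [← hT, ← hT, tri_swap]
  have h2 : ∀ i j k, k < j → T i j k = -T i k j := fun i j k _ => by
    rw [← hT, ← hT, tri_swap']
  have h3 : ∀ i j, T i i j = 0 := fun i j => by rw [← hT, tri_self]
  have h4 : ∀ i j, T j i i = 0 := fun i j => by rw [← hT, tri_self']
  have h5 : ∀ i j, T i j i = 0 := fun i j => by rw [← hT, tri_self'']
  rw [show cubeVariation φ η e (e i) (e i) = cubeVariation φ η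
      ![e 0, e 1, e 2, e 3, e 4, e 5, e 6] (e i) (e i) from
    congrArg (fun c => cubeVariation φ η c (e i) (e i)) he, cubeVariation_self, wedge_four_three,
    wedge_four_three]
  clear he
  simp only [wedge_two_two, AlternatingMap.curryLeft_apply_apply, ← tri_apply, hT, hφ]
  fin_cases i <;>
  · simp [modelForm, minor, Fin.sum_univ_seven, h1, h2, h3, h4, h5]
    ring

end CubeVariation

/-! ### Derivatives of families of forms and of determinants. -/

section FormDerivative

variable {E : Type*} [NormedAddCommGroup E] [NormedSpace ℝ E]
  {V : Type*} [AddCommGroup V] [Module ℝ V]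

/-- The family of forms `A` has derivative `A'` at `z`, when evaluated on fixed vectors. -/
def HasFormDerivAt {k : ℕ} (A A' : E → V [⋀^Fin k]→ₗ[ℝ] ℝ) (z : E) : Prop :=
  ∀ v, ∃ f' : E →L[ℝ] ℝ, HasFDerivAt (fun y => A y v) f' z ∧ ∀ a, f' a = A' a v

/-- On fixed vectors a wedge product is a finite signed sum of products of values, so the ordinary
product rule applies and no topology on V is needed. -/
theorem HasFormDerivAt.wedge {m n : ℕ} {A A' : E → V [⋀^Fin m]→ₗ[ℝ] ℝ}
    {B B' : E → V [⋀^Fin n]→ₗ[ℝ] ℝ} {z : E} (hA : HasFormDerivAt A A' z)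
    (hB : HasFormDerivAt B B' z) :
    HasFormDerivAt (fun y => wedge (A y) (B y))
      (fun a => wedge (A' a) (B z) + wedge (A z) (B' a)) z := by
  have hfac : (m.factorial * n.factorial : ℝ) ≠ 0 := by positivity
  have hwedge : ∀ (α : V [⋀^Fin m]→ₗ[ℝ] ℝ) (β : V [⋀^Fin n]→ₗ[ℝ] ℝ) v,
      G2Geometry.wedge α β v
        = (m.factorial * n.factorial : ℝ)⁻¹ * signedSum (tensorValue α β) v := fun α β v => by
    rw [← factorial_mul_wedge, inv_mul_cancel_left₀ hfac]
  intro v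
  choose f hf hf' using hA
  choose g hg hg' using hB
  have hd := (HasFDerivAt.fun_sum (u := Finset.univ) fun (σ : Equiv.Perm (Fin (m + n))) _ =>
    ((hf ((v ∘ σ) ∘ Fin.castAdd n)).mul (hg ((v ∘ σ) ∘ Fin.natAdd m))).const_mul
      ((Equiv.Perm.sign σ : ℤ) : ℝ)).const_mul (m.factorial * n.factorial : ℝ)⁻¹
  refine ⟨_, hd.congr_of_eventuallyEq (Filter.Eventually.of_forall fun y => by
    simp only [hwedge, signedSum, tensorValue, Pi.mul_apply]), fun a => ?_⟩
  simp only [AlternatingMap.add_apply, hwedge, signedSum, tensorValue, ← mul_add,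
    ← Finset.sum_add_distrib, _root_.smul_apply, _root_.sum_apply,
    _root_.add_apply, hf', hg', smul_eq_mul]
  congr 1
  exact Finset.sum_congr rfl fun σ _ => by ring

theorem HasFormDerivAt.curryLeft {k : ℕ} {A A' : E → V [⋀^Fin (k + 1)]→ₗ[ℝ] ℝ} {z : E}
    (hA : HasFormDerivAt A A' z) (u : V) :
    HasFormDerivAt (fun y => (A y).curryLeft u) (fun a => (A' a).curryLeft u) z :=
  fun v => hA (Matrix.vecCons u v)

theorem HasFormDerivAt.cubeForm {A A' : E → V [⋀^Fin 3]→ₗ[ℝ] ℝ} {z : E}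
    (hA : HasFormDerivAt A A' z) (c : Fin 7 → V) (u v : V) :
    ∃ f' : E →L[ℝ] ℝ, HasFDerivAt (fun y => cubeForm (A y) c u v) f' z ∧
      ∀ a, f' a = cubeVariation (A z) (A' a) c u v := by
  obtain ⟨f', hf, hf'⟩ := (((hA.curryLeft u).wedge (hA.curryLeft v)).wedge hA) c
  refine ⟨f', ?_, fun a => ?_⟩
  · simpa only [cubeForm_apply] using hf
  · rw [hf', AlternatingMap.add_apply, wedge_add_left, AlternatingMap.add_apply, cubeVariation]

end FormDerivative

section Determinant

variable {E : Type*} [NormedAddCommGroup E] [NormedSpace ℝ E]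

/-- At the identity matrix only the identity permutation survives: any other one moves at least two
indices, so after differentiating one factor a vanishing off-diagonal entry remains. -/
theorem hasFDerivAt_det_one {n : ℕ} {M : E → Matrix (Fin n) (Fin n) ℝ}
    {M' : Fin n → Fin n → E →L[ℝ] ℝ} {z : E}
    (hM : ∀ i j, HasFDerivAt (fun y => M y i j) (M' i j) z) (h1 : M z = 1) :
    HasFDerivAt (fun y => (M y).det) (∑ i, M' i i) z := by
  have h : HasFDerivAt (fun y => (M y).det) (∑ σ : Equiv.Perm (Fin n),
      ((Equiv.Perm.sign σ : ℤ) : ℝ) • ∑ i, (∏ j ∈ Finset.univ.erase i, M z (σ j) j) • M' (σ i) i)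
      z := by
    simp only [Matrix.det_apply']
    exact HasFDerivAt.fun_sum fun σ _ =>
      (HasFDerivAt.finsetProd fun i _ => hM (σ i) i).const_mul _
  convert h using 1
  rw [Finset.sum_eq_single (1 : Equiv.Perm (Fin n))]
  · simp [h1, Finset.prod_eq_one]
  · intro σ _ hσ
    rw [Finset.sum_eq_zero, smul_zero]
    intro i _
    obtain ⟨j, hji, hj⟩ : ∃ j, j ≠ i ∧ σ j ≠ j := by
      by_contra! hcon
      apply hσ
      ext1 k
      by_cases hk : k = i
      · by_contra hne
        have := hcon (σ k) (fun h => hne (by rw [h, hk]; rfl))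
        exact hne (σ.injective this)
      · exact hcon k hk
    rw [Finset.prod_eq_zero (Finset.mem_erase.2 ⟨hji, Finset.mem_univ j⟩), zero_smul]
    rw [h1, Matrix.one_apply_ne hj]
  · simp

end Determinant

/-! ### Derivative of the induced metric. -/

section Metric

variable {E : Type*} [NormedAddCommGroup E] [NormedSpace ℝ E]
  {V : Type*} [AddCommGroup V] [Module ℝ V]

/-- The Gram matrix of `cubeForm` determines the volume factor. -/
theorem IsAdapted.cubeForm_det {φ : V [⋀^Fin 3]→ₗ[ℝ] ℝ} {e : Module.Basis (Fin 7) ℝ V}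
    (h : IsAdapted φ e) (c : Fin 7 → V) :
    Matrix.det (Matrix.of fun i j => cubeForm φ c (c i) (c j) / 6) = e.det c ^ 9 := by
  have hM : (Matrix.of fun i j => cubeForm φ c (c i) (c j) / 6)
      = e.det c • ((e.toMatrix c).transpose * e.toMatrix c) := by
    ext i j
    rw [Matrix.of_apply, cubeForm_eq_det_mul φ e, h.cubeForm_eq, Matrix.smul_apply,
      Matrix.mul_apply, smul_eq_mul]
    simp only [Matrix.transpose_apply, Module.Basis.toMatrix_apply]
    ring
  -- The exponent 9 is 7 + 2: the scalar det appears once for each of the seven rows, and the Gram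
  -- matrix adds det².
  rw [hM, Matrix.det_smul, Matrix.det_mul, Matrix.det_transpose, ← Module.Basis.det_apply,
    Fintype.card_fin]
  ring

/-- The derivative of the induced metric. -/
theorem HasFormDerivAt.inducedMetric {A A' : E → V [⋀^Fin 3]→ₗ[ℝ] ℝ} {z : E}
    (hA : HasFormDerivAt A A' z) (hex : ∀ᶠ y in nhds z, ∃ e, IsAdapted (A y) e)
    {e : Module.Basis (Fin 7) ℝ V} (he : IsAdapted (A z) e) (u v : V) :
    ∃ f' : E →L[ℝ] ℝ, HasFDerivAt (fun y => inducedMetric (A y) u v) f' z ∧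
      ∀ a, f' a = cubeVariation (A z) (A' a) e u v / 6
        - (∑ i, cubeVariation (A z) (A' a) e (e i) (e i)) / 54 * frameMetric e u v := by
  choose H hH hH' using fun u v => hA.cubeForm e u v
  set M : E → Matrix (Fin 7) (Fin 7) ℝ := fun y => Matrix.of fun i j =>
    G2Geometry.cubeForm (A y) e (e i) (e j) / 6 with hMdef
  have hM : ∀ i j, HasFDerivAt (fun y => M y i j) ((6 : ℝ)⁻¹ • H (e i) (e j)) z := fun i j => by
    simpa only [hMdef, Matrix.of_apply, div_eq_inv_mul] using (hH (e i) (e j)).const_mul (6 : ℝ)⁻¹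
  have hM1 : M z = 1 := by
    ext i j
    change G2Geometry.cubeForm (A z) e (e i) (e j) / 6 = _
    rw [he.cubeForm_eq]
    rw [mul_div_cancel_left₀ _ (by norm_num)]
    simp [Matrix.one_apply, Finsupp.single_apply]
  have hdet := hasFDerivAt_det_one hM hM1
  have hD1 : (M z).det = 1 := by rw [hM1, Matrix.det_one]
  have hpos : ∀ᶠ y in nhds z, 0 < (M y).det :=
    continuousAt_const.eventually_lt hdet.continuousAt (by rw [hD1]; exact one_pos)
  -- In a frame fixed independently of y, `cubeForm` is 6 det · g, and det is the ninth root of the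
  -- Gram determinant `(M y).det`. This expresses g without adapted frames at y, so it can be
  -- differentiated. At `M z = 1` the power −1/9 and the factor 1/6 in M give the coefficient 1/54.
  have hEq : (fun y => G2Geometry.inducedMetric (A y) u v) =ᶠ[nhds z]
      fun y => G2Geometry.cubeForm (A y) e u v / 6 * (M y).det ^ (-(1 / 9) : ℝ) := by
    filter_upwards [hex, hpos] with y ⟨ey, hey⟩ hy
    have hd : (M y).det = ey.det e ^ 9 := hey.cubeForm_det e
    have hd0 : 0 < ey.det e := by
      rw [hd] at hy
      exact (Odd.pow_pos_iff (by decide)).1 hy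
    have hroot : (M y).det ^ (-(1 / 9) : ℝ) = (ey.det e)⁻¹ := by
      rw [hd, Real.rpow_neg (pow_nonneg hd0.le 9), ← Real.rpow_natCast, ← Real.rpow_mul hd0.le]
      norm_num
    rw [hroot, cubeForm_eq_det_mul _ ey, hey.cubeForm_eq, hey.inducedMetric_eq, frameMetric_apply]
    field_simp
  refine ⟨_, (((hH u v).const_mul (6 : ℝ)⁻¹).mul
    (hdet.rpow_const (p := -(1 / 9)) (Or.inl (by rw [hD1]; exact one_ne_zero)))).congr_of_eventuallyEq
    (hEq.trans (Filter.Eventually.of_forall fun y => by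
      simp only [Pi.mul_apply, div_eq_inv_mul])), fun a => ?_⟩
  simp only [_root_.add_apply, _root_.smul_apply, _root_.sum_apply, hH', hD1, he.cubeForm_eq,
    frameMetric_apply, Real.one_rpow, smul_eq_mul, ← Finset.mul_sum]
  ring

/-- The trace of the derivative of the induced metric over the orthogonal complement of the first
vector of an adapted frame. -/
theorem IsAdapted.sum_cubeVariation {φ : V [⋀^Fin 3]→ₗ[ℝ] ℝ} {e : Module.Basis (Fin 7) ℝ V}
    (h : IsAdapted φ e) (η : V [⋀^Fin 3]→ₗ[ℝ] ℝ) :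
    ∑ i : Fin 6, (cubeVariation φ η e (e i.succ) (e i.succ) / 6
        - (∑ j, cubeVariation φ η e (e j) (e j)) / 54 * frameMetric e (e i.succ) (e i.succ))
      = tri η (e 1) (e 3) (e 5) - tri η (e 1) (e 4) (e 6) - tri η (e 2) (e 3) (e 6)
        - tri η (e 2) (e 4) (e 5) := by
  have hone : ∀ i : Fin 6, frameMetric e (e i.succ) (e i.succ) = 1 := fun i => by
    rw [frameMetric_basis]
    simp
  have hφ : ∀ i j k, tri φ (e i) (e j) (e k)
      = modelForm 1 (fun l => if i = l then 1 else 0) (fun l => if j = l then 1 else 0)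
          (fun l => if k = l then 1 else 0) := fun i j k => by
    rw [h]
    simp only [Module.Basis.repr_self]
    congr 1 <;> ext l <;> rw [Finsupp.single_apply]
  obtain ⟨T, hT⟩ : ∃ T : Fin 7 → Fin 7 → Fin 7 → ℝ, ∀ i j k, tri η (e i) (e j) (e k) = T i j k :=
    ⟨_, fun _ _ _ => rfl⟩
  have h1 : ∀ i j k, j < i → T i j k = -T j i k := fun i j k _ => by
    rw [← hT, ← hT, tri_swap]
  have h2 : ∀ i j k, k < j → T i j k = -T i k j := fun i j k _ => by
    rw [← hT, ← hT, tri_swap']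
  have hsum : ∑ i : Fin 6, cubeVariation φ η e (e i.succ) (e i.succ)
      = ∑ i, cubeVariation φ η e (e i) (e i) - cubeVariation φ η e (e 0) (e 0) := by
    rw [Fin.sum_univ_succ (n := 6), add_sub_cancel_left]
  -- With h_ii the diagonal variation and S its sum, the trace is (S − h₀₀)/6 − S/9 = S/18 − h₀₀/6.
  -- The first term is ⟨φ, η⟩ and the second ⟨i₀φ, i₀η⟩, so the pairing of the restrictions to the
  -- complement of e₀ remains.
  simp only [hone, mul_one, Finset.sum_sub_distrib, ← Finset.sum_div, hsum, Finset.sum_const,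
    Finset.card_univ, Fintype.card_fin]
  simp only [h.cubeVariation_basis, hφ, hT]
  simp [modelForm, minor, Fin.sum_univ_seven, h1, h2]
  ring

end Metric

/-! ### Differentiability tested on basis vectors, and product rules. -/

section Calculus

variable {E : Type*} [NormedAddCommGroup E] [NormedSpace ℝ E]

/-- A map to a normed space is differentiable if finitely many functionals which separate points
are differentiable on it. -/
theorem differentiableAt_of_separating {F ι : Type*} [NormedAddCommGroup F] [NormedSpace ℝ F]
    [Fintype ι] (l : ι → F →L[ℝ] ℝ) (hl : ∀ x, (∀ i, l i x = 0) → x = 0) {f : E → F} {z : E}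
    (hf : ∀ i, DifferentiableAt ℝ (fun y => l i (f y)) z) : DifferentiableAt ℝ f z := by
  let T : F →ₗ[ℝ] (ι → ℝ) := LinearMap.pi fun i => (l i).toLinearMap
  have hT : LinearMap.ker T = ⊥ := by
    rw [LinearMap.ker_eq_bot']
    exact fun x hx => hl x fun i => congrFun hx i
  obtain ⟨S, hS⟩ := T.exists_leftInverse_of_injective hT
  have hf' : f = fun y => LinearMap.toContinuousLinearMap S (fun i => l i (f y)) := by
    funext y
    exact (LinearMap.congr_fun hS (f y)).symm
  rw [hf']
  exact (LinearMap.toContinuousLinearMap S).differentiableAt.comp z (differentiableAt_pi.2 hf)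

variable {V : Type*} [NormedAddCommGroup V] [NormedSpace ℝ V]

theorem differentiableAt_form {k n : ℕ} (b : Module.Basis (Fin n) ℝ V)
    {A : E → V [⋀^Fin k]→L[ℝ] ℝ} {z : E} (hA : ∀ v, DifferentiableAt ℝ (fun y => A y v) z) :
    DifferentiableAt ℝ A z := by
  refine differentiableAt_of_separating
    (fun v : Fin k → Fin n => ContinuousAlternatingMap.apply ℝ V ℝ (fun i => b (v i)))
    (fun x hx => ?_) fun v => hA _
  apply ContinuousAlternatingMap.toAlternatingMap_injective
  exact Module.Basis.ext_alternating b fun v _ => hx v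

theorem differentiableAt_bilin {n : ℕ} (b : Module.Basis (Fin n) ℝ V)
    {G : E → V →L[ℝ] V →L[ℝ] ℝ} {z : E} (hG : ∀ u v, DifferentiableAt ℝ (fun y => G y u v) z) :
    DifferentiableAt ℝ G z := by
  refine differentiableAt_of_separating
    (fun v : Fin n × Fin n => (ContinuousLinearMap.apply ℝ ℝ (b v.2)).comp
      (ContinuousLinearMap.apply ℝ (V →L[ℝ] ℝ) (b v.1)))
    (f := G) (fun x hx => ?_) fun v => hG (b v.1) (b v.2)
  have h1 : ∀ i, x (b i) = 0 := fun i => by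
    apply ContinuousLinearMap.coe_injective
    exact b.ext fun j => hx (i, j)
  apply ContinuousLinearMap.coe_injective
  exact b.ext h1

theorem differentiableAt_covector {n : ℕ} (b : Module.Basis (Fin n) ℝ V)
    {θ : E → V →L[ℝ] ℝ} {z : E} (hθ : ∀ u, DifferentiableAt ℝ (fun y => θ y u) z) :
    DifferentiableAt ℝ θ z := by
  refine differentiableAt_of_separating (fun i => ContinuousLinearMap.apply ℝ ℝ (b i))
    (fun x hx => ?_) fun v => hθ _
  apply ContinuousLinearMap.coe_injective
  exact b.ext hx

theorem exists_hasFormDerivAt {V : Type*} [AddCommGroup V] [Module ℝ V] {k : ℕ}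
    {A : E → V [⋀^Fin k]→ₗ[ℝ] ℝ} {z : E} (hA : ∀ v, DifferentiableAt ℝ (fun y => A y v) z) :
    ∃ A' : E → V [⋀^Fin k]→ₗ[ℝ] ℝ, HasFormDerivAt A A' z ∧
      ∀ a v, A' a v = fderiv ℝ (fun y => A y v) z a := by
  refine ⟨fun a =>
    { toFun := fun v => fderiv ℝ (fun y => A y v) z a
      map_update_add' := fun v i x x' => ?_
      map_update_smul' := fun v i c x => ?_
      map_eq_zero_of_eq' := fun v i j hv hij => ?_ },
    fun v => ⟨fderiv ℝ (fun y => A y v) z, (hA v).hasFDerivAt, fun a => rfl⟩, fun a v => rfl⟩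
  · simp only [AlternatingMap.map_update_add]
    rw [fderiv_fun_add (hA _) (hA _), _root_.add_apply]
  · simp only [AlternatingMap.map_update_smul, smul_eq_mul]
    rw [fderiv_const_mul (hA _), _root_.smul_apply, smul_eq_mul]
  · simp only [fun y => (A y).map_eq_zero_of_eq v hv hij]
    simp

theorem fderiv_bilin {G : E → V →L[ℝ] V →L[ℝ] ℝ} {a b : E → V} {z : E}
    (hG : DifferentiableAt ℝ G z) (ha : DifferentiableAt ℝ a z) (hb : DifferentiableAt ℝ b z)
    (U : E) : fderiv ℝ (fun y => G y (a y) (b y)) z U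
      = fderiv ℝ G z U (a z) (b z) + G z (fderiv ℝ a z U) (b z) + G z (a z) (fderiv ℝ b z U) := by
  have h := (hG.hasFDerivAt.clm_apply ha.hasFDerivAt).clm_apply hb.hasFDerivAt
  rw [h.fderiv]
  simp only [_root_.add_apply, ContinuousLinearMap.comp_apply, ContinuousLinearMap.flip_apply]
  ring

variable {Φ : E → V [⋀^Fin 3]→L[ℝ] ℝ} {a b c : E → V} {z : E}

theorem differentiableAt_tri (hΦ : DifferentiableAt ℝ Φ z) (ha : DifferentiableAt ℝ a z)
    (hb : DifferentiableAt ℝ b z) (hc : DifferentiableAt ℝ c z) :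
    DifferentiableAt ℝ (fun y => tri (Φ y).toAlternatingMap (a y) (b y) (c y)) z := by
  have h := hΦ.continuousAlternatingMap_apply (g := ![a, b, c])
    (fun i => by fin_cases i <;> assumption)
  have e0 : ∀ y, (fun i : Fin 3 => ![a, b, c] i y) = ![a y, b y, c y] := fun y => by
    ext1 i
    fin_cases i <;> rfl
  simp only [e0] at h
  exact h

theorem fderiv_tri (hΦ : DifferentiableAt ℝ Φ z) (ha : DifferentiableAt ℝ a z)
    (hb : DifferentiableAt ℝ b z) (hc : DifferentiableAt ℝ c z) (U : E) :
    fderiv ℝ (fun y => tri (Φ y).toAlternatingMap (a y) (b y) (c y)) z U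
      = tri (fderiv ℝ Φ z U).toAlternatingMap (a z) (b z) (c z)
        + tri (Φ z).toAlternatingMap (fderiv ℝ a z U) (b z) (c z)
        + tri (Φ z).toAlternatingMap (a z) (fderiv ℝ b z U) (c z)
        + tri (Φ z).toAlternatingMap (a z) (b z) (fderiv ℝ c z U) := by
  have h := fderiv_continuousAlternatingMap_apply_apply hΦ (g := ![a, b, c])
    (fun i => by fin_cases i <;> assumption) U
  have e0 : ∀ y, (fun i : Fin 3 => ![a, b, c] i y) = ![a y, b y, c y] := fun y => by
    ext1 i
    fin_cases i <;> rfl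
  have e1 : ∀ x : V, Function.update ![a z, b z, c z] 0 x = ![x, b z, c z] := fun x => by
    ext1 i
    fin_cases i <;> rfl
  have e2 : ∀ x : V, Function.update ![a z, b z, c z] 1 x = ![a z, x, c z] := fun x => by
    ext1 i
    fin_cases i <;> rfl
  have e3 : ∀ x : V, Function.update ![a z, b z, c z] 2 x = ![a z, b z, x] := fun x => by
    ext1 i
    fin_cases i <;> rfl
  simp only [e0, Fin.sum_univ_three, e1, e2, e3] at h
  simp only [tri_apply, ContinuousAlternatingMap.coe_toAlternatingMap]
  rw [h]
  simp only [Matrix.cons_val]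
  ring

end Calculus

/-! ### The induced metric of a 3-form on an open set, and its Christoffel symbols. -/

section LocalMetric

variable {V : Type*} [NormedAddCommGroup V] [NormedSpace ℝ V]

/-- In a neighbourhood of `z`, the `3`-form `Φ` has adapted frames and induces the metric `G`. -/
structure IsLocalMetric (Φ : V → V [⋀^Fin 3]→L[ℝ] ℝ) (G : V → V →L[ℝ] V →L[ℝ] ℝ) (z : V) :
    Prop where
  form : DifferentiableAt ℝ Φ z
  adapted : ∀ᶠ x in nhds z, ∃ e, IsAdapted (Φ x).toAlternatingMap e
  metric : ∀ᶠ x in nhds z, ∀ u v, G x u v = inducedMetric (Φ x).toAlternatingMap u v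

variable {Φ : V → V [⋀^Fin 3]→L[ℝ] ℝ} {G : V → V →L[ℝ] V →L[ℝ] ℝ} {z : V}
  {e : Module.Basis (Fin 7) ℝ V}

theorem IsAdapted.isInvertible {φ : V [⋀^Fin 3]→ₗ[ℝ] ℝ} (he : IsAdapted φ e)
    {g : V →L[ℝ] V →L[ℝ] ℝ} (hg : ∀ u v, g u v = inducedMetric φ u v) : g.IsInvertible := by
  have : FiniteDimensional ℝ V := e.finiteDimensional_of_finite
  have hinj : Function.Injective g := by
    rw [injective_iff_map_eq_zero]
    intro u hu
    by_contra h0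
    have h1 := frameMetric_pos e u h0
    rw [← he.inducedMetric_eq, ← hg, hu] at h1
    exact lt_irrefl _ h1
  have hfin : Module.finrank ℝ V = Module.finrank ℝ (V →L[ℝ] ℝ) := by
    rw [← (LinearMap.toContinuousLinearMap (𝕜 := ℝ) (E := V) (F' := ℝ)).finrank_eq]
    exact (Subspace.dual_finrank_eq (K := ℝ) (V := V)).symm
  exact ⟨(LinearEquiv.ofInjectiveOfFinrankEq g.toLinearMap hinj hfin).toContinuousLinearEquiv, rfl⟩

namespace IsLocalMetric

theorem eq_frameMetric (h : IsLocalMetric Φ G z) (he : IsAdapted (Φ z).toAlternatingMap e)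
    (u v : V) : G z u v = frameMetric e u v := by
  rw [h.metric.self_of_nhds, he.inducedMetric_eq]

theorem isInvertible (h : IsLocalMetric Φ G z) : (G z).IsInvertible := by
  obtain ⟨e, he⟩ := h.adapted.self_of_nhds
  exact he.isInvertible h.metric.self_of_nhds

theorem hasFormDerivAt (h : IsLocalMetric Φ G z) :
    HasFormDerivAt (fun x => (Φ x).toAlternatingMap) (fun a => (fderiv ℝ Φ z a).toAlternatingMap)
      z :=
  fun v => ⟨(ContinuousAlternatingMap.apply ℝ V ℝ v).comp (fderiv ℝ Φ z),
    (ContinuousAlternatingMap.apply ℝ V ℝ v).hasFDerivAt.comp z h.form.hasFDerivAt, fun _ => rfl⟩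

theorem differentiableAt_metric_apply (h : IsLocalMetric Φ G z) (u v : V) :
    DifferentiableAt ℝ (fun x => G x u v) z := by
  obtain ⟨e, he⟩ := h.adapted.self_of_nhds
  obtain ⟨f', hf, -⟩ := h.hasFormDerivAt.inducedMetric h.adapted he u v
  exact (hf.congr_of_eventuallyEq (h.metric.mono fun x hx => hx u v)).differentiableAt

theorem differentiableAt_metric (h : IsLocalMetric Φ G z) : DifferentiableAt ℝ G z := by
  obtain ⟨e, he⟩ := h.adapted.self_of_nhds
  exact differentiableAt_bilin e h.differentiableAt_metric_apply

theorem fderiv_metric_apply (h : IsLocalMetric Φ G z) (a u v : V) :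
    fderiv ℝ G z a u v = fderiv ℝ (fun x => G x u v) z a := by
  rw [fderiv_bilin h.differentiableAt_metric (differentiableAt_const u) (differentiableAt_const v)]
  simp

theorem fderiv_metric (h : IsLocalMetric Φ G z) (he : IsAdapted (Φ z).toAlternatingMap e)
    (a u v : V) : fderiv ℝ G z a u v
      = cubeVariation (Φ z).toAlternatingMap (fderiv ℝ Φ z a).toAlternatingMap e u v / 6
        - (∑ i, cubeVariation (Φ z).toAlternatingMap (fderiv ℝ Φ z a).toAlternatingMap e (e i)
          (e i)) / 54 * frameMetric e u v := by
  obtain ⟨f', hf, hf'⟩ := h.hasFormDerivAt.inducedMetric h.adapted he u v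
  rw [h.fderiv_metric_apply,
    (hf.congr_of_eventuallyEq (h.metric.mono fun x hx => hx u v)).fderiv, hf']

theorem metric_symm (h : IsLocalMetric Φ G z) :
    ∀ᶠ x in nhds z, ∀ u v, G x u v = G x v u := by
  filter_upwards [h.metric, h.adapted] with x hx ⟨e, he⟩ u v
  rw [hx, hx, he.inducedMetric_eq, frameMetric_symm]

theorem fderiv_metric_symm (h : IsLocalMetric Φ G z) (a u v : V) :
    fderiv ℝ G z a u v = fderiv ℝ G z a v u := by
  rw [h.fderiv_metric_apply, h.fderiv_metric_apply]
  have : (fun x => G x u v) =ᶠ[nhds z] fun x => G x v u := h.metric_symm.mono fun x hx => hx u v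
  rw [this.fderiv_eq]

/-- The trace of the derivative of the metric on the hyperplane orthogonal to `e 0`. -/
theorem sum_fderiv_metric (h : IsLocalMetric Φ G z) (he : IsAdapted (Φ z).toAlternatingMap e)
    (a : V) : ∑ i : Fin 6, fderiv ℝ G z a (e i.succ) (e i.succ)
      = tri (fderiv ℝ Φ z a).toAlternatingMap (e 1) (e 3) (e 5)
        - tri (fderiv ℝ Φ z a).toAlternatingMap (e 1) (e 4) (e 6)
        - tri (fderiv ℝ Φ z a).toAlternatingMap (e 2) (e 3) (e 6)
        - tri (fderiv ℝ Φ z a).toAlternatingMap (e 2) (e 4) (e 5) := by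
  simp only [h.fderiv_metric he]
  exact he.sum_cubeVariation _

end IsLocalMetric

end LocalMetric

section Christoffel

variable {n : ℕ} {G : EuclideanSpace ℝ (Fin n) →
  EuclideanSpace ℝ (Fin n) →L[ℝ] EuclideanSpace ℝ (Fin n) →L[ℝ] ℝ}
  {z : EuclideanSpace ℝ (Fin n)}

theorem metric_christoffel (hG : (G z).IsInvertible) (u v w : EuclideanSpace ℝ (Fin n)) :
    G z (christoffel G z u v) w = 1 / 2 * (fderiv ℝ G z u v w + fderiv ℝ G z v u w
      - fderiv ℝ G z w u v) := by
  rw [christoffel, hG.self_apply_inverse]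
  simp only [_root_.smul_apply, _root_.sub_apply, _root_.add_apply, smul_eq_mul,
    ContinuousLinearMap.flip_apply]

end Christoffel

/-! ### Hypersurfaces in local coordinates. -/

section LocalHypersurface

variable {V W : Type*} [NormedAddCommGroup V] [NormedSpace ℝ V] [NormedAddCommGroup W]
  [NormedSpace ℝ W]

/-- In a neighbourhood of `y`, the map `F` is an immersed hypersurface with unit normal `n`, and `R`
is the `3`-form `ρ̃` on it. -/
structure IsLocalHypersurface (Φ : V → V [⋀^Fin 3]→L[ℝ] ℝ) (G : V → V →L[ℝ] V →L[ℝ] ℝ)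
    (F n : W → V) (R : W → W [⋀^Fin 3]→L[ℝ] ℝ) (y : W) : Prop where
  metric : IsLocalMetric Φ G (F y)
  map : ContDiffAt ℝ 2 F y
  normal : DifferentiableAt ℝ n y
  frame : ∀ᶠ x in nhds y, ∃ e t,
    IsTangentFrame (Φ (F x)).toAlternatingMap (n x) (fderiv ℝ F x).toLinearMap e t ∧
      (R x).toAlternatingMap = ((Φ (F x)).toAlternatingMap.compLinearMap
        (fderiv ℝ F x).toLinearMap).compLinearMap (frameComplex t)

variable {Φ : V → V [⋀^Fin 3]→L[ℝ] ℝ} {G : V → V →L[ℝ] V →L[ℝ] ℝ} {F n : W → V}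
  {R : W → W [⋀^Fin 3]→L[ℝ] ℝ} {y : W}

/-- The second fundamental form in terms of the derivative of the normal vector. -/
def shapeForm (G : V → V →L[ℝ] V →L[ℝ] ℝ) (F n : W → V) (y : W) : W →ₗ[ℝ] W →ₗ[ℝ] ℝ :=
  LinearMap.mk₂ ℝ (fun X Y => -G (F y) (fderiv ℝ n y X) (fderiv ℝ F y Y)
      - 1 / 2 * (fderiv ℝ G (F y) (fderiv ℝ F y X) (n y) (fderiv ℝ F y Y)
        + fderiv ℝ G (F y) (n y) (fderiv ℝ F y X) (fderiv ℝ F y Y)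
        - fderiv ℝ G (F y) (fderiv ℝ F y Y) (fderiv ℝ F y X) (n y)))
    (fun X X' Y => by simp only [map_add, _root_.add_apply]; ring)
    (fun c X Y => by simp only [map_smul, _root_.smul_apply, smul_eq_mul]; ring)
    (fun X Y Y' => by simp only [map_add, _root_.add_apply]; ring)
    (fun c X Y => by simp only [map_smul, _root_.smul_apply, smul_eq_mul]; ring)

theorem shapeForm_apply (X Y : W) : shapeForm G F n y X Y
    = -G (F y) (fderiv ℝ n y X) (fderiv ℝ F y Y)
      - 1 / 2 * (fderiv ℝ G (F y) (fderiv ℝ F y X) (n y) (fderiv ℝ F y Y)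
        + fderiv ℝ G (F y) (n y) (fderiv ℝ F y X) (fderiv ℝ F y Y)
        - fderiv ℝ G (F y) (fderiv ℝ F y Y) (fderiv ℝ F y X) (n y)) := rfl

namespace IsLocalHypersurface

theorem differentiableAt_map (h : IsLocalHypersurface Φ G F n R y) : DifferentiableAt ℝ F y :=
  h.map.differentiableAt (by norm_num)

theorem differentiableAt_fderiv (h : IsLocalHypersurface Φ G F n R y) :
    DifferentiableAt ℝ (fderiv ℝ F) y :=
  (h.map.fderiv_right (m := 1) (by norm_num)).differentiableAt (by norm_num)

theorem differentiableAt_fderiv_apply (h : IsLocalHypersurface Φ G F n R y) (X : W) :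
    DifferentiableAt ℝ (fun x => fderiv ℝ F x X) y :=
  h.differentiableAt_fderiv.clm_apply (differentiableAt_const X)

theorem fderiv_fderiv_apply (h : IsLocalHypersurface Φ G F n R y) (U X : W) :
    fderiv ℝ (fun x => fderiv ℝ F x X) y U = fderiv ℝ (fderiv ℝ F) y U X := by
  rw [fderiv_clm_apply h.differentiableAt_fderiv (differentiableAt_const X)]
  simp

theorem hessian_symm (h : IsLocalHypersurface Φ G F n R y) (U X : W) :
    fderiv ℝ (fderiv ℝ F) y U X = fderiv ℝ (fderiv ℝ F) y X U :=
  (h.map.isSymmSndFDerivAt (by simp)).eq U X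

theorem differentiableAt_metric (h : IsLocalHypersurface Φ G F n R y) :
    DifferentiableAt ℝ (fun x => G (F x)) y :=
  DifferentiableAt.comp (G := V →L[ℝ] V →L[ℝ] ℝ) (g := G) y h.metric.differentiableAt_metric
    h.differentiableAt_map

theorem differentiableAt_form (h : IsLocalHypersurface Φ G F n R y) :
    DifferentiableAt ℝ (fun x => Φ (F x)) y :=
  h.metric.form.comp y h.differentiableAt_map

theorem fderiv_metric (h : IsLocalHypersurface Φ G F n R y) (U : W) :
    fderiv ℝ (fun x => G (F x)) y U = fderiv ℝ G (F y) (fderiv ℝ F y U) := by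
  have := (HasFDerivAt.comp (G := V →L[ℝ] V →L[ℝ] ℝ) (g := G) y
    h.metric.differentiableAt_metric.hasFDerivAt h.differentiableAt_map.hasFDerivAt).fderiv
  exact congrArg (fun T => T U) this

theorem fderiv_form (h : IsLocalHypersurface Φ G F n R y) (U : W) :
    fderiv ℝ (fun x => Φ (F x)) y U = fderiv ℝ Φ (F y) (fderiv ℝ F y U) := by
  have := (h.metric.form.hasFDerivAt.comp y h.differentiableAt_map.hasFDerivAt).fderiv
  exact congrArg (fun T => T U) this

theorem eventually_metric (h : IsLocalHypersurface Φ G F n R y) : ∀ᶠ x in nhds y, ∀ u v,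
    G (F x) u v = inducedMetric (Φ (F x)).toAlternatingMap u v :=
  h.differentiableAt_map.continuousAt.eventually h.metric.metric

/-- The derivative of the equation `G(n, DF(X)) = 0`. -/
theorem fderiv_normal_tangent (h : IsLocalHypersurface Φ G F n R y) (U X : W) :
    fderiv ℝ G (F y) (fderiv ℝ F y U) (n y) (fderiv ℝ F y X)
      + G (F y) (fderiv ℝ n y U) (fderiv ℝ F y X)
      + G (F y) (n y) (fderiv ℝ (fderiv ℝ F) y U X) = 0 := by
  have hz : (fun x => G (F x) (n x) (fderiv ℝ F x X)) =ᶠ[nhds y] fun _ => 0 := by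
    filter_upwards [h.eventually_metric, h.frame] with x hx ⟨e, t, ht, _⟩
    rw [hx, ht.adapted.inducedMetric_eq, frameMetric_symm, ← ht.zero, frameMetric_basis]
    exact ht.repr_zero X
  have := fderiv_bilin h.differentiableAt_metric h.normal (h.differentiableAt_fderiv_apply X) U
  rw [hz.fderiv_eq, h.fderiv_metric, h.fderiv_fderiv_apply] at this
  rw [← this]
  simp

/-- The derivative of the equation `G(n, n) = 1`. -/
theorem fderiv_normal_normal (h : IsLocalHypersurface Φ G F n R y) (U : W) :
    fderiv ℝ G (F y) (fderiv ℝ F y U) (n y) (n y)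
      + 2 * G (F y) (fderiv ℝ n y U) (n y) = 0 := by
  have hz : (fun x => G (F x) (n x) (n x)) =ᶠ[nhds y] fun _ => 1 := by
    filter_upwards [h.eventually_metric, h.frame] with x hx ⟨e, t, ht, _⟩
    rw [hx, ht.adapted.inducedMetric_eq, ← ht.zero, frameMetric_basis]
    simp
  have := fderiv_bilin h.differentiableAt_metric h.normal h.normal U
  rw [hz.fderiv_eq, h.fderiv_metric, h.metric.metric_symm.self_of_nhds (n y)] at this
  simp only [fderiv_fun_const, Pi.zero_apply, _root_.zero_apply] at this
  linarith

/-- The cross product of the normal vector with the tangent vector `DF(X)`. -/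
def normalCross [FiniteDimensional ℝ V] (Φ : V → V [⋀^Fin 3]→L[ℝ] ℝ)
    (G : V → V →L[ℝ] V →L[ℝ] ℝ) (F n : W → V) (X x : W) : V :=
  (G (F x)).inverse (LinearMap.toContinuousLinearMap
    (tri (Φ (F x)).toAlternatingMap (n x) (fderiv ℝ F x X)))

section Cross

variable [FiniteDimensional ℝ V]

theorem eventually_normalCross (h : IsLocalHypersurface Φ G F n R y) : ∀ᶠ x in nhds y, ∀ X w,
    G (F x) (normalCross Φ G F n X x) w
      = tri (Φ (F x)).toAlternatingMap (n x) (fderiv ℝ F x X) w := by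
  filter_upwards [h.eventually_metric, h.frame] with x hx ⟨e, t, ht, _⟩ X w
  rw [normalCross, (ht.adapted.isInvertible hx).self_apply_inverse]
  rfl

/-- As I X is the cross product of n with DF(X), ρ̃ becomes φ evaluated on three cross products.
These depend differentiably on the point, whereas the frames supplied by `frame` carry no
regularity. -/
theorem eventually_companion (h : IsLocalHypersurface Φ G F n R y) : ∀ᶠ x in nhds y, ∀ X Y Z,
    R x ![X, Y, Z] = tri (Φ (F x)).toAlternatingMap (normalCross Φ G F n X x)
      (normalCross Φ G F n Y x) (normalCross Φ G F n Z x) := by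
  filter_upwards [h.eventually_metric, h.frame, h.eventually_normalCross] with x hx ⟨e, t, ht, hR⟩
    hc X Y Z
  have hc' : ∀ X, fderiv ℝ F x (frameComplex t X) = normalCross Φ G F n X x := fun X =>
    ht.apply_frameComplex X fun w => by
      rw [← ht.adapted.inducedMetric_eq, ← hx, hc]
      rfl
  have : R x ![X, Y, Z] = tri (R x).toAlternatingMap X Y Z := rfl
  rw [this, hR, tri_compLinearMap, tri_compLinearMap]
  simp only [ContinuousLinearMap.coe_coe, hc']

theorem normalCross_eq (h : IsLocalHypersurface Φ G F n R y) {e : Module.Basis (Fin 7) ℝ V}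
    {t : Module.Basis (Fin 6) ℝ W} (ht : IsTangentFrame (Φ (F y)).toAlternatingMap (n y)
      (fderiv ℝ F y).toLinearMap e t) (X : W) :
    normalCross Φ G F n X y = fderiv ℝ F y (frameComplex t X) :=
  (ht.apply_frameComplex X fun w => by
    rw [← h.metric.eq_frameMetric ht.adapted, h.eventually_normalCross.self_of_nhds]
    rfl).symm

/-- The cross product is the inverse of G applied to a covector; inversion is smooth at an
invertible operator, and the covector is differentiable by the product rule. -/
theorem differentiableAt_normalCross (h : IsLocalHypersurface Φ G F n R y) (X : W) :
    DifferentiableAt ℝ (normalCross Φ G F n X) y := by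
  have : CompleteSpace V := FiniteDimensional.complete ℝ V
  obtain ⟨e, he⟩ := h.metric.adapted.self_of_nhds
  have hθ : DifferentiableAt ℝ (fun x => LinearMap.toContinuousLinearMap
      (tri (Φ (F x)).toAlternatingMap (n x) (fderiv ℝ F x X))) y :=
    differentiableAt_covector e fun u => differentiableAt_tri h.differentiableAt_form h.normal
      (h.differentiableAt_fderiv_apply X) (differentiableAt_const u)
  have hinv : DifferentiableAt ℝ (fun x => (G (F x)).inverse) y := by
    obtain ⟨T, hT⟩ := h.metric.isInvertible
    have h1 : DifferentiableAt ℝ (ContinuousLinearMap.inverse : (V →L[ℝ] V →L[ℝ] ℝ) → _)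
        (G (F y)) := by
      rw [← hT]
      exact (contDiffAt_map_inverse (n := 1) T).differentiableAt (by norm_num)
    exact DifferentiableAt.comp (𝕜 := ℝ) (F := V →L[ℝ] V →L[ℝ] ℝ) (G := (V →L[ℝ] ℝ) →L[ℝ] V)
      (f := fun x => G (F x)) y h1 h.differentiableAt_metric
  exact hinv.clm_apply hθ

/-- Differentiating the defining equation G(c, w) = φ(n, DF(X), w) gives the derivative of c
implicitly, without a formula for the derivative of the inverse of G. -/
theorem fderiv_normalCross (h : IsLocalHypersurface Φ G F n R y) (U X : W) (w : V) :
    G (F y) (fderiv ℝ (normalCross Φ G F n X) y U) w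
      + fderiv ℝ G (F y) (fderiv ℝ F y U) (normalCross Φ G F n X y) w
      = tri (fderiv ℝ Φ (F y) (fderiv ℝ F y U)).toAlternatingMap (n y) (fderiv ℝ F y X) w
        + tri (Φ (F y)).toAlternatingMap (fderiv ℝ n y U) (fderiv ℝ F y X) w
        + tri (Φ (F y)).toAlternatingMap (n y) (fderiv ℝ (fderiv ℝ F) y U X) w := by
  have hE : (fun x => G (F x) (normalCross Φ G F n X x) w) =ᶠ[nhds y] fun x =>
      tri (Φ (F x)).toAlternatingMap (n x) (fderiv ℝ F x X) w :=
    h.eventually_normalCross.mono fun x hx => hx X w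
  have h1 := fderiv_bilin h.differentiableAt_metric (h.differentiableAt_normalCross X)
    (differentiableAt_const w) U
  have h2 := fderiv_tri h.differentiableAt_form h.normal (h.differentiableAt_fderiv_apply X)
    (differentiableAt_const w) U
  rw [hE.fderiv_eq, h2, h.fderiv_form, h.fderiv_metric, h.fderiv_fderiv_apply] at h1
  simp only [fderiv_fun_const, Pi.zero_apply, _root_.zero_apply, map_zero, add_zero] at h1
  linarith

theorem differentiableAt_companion_apply (h : IsLocalHypersurface Φ G F n R y) (v : Fin 3 → W) :
    DifferentiableAt ℝ (fun x => R x v) y := by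
  have hv : v = ![v 0, v 1, v 2] := by
    ext1 i
    fin_cases i <;> rfl
  have hE : (fun x => R x ![v 0, v 1, v 2]) =ᶠ[nhds y] _ :=
    h.eventually_companion.mono fun x hx => hx (v 0) (v 1) (v 2)
  rw [hv]
  exact hE.differentiableAt_iff.2 (differentiableAt_tri h.differentiableAt_form
    (h.differentiableAt_normalCross _) (h.differentiableAt_normalCross _)
    (h.differentiableAt_normalCross _))

theorem fderiv_companion_apply (h : IsLocalHypersurface Φ G F n R y) (U X Y Z : W) :
    fderiv ℝ (fun x => R x ![X, Y, Z]) y U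
      = tri (fderiv ℝ Φ (F y) (fderiv ℝ F y U)).toAlternatingMap (normalCross Φ G F n X y)
          (normalCross Φ G F n Y y) (normalCross Φ G F n Z y)
        + tri (Φ (F y)).toAlternatingMap (fderiv ℝ (normalCross Φ G F n X) y U)
          (normalCross Φ G F n Y y) (normalCross Φ G F n Z y)
        + tri (Φ (F y)).toAlternatingMap (normalCross Φ G F n X y)
          (fderiv ℝ (normalCross Φ G F n Y) y U) (normalCross Φ G F n Z y)
        + tri (Φ (F y)).toAlternatingMap (normalCross Φ G F n X y) (normalCross Φ G F n Y y)
          (fderiv ℝ (normalCross Φ G F n Z) y U) := by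
  have hE : (fun x => R x ![X, Y, Z]) =ᶠ[nhds y] _ :=
    h.eventually_companion.mono fun x hx => hx X Y Z
  rw [hE.fderiv_eq, fderiv_tri h.differentiableAt_form (h.differentiableAt_normalCross _)
    (h.differentiableAt_normalCross _) (h.differentiableAt_normalCross _), h.fderiv_form]

end Cross

theorem differentiableAt_companion [FiniteDimensional ℝ V] (h : IsLocalHypersurface Φ G F n R y) :
    DifferentiableAt ℝ R y := by
  obtain ⟨e, t, ht, -⟩ := h.frame.self_of_nhds
  exact G2Geometry.differentiableAt_form t h.differentiableAt_companion_apply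

theorem extDeriv_companion [FiniteDimensional ℝ V] (h : IsLocalHypersurface Φ G F n R y)
    (U X Y Z : W) :
    extDeriv R y ![U, X, Y, Z] = fderiv ℝ (fun x => R x ![X, Y, Z]) y U
      - fderiv ℝ (fun x => R x ![U, Y, Z]) y X + fderiv ℝ (fun x => R x ![U, X, Z]) y Y
      - fderiv ℝ (fun x => R x ![U, X, Y]) y Z := by
  have e0 : Fin.removeNth 0 ![U, X, Y, Z] = ![X, Y, Z] := by ext1 i; fin_cases i <;> rfl
  have e1 : Fin.removeNth 1 ![U, X, Y, Z] = ![U, Y, Z] := by ext1 i; fin_cases i <;> rfl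
  have e2 : Fin.removeNth 2 ![U, X, Y, Z] = ![U, X, Z] := by ext1 i; fin_cases i <;> rfl
  have e3 : Fin.removeNth 3 ![U, X, Y, Z] = ![U, X, Y] := by ext1 i; fin_cases i <;> rfl
  rw [extDeriv_apply h.differentiableAt_companion, Fin.sum_univ_four, e0, e1, e2, e3]
  simp
  ring

end IsLocalHypersurface

end LocalHypersurface

/-! ### The two formulas for dρ̃ in local coordinates. -/

section LocalFormulas

variable {V W : Type*} [NormedAddCommGroup V] [NormedSpace ℝ V] [NormedAddCommGroup W]
  [NormedSpace ℝ W] {Φ : V → V [⋀^Fin 3]→L[ℝ] ℝ} {G : V → V →L[ℝ] V →L[ℝ] ℝ} {F n : W → V}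
  {R : W → W [⋀^Fin 3]→L[ℝ] ℝ} {y : W} {e : Module.Basis (Fin 7) ℝ V}
  {t : Module.Basis (Fin 6) ℝ W} {Γ : V → V → V}

/-- The map `Γ` is given by the Christoffel symbols at `z` of the metric `G`. -/
def IsChristoffel (G : V → V →L[ℝ] V →L[ℝ] ℝ) (z : V) (Γ : V → V → V) : Prop :=
  ∀ u v w, G z (Γ u v) w
    = 1 / 2 * (fderiv ℝ G z u v w + fderiv ℝ G z v u w - fderiv ℝ G z w u v)

theorem IsLocalMetric.christoffel_symm {z : V} (h : IsLocalMetric Φ G z)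
    (hΓ : IsChristoffel G z Γ) (u v : V) : Γ u v = Γ v u := by
  have hinj : Function.Injective (G z) := by
    obtain ⟨T, hT⟩ := h.isInvertible
    rw [← hT]
    exact T.injective
  apply hinj
  ext w
  rw [hΓ, hΓ, h.fderiv_metric_symm w u v]
  ring

/-- This is metric compatibility of the Levi-Civita connection: in the sum of the two Koszul
formulas everything cancels except the derivative along a. -/
theorem IsLocalMetric.fderiv_eq_christoffel {z : V} (h : IsLocalMetric Φ G z)
    (hΓ : IsChristoffel G z Γ) (a u v : V) :
    fderiv ℝ G z a u v = G z (Γ a u) v + G z u (Γ a v) := by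
  rw [h.metric_symm.self_of_nhds u, hΓ, hΓ, h.fderiv_metric_symm a v u]
  ring

namespace IsLocalHypersurface

/-- Differentiating G(n, DF(Y)) = 0 moves the derivative from n to DF(Y). One side is convenient for
∇n, the other is visibly symmetric. -/
theorem shapeForm_eq (h : IsLocalHypersurface Φ G F n R y) (hΓ : IsChristoffel G (F y) Γ)
    (X Y : W) : shapeForm G F n y X Y
      = G (F y) (fderiv ℝ (fderiv ℝ F) y X Y + Γ (fderiv ℝ F y X) (fderiv ℝ F y Y)) (n y) := by
  have h1 := h.fderiv_normal_tangent X Y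
  rw [h.metric.metric_symm.self_of_nhds (n y)] at h1
  rw [shapeForm_apply, map_add, _root_.add_apply, hΓ,
    h.metric.fderiv_metric_symm _ (fderiv ℝ F y Y) (n y)]
  linarith

theorem shapeForm_symm (h : IsLocalHypersurface Φ G F n R y) (hΓ : IsChristoffel G (F y) Γ)
    (X Y : W) : shapeForm G F n y X Y = shapeForm G F n y Y X := by
  rw [h.shapeForm_eq hΓ, h.shapeForm_eq hΓ, h.hessian_symm, h.metric.christoffel_symm hΓ]

/-- The exterior derivative of `ρ̃` when `φ` is parallel. -/
theorem extDeriv_of_parallel [FiniteDimensional ℝ V] (h : IsLocalHypersurface Φ G F n R y)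
    (ht : IsTangentFrame (Φ (F y)).toAlternatingMap (n y) (fderiv ℝ F y).toLinearMap e t)
    (hΓ : IsChristoffel G (F y) Γ)
    (hpar : ∀ a u v w, tri (fderiv ℝ Φ (F y) a).toAlternatingMap u v w
      = tri (Φ (F y)).toAlternatingMap (Γ a u) v w + tri (Φ (F y)).toAlternatingMap u (Γ a v) w
        + tri (Φ (F y)).toAlternatingMap u v (Γ a w))
    {β : W → W → ℝ} (hβ : ∀ X Y, β X Y = 1 / 2 * (shapeForm G F n y (frameComplex t X) Y
      - shapeForm G F n y X (frameComplex t Y))) (U X Y Z : W) :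
    extDeriv R y ![U, X, Y, Z] = 2 *
      (β U X * tri (Φ (F y)).toAlternatingMap (n y) (fderiv ℝ F y Y) (fderiv ℝ F y Z)
        - β U Y * tri (Φ (F y)).toAlternatingMap (n y) (fderiv ℝ F y X) (fderiv ℝ F y Z)
        + β U Z * tri (Φ (F y)).toAlternatingMap (n y) (fderiv ℝ F y X) (fderiv ℝ F y Y)
        + β X Y * tri (Φ (F y)).toAlternatingMap (n y) (fderiv ℝ F y U) (fderiv ℝ F y Z)
        - β X Z * tri (Φ (F y)).toAlternatingMap (n y) (fderiv ℝ F y U) (fderiv ℝ F y Y)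
        + β Y Z * tri (Φ (F y)).toAlternatingMap (n y) (fderiv ℝ F y U) (fderiv ℝ F y X)) := by
  have hg : ∀ u v, frameMetric e u v = G (F y) u v := fun u v =>
    (h.metric.eq_frameMetric ht.adapted u v).symm
  have hcov := h.metric.fderiv_eq_christoffel hΓ
  rw [h.extDeriv_companion]
  -- Here N is ∇_U n, S the covariant Hessian of F, and C the covariant derivative of n × DF(X).
  -- Parallelism of φ replaces the plain derivatives by these covariant ones.
  refine ht.sum_deriv_companion (B := shapeForm G F n y) (h.shapeForm_symm hΓ)
    (N := fun U => fderiv ℝ n y U + Γ (fderiv ℝ F y U) (n y)) (fun U => ?_) (fun U X => ?_)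
    (S := fun U X => fderiv ℝ (fderiv ℝ F) y U X + Γ (fderiv ℝ F y U) (fderiv ℝ F y X))
    (fun U X => ?_)
    (C := fun U X => fderiv ℝ (normalCross Φ G F n X) y U
      + Γ (fderiv ℝ F y U) (fderiv ℝ F y (frameComplex t X))) (fun U X w => ?_)
    (D := fun U X Y Z => fderiv ℝ (fun x => R x ![X, Y, Z]) y U) (fun U X Y Z => ?_) hβ U X Y Z
  · have h1 := h.fderiv_normal_normal U
    have h2 := hcov (fderiv ℝ F y U) (n y) (n y)
    rw [h.metric.metric_symm.self_of_nhds (n y) (Γ _ _)] at h2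
    rw [hg, map_add, _root_.add_apply]
    linarith
  · change frameMetric e _ (fderiv ℝ F y X) = _
    rw [hg, shapeForm_apply, map_add, _root_.add_apply, hΓ]
    ring
  · rw [h.hessian_symm, h.metric.christoffel_symm hΓ]
  · have h1 := h.fderiv_normalCross U X w
    have h2 := h.eventually_normalCross.self_of_nhds X (Γ (fderiv ℝ F y U) w)
    rw [hcov, hpar, h2, h.normalCross_eq ht] at h1
    simp only [hg, map_add, LinearMap.add_apply]
    change _ = tri (Φ (F y)).toAlternatingMap _ (fderiv ℝ F y X) w
      + tri (Φ (F y)).toAlternatingMap _ (fderiv ℝ F y X) w + _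
    linarith
  · change fderiv ℝ (fun x => R x ![X, Y, Z]) y U = tri (Φ (F y)).toAlternatingMap
        (_ + Γ _ (fderiv ℝ F y (frameComplex t X))) (fderiv ℝ F y (frameComplex t Y))
          (fderiv ℝ F y (frameComplex t Z))
      + tri (Φ (F y)).toAlternatingMap (fderiv ℝ F y (frameComplex t X))
        (_ + Γ _ (fderiv ℝ F y (frameComplex t Y))) (fderiv ℝ F y (frameComplex t Z))
      + tri (Φ (F y)).toAlternatingMap (fderiv ℝ F y (frameComplex t X))
        (fderiv ℝ F y (frameComplex t Y)) (_ + Γ _ (fderiv ℝ F y (frameComplex t Z)))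
    rw [h.fderiv_companion_apply]
    simp only [hpar, h.normalCross_eq ht, map_add, LinearMap.add_apply]
    ring

/-- The form `dρ̃ ∧ ω` when `φ` is closed. -/
theorem wedge_extDeriv_of_closed [FiniteDimensional ℝ V] (h : IsLocalHypersurface Φ G F n R y)
    (ht : IsTangentFrame (Φ (F y)).toAlternatingMap (n y) (fderiv ℝ F y).toLinearMap e t)
    (hR : (R y).toAlternatingMap = ((Φ (F y)).toAlternatingMap.compLinearMap
        (fderiv ℝ F y).toLinearMap).compLinearMap (frameComplex t))
    (hcl : ∀ a b c d, tri (fderiv ℝ Φ (F y) a).toAlternatingMap b c d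
      - tri (fderiv ℝ Φ (F y) b).toAlternatingMap a c d
      + tri (fderiv ℝ Φ (F y) c).toAlternatingMap a b d
      - tri (fderiv ℝ Φ (F y) d).toAlternatingMap a b c = 0) :
    wedge (extDeriv R y).toAlternatingMap
      (((Φ (F y)).toAlternatingMap.curryLeft (n y)).compLinearMap (fderiv ℝ F y).toLinearMap) t
      = 2 * ∑ i, shapeForm G F n y (t i) (t i) := by
  set σ : W → W [⋀^Fin 2]→ₗ[ℝ] ℝ := fun x =>
    ((Φ (F x)).toAlternatingMap.curryLeft (n x)).compLinearMap (fderiv ℝ F x).toLinearMap with hωdef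
  have hω : ∀ x X Y, σ x ![X, Y]
      = tri (Φ (F x)).toAlternatingMap (n x) (fderiv ℝ F x X) (fderiv ℝ F x Y) := fun x X Y => by
    rw [tri_apply, hωdef]
    change (Φ (F x)).toAlternatingMap _ = _
    congr 1
    ext1 i
    fin_cases i <;> rfl
  have hωd : ∀ v, DifferentiableAt ℝ (fun x => σ x v) y := fun v => by
    have hv : v = ![v 0, v 1] := by
      ext1 i
      fin_cases i <;> rfl
    rw [hv]
    simp only [hω]
    exact differentiableAt_tri h.differentiableAt_form h.normal (h.differentiableAt_fderiv_apply _)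
      (h.differentiableAt_fderiv_apply _)
  obtain ⟨Dω, hDω, hDω'⟩ := exists_hasFormDerivAt hωd
  obtain ⟨Dρ, hDρ, hDρ'⟩ := exists_hasFormDerivAt (A := fun x => (R x).toAlternatingMap)
    h.differentiableAt_companion_apply
  have hDω2 : ∀ U X Y, Dω U ![X, Y]
      = tri (fderiv ℝ Φ (F y) (fderiv ℝ F y U)).toAlternatingMap (n y) (fderiv ℝ F y X)
          (fderiv ℝ F y Y)
        + tri (Φ (F y)).toAlternatingMap (fderiv ℝ n y U) (fderiv ℝ F y X) (fderiv ℝ F y Y)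
        + tri (Φ (F y)).toAlternatingMap (n y) (fderiv ℝ (fderiv ℝ F) y U X) (fderiv ℝ F y Y)
        + tri (Φ (F y)).toAlternatingMap (n y) (fderiv ℝ F y X)
          (fderiv ℝ (fderiv ℝ F) y U Y) := fun U X Y => by
    rw [hDω']
    simp only [hω]
    rw [fderiv_tri h.differentiableAt_form h.normal (h.differentiableAt_fderiv_apply _)
      (h.differentiableAt_fderiv_apply _), h.fderiv_form, h.fderiv_fderiv_apply,
      h.fderiv_fderiv_apply]
  have hzero : ∀ᶠ x in nhds y, wedge (R x).toAlternatingMap (σ x) = 0 := by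
    filter_upwards [h.frame] with x ⟨e, t, ht, hR⟩
    rw [hR]
    exact ht.wedge_frameComplex_normal
  -- Since ρ̃ ∧ ω vanishes in a whole neighbourhood, so does its derivative at y.
  have hD : ∀ U, wedge (Dρ U) (σ y) + wedge (R y).toAlternatingMap (Dω U) = 0 := fun U => by
    ext v
    obtain ⟨f', hf, hf'⟩ := hDρ.wedge hDω v
    have hz : (fun x => wedge (R x).toAlternatingMap (σ x) v) =ᶠ[nhds y] fun _ => 0 :=
      hzero.mono fun x hx => by simp only [hx, AlternatingMap.zero_apply]
    have h0 : f' = 0 := hf.unique ((hasFDerivAt_const (0 : ℝ) y).congr_of_eventuallyEq hz)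
    rw [← hf', h0]
    rfl
  have hσ : σ y = ((Φ (F y)).toAlternatingMap.curryLeft (n y)).compLinearMap
    (fderiv ℝ F y).toLinearMap := rfl
  rw [hR, hσ] at hD
  rw [ht.wedge_deriv_eq hD (dω := fun U X Y => Dω U ![X, Y] - Dω X ![U, Y] + Dω Y ![U, X])
    (fun U X Y Z => ?_) (fun U X Y => rfl)]
  swap
  · rw [hDρ', hDρ', hDρ', hDρ']
    exact h.extDeriv_companion U X Y Z
  -- Closedness on (n, U, X, Y) trades the tangential derivatives of φ for the one along n; the
  -- Hessian terms of F cancel by symmetry. This is Cartan's formula for dω.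
  have hdω : ∀ U X Y, Dω U ![X, Y] - Dω X ![U, Y] + Dω Y ![U, X]
      = tri (fderiv ℝ Φ (F y) (n y)).toAlternatingMap (fderiv ℝ F y U) (fderiv ℝ F y X)
          (fderiv ℝ F y Y)
        + tri (Φ (F y)).toAlternatingMap (fderiv ℝ n y U) (fderiv ℝ F y X) (fderiv ℝ F y Y)
        - tri (Φ (F y)).toAlternatingMap (fderiv ℝ n y X) (fderiv ℝ F y U) (fderiv ℝ F y Y)
        + tri (Φ (F y)).toAlternatingMap (fderiv ℝ n y Y) (fderiv ℝ F y U) (fderiv ℝ F y X) := by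
    intro U X Y
    have h1 := hcl (n y) (fderiv ℝ F y U) (fderiv ℝ F y X) (fderiv ℝ F y Y)
    have s1 := tri_swap' (Φ (F y)).toAlternatingMap (n y) (fderiv ℝ F y Y)
      (fderiv ℝ (fderiv ℝ F) y U X)
    have s2 := tri_swap' (Φ (F y)).toAlternatingMap (n y) (fderiv ℝ F y X)
      (fderiv ℝ (fderiv ℝ F) y U Y)
    have s3 := tri_swap' (Φ (F y)).toAlternatingMap (n y) (fderiv ℝ F y U)
      (fderiv ℝ (fderiv ℝ F) y X Y)
    rw [hDω2, hDω2, hDω2, h.hessian_symm X U, h.hessian_symm Y U, h.hessian_symm Y X]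
    linarith
  have hsum := ht.sum_deriv_normal (D := fun U X Y => Dω U ![X, Y] - Dω X ![U, Y] + Dω Y ![U, X])
    hdω
  -- The contraction of ρ with the derivative of φ along n is the trace over the hyperplane of the
  -- derivative of G. Together with the trace of Dn it is −2 times the trace of the second
  -- fundamental form.
  rw [hsum, ← h.metric.sum_fderiv_metric ht.adapted]
  have hB : ∀ i, shapeForm G F n y (t i) (t i)
      = -frameMetric e (fderiv ℝ n y (t i)) (fderiv ℝ F y (t i))
        - 1 / 2 * fderiv ℝ G (F y) (n y) (e i.succ) (e i.succ) := fun i => by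
    have hs : fderiv ℝ F y (t i) = e i.succ := ht.succ i
    rw [shapeForm_apply, ← h.metric.eq_frameMetric ht.adapted, hs,
      h.metric.fderiv_metric_symm _ (n y)]
    ring
  simp only [hB, Finset.sum_sub_distrib, Finset.sum_neg_distrib, ← Finset.mul_sum]
  change -(_ + 2 * ∑ i, frameMetric e (fderiv ℝ n y (t i)) (fderiv ℝ F y (t i))) = _
  ring

end IsLocalHypersurface

end LocalFormulas

/-! ### Change of coordinates and preferred charts. -/

section Transport

variable {V W V' W' : Type*} [AddCommGroup V] [Module ℝ V] [AddCommGroup W] [Module ℝ W]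
  [AddCommGroup V'] [Module ℝ V'] [AddCommGroup W'] [Module ℝ W']
  {φ : V [⋀^Fin 3]→ₗ[ℝ] ℝ} {ν : V} {L : W →ₗ[ℝ] V} {e : Module.Basis (Fin 7) ℝ V}
  {t : Module.Basis (Fin 6) ℝ W}

theorem IsTangentFrame.map (h : IsTangentFrame φ ν L e t) (S : V' ≃ₗ[ℝ] V) (T : W' ≃ₗ[ℝ] W)
    {L' : W' →ₗ[ℝ] V'} {ν' : V'} (hL : ∀ X, S (L' X) = L (T X)) (hν : S ν' = ν) :
    IsTangentFrame (φ.compLinearMap S.toLinearMap) ν' L' (e.map S.symm) (t.map T.symm) where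
  adapted := h.adapted.map S
  zero := by rw [Module.Basis.map_apply, h.zero, ← hν, LinearEquiv.symm_apply_apply]
  succ i := by
    apply S.injective
    rw [hL, Module.Basis.map_apply, Module.Basis.map_apply, LinearEquiv.apply_symm_apply,
      LinearEquiv.apply_symm_apply, h.succ]

theorem frameComplex_map (t : Module.Basis (Fin 6) ℝ W) (T : W' ≃ₗ[ℝ] W) (X : W') :
    T (frameComplex (t.map T.symm) X) = frameComplex t (T X) := by
  rw [frameComplex_apply, frameComplex_apply]
  simp

end Transport

section Charts

variable {n : ℕ} {M : Type*} [TopologicalSpace M] [ChartedSpace (EuclideanSpace ℝ (Fin n)) M]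

/-- The derivative of the chart at `x`, evaluated at `q`. -/
def chartDeriv (x q : M) : EuclideanSpace ℝ (Fin n) →L[ℝ] EuclideanSpace ℝ (Fin n) :=
  mfderiv (𝓡 n) 𝓘(ℝ, EuclideanSpace ℝ (Fin n)) (extChartAt (𝓡 n) x) q

/-- The derivative of the inverse of the chart at `x`, as an endomorphism of the model space. -/
def chartInvDeriv (x : M) (z : EuclideanSpace ℝ (Fin n)) :
    EuclideanSpace ℝ (Fin n) →L[ℝ] EuclideanSpace ℝ (Fin n) :=
  chartSymmDeriv x z

/-- A form, with the tangent spaces identified with the model space. -/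
def formAt {k : ℕ} (α : DiffForm n M k) (x : M) : EuclideanSpace ℝ (Fin n) [⋀^Fin k]→L[ℝ] ℝ := α x

theorem formInChart_eq {k : ℕ} (α : DiffForm n M k) (x : M) (z : EuclideanSpace ℝ (Fin n)) :
    formInChart α x z
      = (formAt α ((extChartAt (𝓡 n) x).symm z)).compContinuousLinearMap (chartInvDeriv x z) := rfl

theorem toAlternatingMap_formInChart {k : ℕ} (α : DiffForm n M k) (x : M)
    (z : EuclideanSpace ℝ (Fin n)) :
    (formInChart α x z).toAlternatingMap
      = (formAt α ((extChartAt (𝓡 n) x).symm z)).toAlternatingMap.compLinearMap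
        (chartInvDeriv x z).toLinearMap := rfl

variable [IsManifold (𝓡 n) ∞ M]

theorem chartInvDeriv_chartDeriv (x : M) {z : EuclideanSpace ℝ (Fin n)}
    (hz : z ∈ (extChartAt (𝓡 n) x).target) (v : EuclideanSpace ℝ (Fin n)) :
    chartInvDeriv x z (chartDeriv x ((extChartAt (𝓡 n) x).symm z) v) = v := by
  have : IsManifold (𝓡 n) 1 M := IsManifold.of_le (n := ∞) (by norm_num)
  have h := mfderivWithin_extChartAt_symm_comp_mfderiv_extChartAt (I := 𝓡 n) (x := x) hz
  rw [ModelWithCorners.range_eq_univ, mfderivWithin_univ] at h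
  exact congrArg (fun T : EuclideanSpace ℝ (Fin n) →L[ℝ] EuclideanSpace ℝ (Fin n) => T v) h

theorem chartDeriv_chartInvDeriv (x : M) {z : EuclideanSpace ℝ (Fin n)}
    (hz : z ∈ (extChartAt (𝓡 n) x).target) (v : EuclideanSpace ℝ (Fin n)) :
    chartDeriv x ((extChartAt (𝓡 n) x).symm z) (chartInvDeriv x z v) = v := by
  have : IsManifold (𝓡 n) 1 M := IsManifold.of_le (n := ∞) (by norm_num)
  have h := mfderiv_extChartAt_comp_mfderivWithin_extChartAt_symm (I := 𝓡 n) (x := x) hz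
  rw [ModelWithCorners.range_eq_univ, mfderivWithin_univ] at h
  exact congrArg (fun T : EuclideanSpace ℝ (Fin n) →L[ℝ] EuclideanSpace ℝ (Fin n) => T v) h

/-- The derivative of the inverse of the chart at `x`, as a linear equivalence. -/
def chartInvEquiv (x : M) {z : EuclideanSpace ℝ (Fin n)} (hz : z ∈ (extChartAt (𝓡 n) x).target) :
    EuclideanSpace ℝ (Fin n) ≃ₗ[ℝ] EuclideanSpace ℝ (Fin n) :=
  LinearEquiv.ofLinearMap (chartInvDeriv x z).toLinearMap
    (chartDeriv x ((extChartAt (𝓡 n) x).symm z)).toLinearMap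
    (LinearMap.ext (chartInvDeriv_chartDeriv x hz)) (LinearMap.ext (chartDeriv_chartInvDeriv x hz))

/-- The tangent space at x is identified with the model space by this very chart. Hence local
expressions evaluated at the base point are the tensors themselves. -/
theorem chartDeriv_self (x : M) (v : EuclideanSpace ℝ (Fin n)) : chartDeriv x x v = v := by
  have : IsManifold (𝓡 n) 1 M := IsManifold.of_le (n := ∞) (by norm_num)
  have h := mfderiv_extChartAt_self (I := 𝓡 n) (x := x)
  exact congrArg (fun T : EuclideanSpace ℝ (Fin n) →L[ℝ] EuclideanSpace ℝ (Fin n) => T v) h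

theorem chartInvDeriv_self (x : M) (v : EuclideanSpace ℝ (Fin n)) :
    chartInvDeriv x (extChartAt (𝓡 n) x x) v = v := by
  have : IsManifold (𝓡 n) 1 M := IsManifold.of_le (n := ∞) (by norm_num)
  have h := mfderivWithin_range_extChartAt_symm (I := 𝓡 n) (x := x)
  rw [ModelWithCorners.range_eq_univ, mfderivWithin_univ] at h
  exact congrArg (fun T : EuclideanSpace ℝ (Fin n) →L[ℝ] EuclideanSpace ℝ (Fin n) => T v) h

theorem formInChart_self {k : ℕ} (α : DiffForm n M k) (x : M) :
    formInChart α x (extChartAt (𝓡 n) x x) = formAt α x := by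
  rw [formInChart_eq, extChartAt_to_inv]
  ext v
  change formAt α x (fun i => chartInvDeriv x (extChartAt (𝓡 n) x x) (v i)) = formAt α x v
  simp only [chartInvDeriv_self]

end Charts

/-! ### Local expressions of the structure, the normal and the immersion. -/

section LocalExpressions

variable {M : Type*} [TopologicalSpace M] [ChartedSpace (EuclideanSpace ℝ (Fin 7)) M]
  {o : PointwiseOrientation M} {φ : DiffForm 7 M 3}

/-- The orientation at `x`, with the tangent space identified with the model space. -/
def orientationAt (o : PointwiseOrientation M) (x : M) :
    Orientation ℝ (EuclideanSpace ℝ (Fin 7)) (Fin 7) := o x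

theorem IsG2Structure.exists_isAdapted (hφ : IsG2Structure o φ) (x : M) :
    ∃ e : Module.Basis (Fin 7) ℝ (EuclideanSpace ℝ (Fin 7)),
      IsAdapted (formAt φ x).toAlternatingMap e := by
  let b := (EuclideanSpace.basisFun (Fin 7) ℝ).toBasis
  have hpos : IsPositiveForm (orientationAt o x) (formAt φ x).toAlternatingMap := hφ.positive x
  obtain ⟨e, s, -, -, -, he⟩ := G2Geometry.exists_isAdapted hpos b (b.ne_zero 0)
  exact ⟨e, he⟩

/-- Adapted frames and the induced metric are natural under linear isomorphisms, here the derivative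
of the inverse chart. -/
theorem IsG2Structure.isLocalMetric [IsManifold (𝓡 7) ∞ M] (hφ : IsG2Structure o φ) (x : M) :
    IsLocalMetric (formInChart φ x) (bilinInChart (g2Metric φ) x) (extChartAt (𝓡 7) x x) where
  form := ((hφ.smooth x).contDiffAt (extChartAt_target_mem_nhds x)).differentiableAt (by simp)
  adapted := by
    filter_upwards [extChartAt_target_mem_nhds x] with z hz
    obtain ⟨e, he⟩ := hφ.exists_isAdapted ((extChartAt (𝓡 7) x).symm z)
    exact ⟨_, he.map (chartInvEquiv x hz)⟩
  metric := by
    filter_upwards [extChartAt_target_mem_nhds x] with z hz u v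
    obtain ⟨e, he⟩ := hφ.exists_isAdapted ((extChartAt (𝓡 7) x).symm z)
    exact (he.inducedMetric_compLinearMap (chartInvEquiv x hz) u v).symm

variable {N : Type*} [TopologicalSpace N] [ChartedSpace (EuclideanSpace ℝ (Fin 6)) N]
  {f : N → M} {ν : ∀ p : N, TangentSpace (𝓡 7) (f p)}

/-- The differential of `f`, as a map of model spaces. -/
def differentialAt (f : N → M) (p : N) :
    EuclideanSpace ℝ (Fin 6) →L[ℝ] EuclideanSpace ℝ (Fin 7) := differential f p

/-- The normal vector, as a vector of the model space. -/
def normalAt (ν : ∀ p : N, TangentSpace (𝓡 7) (f p)) (p : N) : EuclideanSpace ℝ (Fin 7) := ν p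

theorem exists_isTangentFrame_differential [IsManifold (𝓡 7) ∞ M] (hφ : IsG2Structure o φ)
    (himm : ∀ p, Function.Injective (mfderiv (𝓡 6) (𝓡 7) f p))
    (hν : IsUnitNormal (g2Metric φ) f ν) (p : N) :
    ∃ (e : Module.Basis (Fin 7) ℝ (EuclideanSpace ℝ (Fin 7)))
      (t : Module.Basis (Fin 6) ℝ (EuclideanSpace ℝ (Fin 6))),
      e.orientation = orientationAt o (f p) ∧
      IsTangentFrame (formAt φ (f p)).toAlternatingMap (normalAt ν p)
        (differentialAt f p).toLinearMap e t := by
  have hpos : IsPositiveForm (orientationAt o (f p)) (formAt φ (f p)).toAlternatingMap :=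
    hφ.positive (f p)
  have hunit : inducedMetric (formAt φ (f p)).toAlternatingMap (normalAt ν p) (normalAt ν p) = 1 :=
    hν.unit p
  have hnormal : ∀ X, inducedMetric (formAt φ (f p)).toAlternatingMap (normalAt ν p)
      ((differentialAt f p).toLinearMap X) = 0 := hν.normal p
  have hinj : Function.Injective (differentialAt f p).toLinearMap := himm p
  obtain ⟨e, he0, heo, he⟩ := exists_isAdapted_unit hpos
    (EuclideanSpace.basisFun (Fin 7) ℝ).toBasis hunit
  obtain ⟨t, ht⟩ := exists_isTangentFrame hinj (EuclideanSpace.basisFun (Fin 6) ℝ).toBasis he he0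
    hnormal
  exact ⟨e, t, heo, ht⟩

/-- The normal field in the charts at `p` and `f p`. -/
def normalInChart (f : N → M) (ν : ∀ p : N, TangentSpace (𝓡 7) (f p)) (p : N)
    (y : EuclideanSpace ℝ (Fin 6)) : EuclideanSpace ℝ (Fin 7) :=
  chartDeriv (f p) (f ((extChartAt (𝓡 6) p).symm y)) (normalAt ν ((extChartAt (𝓡 6) p).symm y))

theorem normalInChart_self [IsManifold (𝓡 7) ∞ M] (p : N) :
    normalInChart f ν p (extChartAt (𝓡 6) p p) = normalAt ν p := by
  rw [normalInChart, extChartAt_to_inv, chartDeriv_self]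

theorem eventually_mem_chart_source (hf : ContMDiff (𝓡 6) (𝓡 7) ∞ f) (p : N) :
    ∀ᶠ y in nhds (extChartAt (𝓡 6) p p),
      f ((extChartAt (𝓡 6) p).symm y) ∈ (extChartAt (𝓡 7) (f p)).source := by
  have h1 : ContinuousAt (extChartAt (𝓡 6) p).symm (extChartAt (𝓡 6) p p) :=
    continuousAt_extChartAt_symm p
  have h2 : ContinuousAt f ((extChartAt (𝓡 6) p).symm (extChartAt (𝓡 6) p p)) :=
    hf.continuous.continuousAt
  refine (h2.comp h1).eventually ?_
  rw [Function.comp_apply, extChartAt_to_inv]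
  exact extChartAt_source_mem_nhds (f p)

/-- Smoothness of ν into the tangent bundle is smoothness of its fibre coordinate in the
trivialisation at f p; near p this coordinate is given by the derivative of the chart at f p. -/
theorem differentiableAt_normalInChart [IsManifold (𝓡 7) ∞ M] (hf : ContMDiff (𝓡 6) (𝓡 7) ∞ f)
    (hν : IsUnitNormal (g2Metric φ) f ν) (p : N) :
    DifferentiableAt ℝ (normalInChart f ν p) (extChartAt (𝓡 6) p p) := by
  have : IsManifold (𝓡 7) 1 M := IsManifold.of_le (n := ∞) (by norm_num)
  have h1 := (Bundle.contMDiffAt_totalSpace.1 (hν.smooth.contMDiffAt (x := p))).2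
  have h2 := (contMDiffAt_iff.1 h1).2
  rw [ModelWithCorners.range_eq_univ, contDiffWithinAt_univ] at h2
  refine (h2.differentiableAt (by simp)).congr_of_eventuallyEq ?_
  filter_upwards [eventually_mem_chart_source hf p] with y hy
  rw [extChartAt_source] at hy
  have h3 := TangentBundle.continuousLinearMapAt_trivializationAt (I := 𝓡 7) (x₀ := f p) hy
  have h4 := congrFun ((trivializationAt (EuclideanSpace ℝ (Fin 7)) (TangentSpace (𝓡 7))
    (f p)).coe_linearMapAt_of_mem (R := ℝ) (b := f ((extChartAt (𝓡 6) p).symm y))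
    (by simpa using hy)) (ν ((extChartAt (𝓡 6) p).symm y))
  exact (congrArg (fun T : EuclideanSpace ℝ (Fin 7) →L[ℝ] EuclideanSpace ℝ (Fin 7) =>
    T (normalAt ν ((extChartAt (𝓡 6) p).symm y))) h3).symm.trans h4

theorem contDiffAt_writtenInExtChartAt (hf : ContMDiff (𝓡 6) (𝓡 7) ∞ f) (p : N) :
    ContDiffAt ℝ 2 (writtenInExtChartAt (𝓡 6) (𝓡 7) p f) (extChartAt (𝓡 6) p p) := by
  have h := (contMDiffAt_iff.1 (hf.contMDiffAt (x := p))).2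
  rw [ModelWithCorners.range_eq_univ, contDiffWithinAt_univ] at h
  exact h.of_le (by norm_cast)

theorem writtenInExtChartAt_self (p : N) :
    writtenInExtChartAt (𝓡 6) (𝓡 7) p f (extChartAt (𝓡 6) p p) = extChartAt (𝓡 7) (f p) (f p) := by
  simp [writtenInExtChartAt]

theorem fderiv_writtenInExtChartAt [IsManifold (𝓡 7) ∞ M] [IsManifold (𝓡 6) ∞ N]
    (hf : ContMDiff (𝓡 6) (𝓡 7) ∞ f) (p : N)
    {y : EuclideanSpace ℝ (Fin 6)} (hy : y ∈ (extChartAt (𝓡 6) p).target)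
    (hfy : f ((extChartAt (𝓡 6) p).symm y) ∈ (extChartAt (𝓡 7) (f p)).source)
    (X : EuclideanSpace ℝ (Fin 6)) :
    fderiv ℝ (writtenInExtChartAt (𝓡 6) (𝓡 7) p f) y X
      = chartDeriv (f p) (f ((extChartAt (𝓡 6) p).symm y))
        (differentialAt f ((extChartAt (𝓡 6) p).symm y) (chartInvDeriv p y X)) := by
  have : IsManifold (𝓡 7) 1 M := IsManifold.of_le (n := ∞) (by norm_num)
  have : IsManifold (𝓡 6) 1 N := IsManifold.of_le (n := ∞) (by norm_num)
  have h1 : MDifferentiableAt 𝓘(ℝ, EuclideanSpace ℝ (Fin 6)) (𝓡 6) (extChartAt (𝓡 6) p).symm y := by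
    have := mdifferentiableWithinAt_extChartAt_symm (I := 𝓡 6) hy
    rwa [ModelWithCorners.range_eq_univ, mdifferentiableWithinAt_univ] at this
  have h2 : MDifferentiableAt (𝓡 6) (𝓡 7) f ((extChartAt (𝓡 6) p).symm y) :=
    hf.mdifferentiableAt (by simp)
  have h3 : MDifferentiableAt (𝓡 7) 𝓘(ℝ, EuclideanSpace ℝ (Fin 7)) (extChartAt (𝓡 7) (f p))
      (f ((extChartAt (𝓡 6) p).symm y)) := by
    rw [extChartAt_source] at hfy
    exact mdifferentiableAt_extChartAt hfy
  have h4 := (h3.hasMFDerivAt.comp y (h2.hasMFDerivAt.comp y h1.hasMFDerivAt)).mfderiv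
  rw [mfderiv_eq_fderiv] at h4
  exact congrArg (fun T : EuclideanSpace ℝ (Fin 6) →L[ℝ] EuclideanSpace ℝ (Fin 7) => T X) h4

end LocalExpressions

/-! ### From the immersion to the local hypersurface. -/

section Hypersurfaces

variable {M : Type*} [TopologicalSpace M] [ChartedSpace (EuclideanSpace ℝ (Fin 7)) M]
  {N : Type*} [TopologicalSpace N] [ChartedSpace (EuclideanSpace ℝ (Fin 6)) N]
  {o : PointwiseOrientation M} {φ : DiffForm 7 M 3} {f : N → M}
  {ν : ∀ p : N, TangentSpace (𝓡 7) (f p)} {p : N}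
  {e : Module.Basis (Fin 7) ℝ (EuclideanSpace ℝ (Fin 7))}
  {t : Module.Basis (Fin 6) ℝ (EuclideanSpace ℝ (Fin 6))}

theorem toAlternatingMap_rhoTilde (heo : e.orientation = orientationAt o (f p))
    (ht : IsTangentFrame (formAt φ (f p)).toAlternatingMap (normalAt ν p)
      (differentialAt f p).toLinearMap e t) :
    (formAt (rhoTilde o φ f ν) p).toAlternatingMap
      = ((formAt φ (f p)).toAlternatingMap.compLinearMap
        (differentialAt f p).toLinearMap).compLinearMap (frameComplex t) :=
  ht.toAlternatingMap_companion (ρ := formAt (rho φ f) p) heo rfl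

theorem almostComplex_apply (heo : e.orientation = orientationAt o (f p))
    (ht : IsTangentFrame (formAt φ (f p)).toAlternatingMap (normalAt ν p)
      (differentialAt f p).toLinearMap e t) (X : EuclideanSpace ℝ (Fin 6)) :
    almostComplex o φ f ν p X = frameComplex t X :=
  ht.inducedComplexStructure_apply (ρ := formAt (rho φ f) p) heo rfl X

/-- The volume form, with the tangent space identified with the model space. -/
def volAt (o : PointwiseOrientation M) (φ : DiffForm 7 M 3) (f : N → M)
    (ν : ∀ p : N, TangentSpace (𝓡 7) (f p)) (p : N) :
    EuclideanSpace ℝ (Fin 6) [⋀^Fin 6]→ₗ[ℝ] ℝ := vol o φ f ν p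

theorem volAt_eq : volAt o φ f ν p = volumeElement (positiveBases (orientationAt o (f p))
    (differentialAt f p).toLinearMap (normalAt ν p)) (formAt (rho φ f) p) := rfl

theorem volAt_frame (heo : e.orientation = orientationAt o (f p))
    (ht : IsTangentFrame (formAt φ (f p)).toAlternatingMap (normalAt ν p)
      (differentialAt f p).toLinearMap e t) : volAt o φ f ν p t = 1 := by
  have hρ : (formAt (rho φ f) p).toAlternatingMap = (formAt φ (f p)).toAlternatingMap.compLinearMap
    (differentialAt f p).toLinearMap := rfl
  rw [volAt_eq, ht.volumeElement_frame heo hρ]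

variable [IsManifold (𝓡 7) ∞ M] [IsManifold (𝓡 6) ∞ N]

/-- At each nearby point a frame of the tangent spaces there is carried to the model spaces by the
derivatives of the two charts, which intertwine the differential of f with the derivative of its
local expression. -/
theorem isLocalHypersurface (hφ : IsG2Structure o φ) (hf : ContMDiff (𝓡 6) (𝓡 7) ∞ f)
    (himm : ∀ p, Function.Injective (mfderiv (𝓡 6) (𝓡 7) f p))
    (hν : IsUnitNormal (g2Metric φ) f ν) (p : N) :
    IsLocalHypersurface (formInChart φ (f p)) (bilinInChart (g2Metric φ) (f p))
      (writtenInExtChartAt (𝓡 6) (𝓡 7) p f) (normalInChart f ν p)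
      (formInChart (rhoTilde o φ f ν) p) (extChartAt (𝓡 6) p p) where
  metric := by
    rw [writtenInExtChartAt_self]
    exact hφ.isLocalMetric (f p)
  map := contDiffAt_writtenInExtChartAt hf p
  normal := differentiableAt_normalInChart hf hν p
  frame := by
    filter_upwards [extChartAt_target_mem_nhds p, eventually_mem_chart_source hf p] with y hy hfy
    obtain ⟨e, t, heo, ht⟩ :=
      exists_isTangentFrame_differential hφ himm hν ((extChartAt (𝓡 6) p).symm y)
    have hFy : writtenInExtChartAt (𝓡 6) (𝓡 7) p f y ∈ (extChartAt (𝓡 7) (f p)).target :=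
      (extChartAt (𝓡 7) (f p)).map_source hfy
    have hinv : (extChartAt (𝓡 7) (f p)).symm (writtenInExtChartAt (𝓡 6) (𝓡 7) p f y)
        = f ((extChartAt (𝓡 6) p).symm y) := (extChartAt (𝓡 7) (f p)).left_inv hfy
    have hS : ∀ v, chartInvEquiv (f p) hFy
        (chartDeriv (f p) (f ((extChartAt (𝓡 6) p).symm y)) v) = v := fun v => by
      have := chartInvDeriv_chartDeriv (f p) hFy v
      rwa [hinv] at this
    have hL : ∀ X, chartInvEquiv (f p) hFy
        ((fderiv ℝ (writtenInExtChartAt (𝓡 6) (𝓡 7) p f) y).toLinearMap X)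
        = (differentialAt f ((extChartAt (𝓡 6) p).symm y)).toLinearMap (chartInvEquiv p hy X) :=
      fun X => by
        rw [ContinuousLinearMap.coe_coe, fderiv_writtenInExtChartAt hf p hy hfy, hS]
        rfl
    have hform : (formInChart φ (f p) (writtenInExtChartAt (𝓡 6) (𝓡 7) p f y)).toAlternatingMap
        = (formAt φ (f ((extChartAt (𝓡 6) p).symm y))).toAlternatingMap.compLinearMap
          (chartInvEquiv (f p) hFy).toLinearMap := by
      rw [toAlternatingMap_formInChart, hinv]
      rfl
    refine ⟨e.map (chartInvEquiv (f p) hFy).symm, t.map (chartInvEquiv p hy).symm, ?_, ?_⟩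
    · rw [hform]
      exact ht.map (chartInvEquiv (f p) hFy) (chartInvEquiv p hy) hL (hS _)
    · rw [toAlternatingMap_formInChart, toAlternatingMap_rhoTilde heo ht, hform]
      ext v
      simp only [AlternatingMap.compLinearMap_apply, LinearEquiv.coe_coe, hL, frameComplex_map]
      rfl

end Hypersurfaces

/-! ### Semi-positive (2,2)-forms. -/

section SemiPositive

variable {W : Type*} [AddCommGroup W] [Module ℝ W]

theorem areaForm_apply (z : W →ₗ[ℝ] ℂ) (x y : W) :
    areaForm z ![x, y] = (z x).re * (z y).im - (z y).re * (z x).im := by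
  rw [areaForm, wedge_one_one]
  simp [oneForm]

/-- If `σ` is semi-positive and `ω(X, I X) > 0` for `X ≠ 0`, then `σ ∧ ω` is positive on complex
bases. -/
theorem IsSemiPositive.exists_wedge_pos {I : W → W} {σ : W [⋀^Fin 4]→ₗ[ℝ] ℝ}
    (hσ : IsSemiPositive I σ) {α : W [⋀^Fin 2]→ₗ[ℝ] ℝ} (hα : ∀ X, X ≠ 0 → 0 < α ![X, I X]) :
    ∃ x y z, 0 < wedge σ α ![x, I x, y, I y, z, I z] := by
  obtain ⟨z, hzI, hz, l, hl, ⟨i, hi⟩, rfl⟩ := hσ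
  choose s hs using fun i : Fin 3 => hz.2 (Pi.single i 1)
  have hzs : ∀ i j, z j (s i) = if j = i then 1 else 0 := fun i j => by
    have := congrFun (hs i) j
    simpa [Pi.single_apply] using this
  have hs0 : ∀ i, 0 < α ![s i, I (s i)] := fun i => by
    refine hα _ fun h0 => ?_
    have := hzs i i
    rw [h0, map_zero, if_pos rfl] at this
    exact zero_ne_one this
  refine ⟨s 0, s 1, s 2, ?_⟩
  -- On the complex basis s dual to z each product of two area forms sees only its own two
  -- coordinates, so the wedge with α leaves the value of α on the third complex line.
  have hval : wedge (l 0 • wedge (areaForm (z 1)) (areaForm (z 2))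
        + l 1 • wedge (areaForm (z 2)) (areaForm (z 0))
        + l 2 • wedge (areaForm (z 0)) (areaForm (z 1))) α
        ![s 0, I (s 0), s 1, I (s 1), s 2, I (s 2)]
      = l 0 * α ![s 0, I (s 0)] + l 1 * α ![s 1, I (s 1)] + l 2 * α ![s 2, I (s 2)] := by
    rw [wedge_four_two]
    simp only [AlternatingMap.add_apply, AlternatingMap.smul_apply, wedge_two_two, areaForm_apply,
      hzI, hzs]
    simp
    ring
  rw [hval]
  have h0 := mul_nonneg (hl 0) (hs0 0).le
  have h1 := mul_nonneg (hl 1) (hs0 1).le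
  have h2 := mul_nonneg (hl 2) (hs0 2).le
  have hi' := mul_pos hi (hs0 i)
  fin_cases i
  · change 0 < l 0 * α ![s 0, I (s 0)] at hi'
    linarith
  · change 0 < l 1 * α ![s 1, I (s 1)] at hi'
    linarith
  · change 0 < l 2 * α ![s 2, I (s 2)] at hi'
    linarith

end SemiPositive

/-! ### The formulas on the manifold. -/

section Main

variable {M : Type*} [TopologicalSpace M] [ChartedSpace (EuclideanSpace ℝ (Fin 7)) M]
  {N : Type*} [TopologicalSpace N] [ChartedSpace (EuclideanSpace ℝ (Fin 6)) N]
  {o : PointwiseOrientation M} {φ : DiffForm 7 M 3} {f : N → M}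
  {ν : ∀ p : N, TangentSpace (𝓡 7) (f p)} {p : N}
  {e : Module.Basis (Fin 7) ℝ (EuclideanSpace ℝ (Fin 7))}
  {t : Module.Basis (Fin 6) ℝ (EuclideanSpace ℝ (Fin 6))}

/-- The form `ω`, with the tangent space identified with the model space. -/
def omegaAt (φ : DiffForm 7 M 3) (f : N → M) (ν : ∀ p : N, TangentSpace (𝓡 7) (f p)) (p : N) :
    EuclideanSpace ℝ (Fin 6) [⋀^Fin 2]→ₗ[ℝ] ℝ :=
  ((formAt φ (f p)).toAlternatingMap.curryLeft (normalAt ν p)).compLinearMap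
    (differentialAt f p).toLinearMap

/-- The form `dρ̃`, with the tangent space identified with the model space. -/
def dRhoTildeAt (o : PointwiseOrientation M) (φ : DiffForm 7 M 3) (f : N → M)
    (ν : ∀ p : N, TangentSpace (𝓡 7) (f p)) (p : N) :
    EuclideanSpace ℝ (Fin 6) [⋀^Fin 4]→ₗ[ℝ] ℝ :=
  (extDeriv (formInChart (rhoTilde o φ f ν) p) (extChartAt (𝓡 6) p p)).toAlternatingMap

/-- The second fundamental form at `p` in the charts at `p` and `f p`. -/
def shapeFormAt (φ : DiffForm 7 M 3) (f : N → M) (ν : ∀ p : N, TangentSpace (𝓡 7) (f p)) (p : N) :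
    EuclideanSpace ℝ (Fin 6) →ₗ[ℝ] EuclideanSpace ℝ (Fin 6) →ₗ[ℝ] ℝ :=
  shapeForm (bilinInChart (g2Metric φ) (f p)) (writtenInExtChartAt (𝓡 6) (𝓡 7) p f)
    (normalInChart f ν p) (extChartAt (𝓡 6) p p)

theorem omegaAt_apply (X Y : EuclideanSpace ℝ (Fin 6)) : omegaAt φ f ν p ![X, Y]
    = tri (formAt φ (f p)).toAlternatingMap (normalAt ν p) (differentialAt f p X)
      (differentialAt f p Y) := by
  rw [tri_apply, omegaAt, AlternatingMap.compLinearMap_apply, AlternatingMap.curryLeft_apply_apply]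
  congr 1
  ext1 i
  fin_cases i <;> rfl

theorem tri_fderiv_of_parallel (hpar : IsTorsionFree φ) (x : M)
    (a u v w : EuclideanSpace ℝ (Fin 7)) :
    tri (fderiv ℝ (formInChart φ x) (extChartAt (𝓡 7) x x) a).toAlternatingMap u v w
      = tri (formAt φ x).toAlternatingMap
          (christoffel (bilinInChart (g2Metric φ) x) (extChartAt (𝓡 7) x x) a u) v w
        + tri (formAt φ x).toAlternatingMap u
          (christoffel (bilinInChart (g2Metric φ) x) (extChartAt (𝓡 7) x x) a v) w
        + tri (formAt φ x).toAlternatingMap u v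
          (christoffel (bilinInChart (g2Metric φ) x) (extChartAt (𝓡 7) x x) a w) := by
  have h : fderiv ℝ (formInChart φ x) (extChartAt (𝓡 7) x x) a ![u, v, w]
      - ∑ i, formAt φ x (Function.update ![u, v, w] i
        (christoffel (bilinInChart (g2Metric φ) x) (extChartAt (𝓡 7) x x) a (![u, v, w] i))) = 0 :=
    hpar x a ![u, v, w]
  have e1 : ∀ y : EuclideanSpace ℝ (Fin 7), Function.update ![u, v, w] 0 y = ![y, v, w] :=
    fun y => by
      ext1 i
      fin_cases i <;> rfl
  have e2 : ∀ y : EuclideanSpace ℝ (Fin 7), Function.update ![u, v, w] 1 y = ![u, y, w] :=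
    fun y => by
      ext1 i
      fin_cases i <;> rfl
  have e3 : ∀ y : EuclideanSpace ℝ (Fin 7), Function.update ![u, v, w] 2 y = ![u, v, y] :=
    fun y => by
      ext1 i
      fin_cases i <;> rfl
  rw [Fin.sum_univ_three, e1, e2, e3, sub_eq_zero] at h
  exact h

variable [IsManifold (𝓡 7) ∞ M] [IsManifold (𝓡 6) ∞ N]

theorem fderiv_writtenInExtChartAt_self (hf : ContMDiff (𝓡 6) (𝓡 7) ∞ f) (p : N) :
    fderiv ℝ (writtenInExtChartAt (𝓡 6) (𝓡 7) p f) (extChartAt (𝓡 6) p p) = differentialAt f p := by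
  refine ContinuousLinearMap.ext fun X => ?_
  rw [fderiv_writtenInExtChartAt hf p (mem_extChartAt_target p) (by
    rw [extChartAt_to_inv]
    exact mem_extChartAt_source (f p)), chartInvDeriv_self, extChartAt_to_inv, chartDeriv_self]

theorem isTangentFrame_chart (hf : ContMDiff (𝓡 6) (𝓡 7) ∞ f)
    (ht : IsTangentFrame (formAt φ (f p)).toAlternatingMap (normalAt ν p)
      (differentialAt f p).toLinearMap e t) :
    IsTangentFrame (formInChart φ (f p) (writtenInExtChartAt (𝓡 6) (𝓡 7) p f
        (extChartAt (𝓡 6) p p))).toAlternatingMap (normalInChart f ν p (extChartAt (𝓡 6) p p))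
      (fderiv ℝ (writtenInExtChartAt (𝓡 6) (𝓡 7) p f) (extChartAt (𝓡 6) p p)).toLinearMap e t := by
  rw [fderiv_writtenInExtChartAt_self hf, normalInChart_self, writtenInExtChartAt_self,
    formInChart_self]
  exact ht

theorem omegaAt_eq_chart (hf : ContMDiff (𝓡 6) (𝓡 7) ∞ f) : omegaAt φ f ν p
    = ((formInChart φ (f p) (writtenInExtChartAt (𝓡 6) (𝓡 7) p f
        (extChartAt (𝓡 6) p p))).toAlternatingMap.curryLeft
          (normalInChart f ν p (extChartAt (𝓡 6) p p))).compLinearMap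
      (fderiv ℝ (writtenInExtChartAt (𝓡 6) (𝓡 7) p f) (extChartAt (𝓡 6) p p)).toLinearMap := by
  rw [fderiv_writtenInExtChartAt_self hf, normalInChart_self, writtenInExtChartAt_self,
    formInChart_self]
  rfl

theorem isChristoffel_christoffel (hφ : IsG2Structure o φ) (x : M) :
    IsChristoffel (bilinInChart (g2Metric φ) x) (extChartAt (𝓡 7) x x)
      (christoffel (bilinInChart (g2Metric φ) x) (extChartAt (𝓡 7) x x)) :=
  fun u v w => metric_christoffel (hφ.isLocalMetric x).isInvertible u v w

theorem bilinInChart_self (hφ : IsG2Structure o φ) (x : M) (u v : EuclideanSpace ℝ (Fin 7)) :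
    bilinInChart (g2Metric φ) x (extChartAt (𝓡 7) x x) u v
      = inducedMetric (formAt φ x).toAlternatingMap u v := by
  rw [(hφ.isLocalMetric x).metric.self_of_nhds, formInChart_self]

/-- At the base point the charts are the identity on tangent spaces, so both sides are the metric
product of D²F + Γ with the normal. -/
theorem secondFundamentalForm_eq (hφ : IsG2Structure o φ) (hf : ContMDiff (𝓡 6) (𝓡 7) ∞ f)
    (himm : ∀ p, Function.Injective (mfderiv (𝓡 6) (𝓡 7) f p))
    (hν : IsUnitNormal (g2Metric φ) f ν) (p : N) (X Y : EuclideanSpace ℝ (Fin 6)) :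
    secondFundamentalForm (g2Metric φ) f ν p X Y = shapeFormAt φ f ν p X Y := by
  have h := isLocalHypersurface hφ hf himm hν p
  have hΓ := isChristoffel_christoffel hφ (f p)
  rw [← writtenInExtChartAt_self (f := f)] at hΓ
  rw [shapeFormAt, h.shapeForm_eq hΓ, writtenInExtChartAt_self, bilinInChart_self hφ,
    normalInChart_self, fderiv_writtenInExtChartAt_self hf]
  rfl

theorem meanCurvature_eq (hφ : IsG2Structure o φ) (hf : ContMDiff (𝓡 6) (𝓡 7) ∞ f)
    (himm : ∀ p, Function.Injective (mfderiv (𝓡 6) (𝓡 7) f p))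
    (hν : IsUnitNormal (g2Metric φ) f ν)
    (ht : IsTangentFrame (formAt φ (f p)).toAlternatingMap (normalAt ν p)
      (differentialAt f p).toLinearMap e t) :
    meanCurvature (g2Metric φ) f ν p = ∑ i, shapeFormAt φ f ν p (t i) (t i) := by
  rw [← metricTrace_eq t]
  have h1 : (inducedMetric (formAt φ (f p)).toAlternatingMap).compl₁₂
      (differentialAt f p).toLinearMap (differentialAt f p).toLinearMap = frameMetric t := by
    ext X Y
    rw [LinearMap.compl₁₂_apply, ht.adapted.inducedMetric_eq, ht.frameMetric_eq]
  have h2 : (fun X Y : EuclideanSpace ℝ (Fin 6) => secondFundamentalForm (g2Metric φ) f ν p X Y)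
      = fun X Y => shapeFormAt φ f ν p X Y := by
    funext X Y
    exact secondFundamentalForm_eq hφ hf himm hν p X Y
  rw [← h1, ← h2]
  rfl

theorem tri_fderiv_of_closed (hφ : IsG2Structure o φ) (hcl : IsClosedForm φ) (x : M)
    (a b c d : EuclideanSpace ℝ (Fin 7)) :
    tri (fderiv ℝ (formInChart φ x) (extChartAt (𝓡 7) x x) a).toAlternatingMap b c d
      - tri (fderiv ℝ (formInChart φ x) (extChartAt (𝓡 7) x x) b).toAlternatingMap a c d
      + tri (fderiv ℝ (formInChart φ x) (extChartAt (𝓡 7) x x) c).toAlternatingMap a b d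
      - tri (fderiv ℝ (formInChart φ x) (extChartAt (𝓡 7) x x) d).toAlternatingMap a b c = 0 := by
  have h0 : extDeriv (formInChart φ x) (extChartAt (𝓡 7) x x) = 0 := hcl x
  have hd := (hφ.isLocalMetric x).form
  have h1 := extDeriv_apply hd ![a, b, c, d]
  have e0 : Fin.removeNth 0 ![a, b, c, d] = ![b, c, d] := by ext1 i; fin_cases i <;> rfl
  have e1 : Fin.removeNth 1 ![a, b, c, d] = ![a, c, d] := by ext1 i; fin_cases i <;> rfl
  have e2 : Fin.removeNth 2 ![a, b, c, d] = ![a, b, d] := by ext1 i; fin_cases i <;> rfl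
  have e3 : Fin.removeNth 3 ![a, b, c, d] = ![a, b, c] := by ext1 i; fin_cases i <;> rfl
  have hap : ∀ v u, fderiv ℝ (fun z => formInChart φ x z v) (extChartAt (𝓡 7) x x) u
      = fderiv ℝ (formInChart φ x) (extChartAt (𝓡 7) x x) u v := fun v u =>
    congrArg (fun T => T u)
      ((ContinuousAlternatingMap.apply ℝ (EuclideanSpace ℝ (Fin 7)) ℝ v).hasFDerivAt.comp
        (extChartAt (𝓡 7) x x) hd.hasFDerivAt).fderiv
  rw [h0, Fin.sum_univ_four, e0, e1, e2, e3, hap, hap, hap, hap] at h1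
  generalize extChartAt (𝓡 7) x x = z at h1 ⊢
  simp only [Fin.val_zero, pow_zero, one_smul] at h1
  norm_num at h1
  have c2 : ![a, b, c, d] 2 = c := rfl
  have c3 : ![a, b, c, d] 3 = d := rfl
  rw [c2, c3] at h1
  simp only [tri_apply, ContinuousAlternatingMap.coe_toAlternatingMap]
  linarith

set_option maxRecDepth 4000 in
/-- The formula `dρ̃ ∧ ω = 2 μ vol` evaluated on the frame. -/
theorem wedge_dRhoTildeAt (hφ : IsG2Structure o φ) (hf : ContMDiff (𝓡 6) (𝓡 7) ∞ f)
    (himm : ∀ p, Function.Injective (mfderiv (𝓡 6) (𝓡 7) f p))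
    (hν : IsUnitNormal (g2Metric φ) f ν) (heo : e.orientation = orientationAt o (f p))
    (ht : IsTangentFrame (formAt φ (f p)).toAlternatingMap (normalAt ν p)
      (differentialAt f p).toLinearMap e t)
    (hcl : ∀ a b c d : EuclideanSpace ℝ (Fin 7),
      tri (fderiv ℝ (formInChart φ (f p)) (extChartAt (𝓡 7) (f p) (f p)) a).toAlternatingMap b c d
      - tri (fderiv ℝ (formInChart φ (f p)) (extChartAt (𝓡 7) (f p) (f p)) b).toAlternatingMap a c d
      + tri (fderiv ℝ (formInChart φ (f p)) (extChartAt (𝓡 7) (f p) (f p)) c).toAlternatingMap a b d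
      - tri (fderiv ℝ (formInChart φ (f p)) (extChartAt (𝓡 7) (f p) (f p)) d).toAlternatingMap a b c
      = 0) :
    wedge (dRhoTildeAt o φ f ν p) (omegaAt φ f ν p) t
      = 2 * meanCurvature (g2Metric φ) f ν p := by
  have h := isLocalHypersurface hφ hf himm hν p
  rw [← writtenInExtChartAt_self (f := f)] at hcl
  have h1 := h.wedge_extDeriv_of_closed (isTangentFrame_chart hf ht) (by
    rw [formInChart_self, toAlternatingMap_rhoTilde heo ht, writtenInExtChartAt_self,
      formInChart_self, fderiv_writtenInExtChartAt_self hf]) hcl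
  rw [meanCurvature_eq hφ hf himm hν ht, omegaAt_eq_chart hf]
  exact h1

end Main

theorem eq_of_apply_basis {W : Type*} [AddCommGroup W] [Module ℝ W]
    (t : Module.Basis (Fin 6) ℝ W) {α γ : W [⋀^Fin 6]→ₗ[ℝ] ℝ} (h : α t = γ t) : α = γ := by
  rw [α.eq_smul_basis_det t, γ.eq_smul_basis_det t, h]

theorem eq_of_apply_four {W : Type*} [AddCommGroup W] [Module ℝ W] {α γ : W [⋀^Fin 4]→ₗ[ℝ] ℝ}
    (h : ∀ a b c d, α ![a, b, c, d] = γ ![a, b, c, d]) : α = γ := by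
  refine AlternatingMap.ext fun v => ?_
  have hv : v = ![v 0, v 1, v 2, v 3] := by
    ext1 i
    fin_cases i <;> rfl
  rw [hv, h]

section Main

variable {M : Type*} [TopologicalSpace M] [ChartedSpace (EuclideanSpace ℝ (Fin 7)) M]
  {N : Type*} [TopologicalSpace N] [ChartedSpace (EuclideanSpace ℝ (Fin 6)) N]
  {o : PointwiseOrientation M} {φ : DiffForm 7 M 3} {f : N → M}
  {ν : ∀ p : N, TangentSpace (𝓡 7) (f p)} {p : N}
  {e : Module.Basis (Fin 7) ℝ (EuclideanSpace ℝ (Fin 7))}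
  {t : Module.Basis (Fin 6) ℝ (EuclideanSpace ℝ (Fin 6))}

theorem omegaAt_complex_pos (ht : IsTangentFrame (formAt φ (f p)).toAlternatingMap (normalAt ν p)
      (differentialAt f p).toLinearMap e t) (X : EuclideanSpace ℝ (Fin 6)) (hX : X ≠ 0) :
    0 < omegaAt φ f ν p ![X, frameComplex t X] := by
  have h := ht.normal_eq_metric X (frameComplex t X)
  rw [frameComplex_sq, map_neg, neg_neg] at h
  rw [omegaAt_apply]
  exact h ▸ frameMetric_pos t X hX

-- The value is |Ω(x, y, z)|² for Ω = ρ + iρ̃.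
set_option maxRecDepth 4000 in
theorem volAt_complex_nonneg (heo : e.orientation = orientationAt o (f p))
    (ht : IsTangentFrame (formAt φ (f p)).toAlternatingMap (normalAt ν p)
      (differentialAt f p).toLinearMap e t) (x y z : EuclideanSpace ℝ (Fin 6)) :
    0 ≤ volAt o φ f ν p
      ![x, frameComplex t x, y, frameComplex t y, z, frameComplex t z] := by
  have hρ : (formAt (rho φ f) p).toAlternatingMap = (formAt φ (f p)).toAlternatingMap.compLinearMap
    (differentialAt f p).toLinearMap := rfl
  have h := ht.isComplexType_frameComplex.wedge_complex_basis x y z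
  rw [volAt_eq, volumeElement, AlternatingMap.smul_apply, ht.toAlternatingMap_companion heo hρ, hρ,
    smul_eq_mul]
  refine mul_nonneg (by norm_num) ?_
  refine le_of_le_of_eq ?_ h.symm
  positivity

/-- The form `β₁₁` in the frame `t`. -/
def betaAt (φ : DiffForm 7 M 3) (f : N → M) (ν : ∀ p : N, TangentSpace (𝓡 7) (f p)) (p : N)
    (t : Module.Basis (Fin 6) ℝ (EuclideanSpace ℝ (Fin 6)))
    (hs : ∀ X Y, shapeFormAt φ f ν p X Y = shapeFormAt φ f ν p Y X) :
    EuclideanSpace ℝ (Fin 6) [⋀^Fin 2]→ₗ[ℝ] ℝ :=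
  twoForm ((1 / 2 : ℝ) • ((shapeFormAt φ f ν p).comp (frameComplex t)
    - (shapeFormAt φ f ν p).compl₂ (frameComplex t))) fun X => by
      simp [hs (frameComplex t X) X]

theorem betaAt_apply (hs : ∀ X Y, shapeFormAt φ f ν p X Y = shapeFormAt φ f ν p Y X)
    (X Y : EuclideanSpace ℝ (Fin 6)) : betaAt φ f ν p t hs ![X, Y]
      = 1 / 2 * (shapeFormAt φ f ν p (frameComplex t X) Y
        - shapeFormAt φ f ν p X (frameComplex t Y)) := rfl

variable [IsManifold (𝓡 7) ∞ M]

/-- Alternating ∇φ = 0 leaves dφ = 0, since the Christoffel terms cancel by symmetry of Γ. -/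
theorem tri_fderiv_closed_of_parallel (hφ : IsG2Structure o φ) (hpar : IsTorsionFree φ) (x : M)
    (a b c d : EuclideanSpace ℝ (Fin 7)) :
    tri (fderiv ℝ (formInChart φ x) (extChartAt (𝓡 7) x x) a).toAlternatingMap b c d
      - tri (fderiv ℝ (formInChart φ x) (extChartAt (𝓡 7) x x) b).toAlternatingMap a c d
      + tri (fderiv ℝ (formInChart φ x) (extChartAt (𝓡 7) x x) c).toAlternatingMap a b d
      - tri (fderiv ℝ (formInChart φ x) (extChartAt (𝓡 7) x x) d).toAlternatingMap a b c = 0 := by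
  have hs := (hφ.isLocalMetric x).christoffel_symm (isChristoffel_christoffel hφ x)
  simp only [tri_fderiv_of_parallel hpar]
  rw [hs b a, hs c a, hs c b, hs d a, hs d b, hs d c, tri_swap _ b,
    tri_rotate _ (christoffel (bilinInChart (g2Metric φ) x) (extChartAt (𝓡 7) x x) a d),
    tri_swap' _ a _ c]
  ring

-- On a suitable complex basis ½ dρ̃ ∧ ω = μ vol is positive and vol is non-negative, so μ > 0; it
-- need not be checked separately that these vectors form a basis.
set_option maxRecDepth 4000 in
theorem meanCurvature_pos (hφ : IsG2Structure o φ)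
    (himm : ∀ p, Function.Injective (mfderiv (𝓡 6) (𝓡 7) f p))
    (hν : IsUnitNormal (g2Metric φ) f ν) (p : N) (hμ : MeanCurvatureFormula o φ f ν p)
    (hconv : IsSemiPositive (almostComplex o φ f ν p) (dRhoTilde o φ f ν p)) :
    0 < meanCurvature (g2Metric φ) f ν p := by
  obtain ⟨e, t, heo, ht⟩ := exists_isTangentFrame_differential hφ himm hν p
  have hI : (fun X : EuclideanSpace ℝ (Fin 6) => frameComplex t X) = almostComplex o φ f ν p :=
    funext fun X => (almostComplex_apply heo ht X).symm
  have hσ : IsSemiPositive (fun X : EuclideanSpace ℝ (Fin 6) => frameComplex t X)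
      (dRhoTildeAt o φ f ν p) := by
    rw [hI]
    exact hconv
  obtain ⟨x, y, z, hpos⟩ := hσ.exists_wedge_pos (omegaAt_complex_pos ht)
  have hvol := volAt_complex_nonneg heo ht x y z
  have h : (1 / 2 : ℝ) * wedge (dRhoTildeAt o φ f ν p) (omegaAt φ f ν p)
        ![x, frameComplex t x, y, frameComplex t y, z, frameComplex t z]
      = meanCurvature (g2Metric φ) f ν p * volAt o φ f ν p
        ![x, frameComplex t x, y, frameComplex t y, z, frameComplex t z] :=
    congrArg (fun Θ : EuclideanSpace ℝ (Fin 6) [⋀^Fin 6]→ₗ[ℝ] ℝ =>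
      Θ ![x, frameComplex t x, y, frameComplex t y, z, frameComplex t z]) hμ.2
  refine pos_of_mul_pos_left ?_ hvol
  rw [← h]
  exact mul_pos (by norm_num) hpos

variable [IsManifold (𝓡 6) ∞ N]

/-- Both sides are 6-forms in dimension 6, so comparing them on the frame, where vol is 1, suffices.
-/
theorem half_wedge_dRhoTildeAt (hφ : IsG2Structure o φ) (hf : ContMDiff (𝓡 6) (𝓡 7) ∞ f)
    (himm : ∀ p, Function.Injective (mfderiv (𝓡 6) (𝓡 7) f p))
    (hν : IsUnitNormal (g2Metric φ) f ν) (heo : e.orientation = orientationAt o (f p))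
    (ht : IsTangentFrame (formAt φ (f p)).toAlternatingMap (normalAt ν p)
      (differentialAt f p).toLinearMap e t)
    (hcl : ∀ a b c d : EuclideanSpace ℝ (Fin 7),
      tri (fderiv ℝ (formInChart φ (f p)) (extChartAt (𝓡 7) (f p) (f p)) a).toAlternatingMap b c d
      - tri (fderiv ℝ (formInChart φ (f p)) (extChartAt (𝓡 7) (f p) (f p)) b).toAlternatingMap a c d
      + tri (fderiv ℝ (formInChart φ (f p)) (extChartAt (𝓡 7) (f p) (f p)) c).toAlternatingMap a b d
      - tri (fderiv ℝ (formInChart φ (f p)) (extChartAt (𝓡 7) (f p) (f p)) d).toAlternatingMap a b c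
      = 0) :
    (1 / 2 : ℝ) • wedge (dRhoTildeAt o φ f ν p) (omegaAt φ f ν p)
      = meanCurvature (g2Metric φ) f ν p • volAt o φ f ν p := by
  have h := wedge_dRhoTildeAt hφ hf himm hν heo ht hcl
  have hv := volAt_frame heo ht
  refine eq_of_apply_basis t ?_
  have h1 : ((1 / 2 : ℝ) • wedge (dRhoTildeAt o φ f ν p) (omegaAt φ f ν p)) t
      = 1 / 2 * wedge (dRhoTildeAt o φ f ν p) (omegaAt φ f ν p) t := rfl
  have h2 : (meanCurvature (g2Metric φ) f ν p • volAt o φ f ν p) t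
      = meanCurvature (g2Metric φ) f ν p * volAt o φ f ν p t := rfl
  rw [hv] at h2
  rw [h] at h1
  refine Eq.trans h1 (Eq.trans ?_ h2.symm)
  ring

set_option maxRecDepth 4000 in
theorem meanCurvatureFormula (hφ : IsG2Structure o φ) (hf : ContMDiff (𝓡 6) (𝓡 7) ∞ f)
    (himm : ∀ p, Function.Injective (mfderiv (𝓡 6) (𝓡 7) f p))
    (hν : IsUnitNormal (g2Metric φ) f ν) (p : N)
    (hcl : ∀ a b c d : EuclideanSpace ℝ (Fin 7),
      tri (fderiv ℝ (formInChart φ (f p)) (extChartAt (𝓡 7) (f p) (f p)) a).toAlternatingMap b c d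
      - tri (fderiv ℝ (formInChart φ (f p)) (extChartAt (𝓡 7) (f p) (f p)) b).toAlternatingMap a c d
      + tri (fderiv ℝ (formInChart φ (f p)) (extChartAt (𝓡 7) (f p) (f p)) c).toAlternatingMap a b d
      - tri (fderiv ℝ (formInChart φ (f p)) (extChartAt (𝓡 7) (f p) (f p)) d).toAlternatingMap a b c
      = 0) : MeanCurvatureFormula o φ f ν p := by
  obtain ⟨e, t, heo, ht⟩ := exists_isTangentFrame_differential hφ himm hν p
  refine ⟨fun h0 => ?_, half_wedge_dRhoTildeAt hφ hf himm hν heo ht hcl⟩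
  have h1 : volAt o φ f ν p = 0 := h0
  have h2 := volAt_frame heo ht
  rw [h1] at h2
  exact zero_ne_one h2

theorem shapeFormAt_symm (hφ : IsG2Structure o φ) (hf : ContMDiff (𝓡 6) (𝓡 7) ∞ f)
    (himm : ∀ p, Function.Injective (mfderiv (𝓡 6) (𝓡 7) f p))
    (hν : IsUnitNormal (g2Metric φ) f ν) (p : N) (X Y : EuclideanSpace ℝ (Fin 6)) :
    shapeFormAt φ f ν p X Y = shapeFormAt φ f ν p Y X := by
  have hΓ := isChristoffel_christoffel hφ (f p)
  rw [← writtenInExtChartAt_self (f := f)] at hΓ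
  exact (isLocalHypersurface hφ hf himm hν p).shapeForm_symm hΓ X Y

/-- Substituting IX into the Hermitian part gives ½(B(IX, Y) + B(I²X, IY)), and I² = −1 turns the
second term into −B(X, IY). -/
theorem isBeta11_betaAt (hφ : IsG2Structure o φ) (hf : ContMDiff (𝓡 6) (𝓡 7) ∞ f)
    (himm : ∀ p, Function.Injective (mfderiv (𝓡 6) (𝓡 7) f p))
    (hν : IsUnitNormal (g2Metric φ) f ν) (heo : e.orientation = orientationAt o (f p))
    (ht : IsTangentFrame (formAt φ (f p)).toAlternatingMap (normalAt ν p)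
      (differentialAt f p).toLinearMap e t)
    (hs : ∀ X Y, shapeFormAt φ f ν p X Y = shapeFormAt φ f ν p Y X) :
    IsBeta11 o φ f ν p (betaAt φ f ν p t hs) := by
  have hI := almostComplex_apply heo ht
  have h : ∀ X Y : EuclideanSpace ℝ (Fin 6), betaAt φ f ν p t hs ![X, Y]
      = 1 / 2 * (secondFundamentalForm (g2Metric φ) f ν p (frameComplex t X) Y
        + secondFundamentalForm (g2Metric φ) f ν p (frameComplex t (frameComplex t X))
          (frameComplex t Y)) := fun X Y => by
    rw [betaAt_apply, secondFundamentalForm_eq hφ hf himm hν p,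
      secondFundamentalForm_eq hφ hf himm hν p, frameComplex_sq, map_neg, LinearMap.neg_apply,
      sub_eq_add_neg]
  intro X Y
  rw [hermitianPart, hI X, hI Y, hI (frameComplex t X)]
  exact h X Y

theorem wedge_betaAt (hφ : IsG2Structure o φ) (hpar : IsTorsionFree φ)
    (hf : ContMDiff (𝓡 6) (𝓡 7) ∞ f)
    (himm : ∀ p, Function.Injective (mfderiv (𝓡 6) (𝓡 7) f p))
    (hν : IsUnitNormal (g2Metric φ) f ν)
    (ht : IsTangentFrame (formAt φ (f p)).toAlternatingMap (normalAt ν p)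
      (differentialAt f p).toLinearMap e t)
    (hs : ∀ X Y, shapeFormAt φ f ν p X Y = shapeFormAt φ f ν p Y X) :
    wedge (betaAt φ f ν p t hs) (omegaAt φ f ν p) = (1 / 2 : ℝ) • dRhoTildeAt o φ f ν p := by
  have h := isLocalHypersurface hφ hf himm hν p
  have hΓ := isChristoffel_christoffel hφ (f p)
  have hp := tri_fderiv_of_parallel hpar (f p)
  rw [← formInChart_self φ (f p)] at hp
  rw [← writtenInExtChartAt_self (f := f)] at hΓ hp
  refine eq_of_apply_four fun U X Y Z => ?_
  have h1 := h.extDeriv_of_parallel (isTangentFrame_chart hf ht) hΓ hp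
    (β := fun X Y => betaAt φ f ν p t hs ![X, Y]) (fun X Y => betaAt_apply hs X Y) U X Y Z
  rw [writtenInExtChartAt_self, formInChart_self, fderiv_writtenInExtChartAt_self hf,
    normalInChart_self] at h1
  have h2 : dRhoTildeAt o φ f ν p ![U, X, Y, Z] = _ := h1
  rw [AlternatingMap.smul_apply, h2]
  refine (wedge_two_two _ _ U X Y Z).trans ?_
  simp only [omegaAt_apply, smul_eq_mul]
  ring

end Main

end G2Geometry
end

theorem proposition1
    {M : Type*} [TopologicalSpace M] [ChartedSpace (EuclideanSpace ℝ (Fin 7)) M]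
    [IsManifold (𝓡 7) ∞ M]
    {N : Type*} [TopologicalSpace N] [ChartedSpace (EuclideanSpace ℝ (Fin 6)) N]
    [IsManifold (𝓡 6) ∞ N]
    (o : G2Geometry.PointwiseOrientation M) (φ : G2Geometry.DiffForm 7 M 3)
    (hφ : G2Geometry.IsG2Structure o φ)
    (f : N → M) (hf : ContMDiff (𝓡 6) (𝓡 7) ∞ f)
    (himm : ∀ p, Function.Injective (mfderiv (𝓡 6) (𝓡 7) f p))
    (ν : ∀ p : N, TangentSpace (𝓡 7) (f p))
    (hν : G2Geometry.IsUnitNormal (G2Geometry.g2Metric φ) f ν) :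
    (G2Geometry.IsTorsionFree φ →
      (∀ p, ∃ β, G2Geometry.IsBeta11 o φ f ν p β ∧
        G2Geometry.wedge β (G2Geometry.omega φ f ν p)
          = (1 / 2 : ℝ) • G2Geometry.dRhoTilde o φ f ν p) ∧
      (∀ p, G2Geometry.MeanCurvatureFormula o φ f ν p) ∧
      (G2Geometry.IsMeanConvex o φ f ν →
        ∀ p, 0 < G2Geometry.meanCurvature (G2Geometry.g2Metric φ) f ν p)) ∧
    (G2Geometry.IsClosedForm φ →
      ∀ p, G2Geometry.MeanCurvatureFormula o φ f ν p) := by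
  refine ⟨fun hpar => ?_, fun hcl p =>
    G2Geometry.meanCurvatureFormula hφ hf himm hν p (G2Geometry.tri_fderiv_of_closed hφ hcl (f p))⟩
  -- A parallel form is closed, so the mean curvature formula of the closed case applies.
  have hμ : ∀ p, G2Geometry.MeanCurvatureFormula o φ f ν p := fun p =>
    G2Geometry.meanCurvatureFormula hφ hf himm hν p
      (G2Geometry.tri_fderiv_closed_of_parallel hφ hpar (f p))
  refine ⟨fun p => ?_, hμ, fun hconv p =>
    G2Geometry.meanCurvature_pos hφ himm hν p (hμ p) (hconv p)⟩
  obtain ⟨e, t, heo, ht⟩ := G2Geometry.exists_isTangentFrame_differential hφ himm hν p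
  have hs := G2Geometry.shapeFormAt_symm hφ hf himm hν p
  exact ⟨G2Geometry.betaAt φ f ν p t hs, G2Geometry.isBeta11_betaAt hφ hf himm hν heo ht hs,
    G2Geometry.wedge_betaAt hφ hpar hf himm hν ht hs⟩
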